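/- Let $n\ge 0$, $\hbar>0$, $\varkappa\in\mathbb R$. Consider on $\mathbb R^n$ the nonlocal Gross--Pitaevskii equation $$\Big\{-i\hbar\partial_t+\mathcal H(\hat z,t)+\varkappa\int_{\mathbb R^n}d\vec y\,\Psi^*(\vec y,t)V(\hat z,\hat w,t)\Psi(\vec y,t)\Big\}\Psi(\vec x,t)=0,$$ $\hat z=(\hat{\vec p},\vec x)=(-i\hbar\partial_{\vec x},\vec x)$, $\hat w=(-i\hbar\partial_{\vec y},\vec y)$, with the quadratic (Weyl-ordered) symbols $$\mathcal H(z,t)=\tfrac12\langle z,\mathcal H_{zz}(t)z\rangle+\langle\mathcal H_z(t),z\rangle,\qquad V(z,w,t)=\tfrac12\langle z,W_{zz}(t)z\rangle+\langle z,W_{zw}(t)w\rangle+\tfrac12\langle w,W_{ww}(t)w\rangle,$$ whose real coefficients are continuous in $t\in\mathbb R$, with $\mathcal H_{zz},W_{zz},W_{ww}$ symmetric. *Evolution operator.* Let $J=\begin{pmatrix}0&-\mathbb I\\ \mathbb I&0\end{pmatrix}$. For a nonzero Schwartz function $\psi$ put $\tilde\varkappa=\varkappa\|\psi\|^2$ and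 $\mathfrak H_{zz}=\mathcal H_{zz}+\tilde\varkappa W_{zz}$. Let $\mathfrak g(t)=(z(t),\Delta(t))$, $z=(\vec P,\vec X)$, be the solution of the Hamilton--Ehrenfest system $$\dot z=J\{\mathcal H_z+[\mathcal H_{zz}+\tilde\varkappa(W_{zz}+W_{zw})]z\},\qquad \dot\Delta=J\mathfrak H_{zz}\Delta-\Delta\mathfrak H_{zz}J,$$ whose value at $t=s$ consists of the mean values $z_\psi=\langle\hat z\rangle_\psi$ and the symmetrized second centred moments $\frac12\langle\Delta\hat z_j\Delta\hat z_k+\Delta\hat z_k\Delta\hat z_j\rangle_\psi$ of $\psi$, where $\Delta\hat z=\hat z-z_\psi$ and $\langle\hat A\rangle_\psi=\langle\psi|\hat A|\psi\rangle/\|\psi\|^2$. Let $$\mathfrak H=\tfrac12\langle z,[\mathcal H_{zz}+\tilde\varkappa(W_{zz}+2W_{zw}+W_{ww})]z\rangle+\langle\mathcal H_z,z\rangle+\tfrac12\tilde\varkappa\,\mathrm{Sp}(W_{ww}\Delta),\qquad S(t)=\int_0^t\{\langle\vec P,\dot{\vec X}\rangle-\mathfrak H\}\,d\tau.$$ Let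 $\mathcal A(t,s)=\begin{pmatrix}\lambda_4^\intercal&-\lambda_2^\intercal\\-\lambda_3^\intercal&\lambda_1^\intercal\end{pmatrix}$ be the solution of $\dot{\mathcal A}=J\mathfrak H_{zz}(t)\mathcal A$, $\mathcal A(s,s)=\mathbb I$. For $\det\lambda_3(t,s)\neq0$ put $$\hat U_\varkappa(t,s,\psi)(\vec x)=\int_{\mathbb R^n}G(\vec x,\vec y,t,s)\,\psi(\vec y)\,d\vec y,$$ $$G=\frac{1}{\sqrt{\det(-2\pi i\hbar\lambda_3)}}\exp\Big\{\frac i\hbar\Big[S(t)-S(s)+\langle\vec P(t),\Delta\vec x\rangle-\langle\vec P(s),\Delta\vec y\rangle-\tfrac12\langle\Delta\vec y,\lambda_1\lambda_3^{-1}\Delta\vec y\rangle+\langle\Delta\vec x,\lambda_3^{-1}\Delta\vec y\rangle-\tfrac12\langle\Delta\vec x,\lambda_3^{-1}\lambda_4\Delta\vec x\rangle\Big]\Big\},$$ $\Delta\vec x=\vec x-\vec X(t)$, $\Delta\vec y=\vec y-\vec X(s)$. Let $G_\varepsilon$ ($\varepsilon>0$) be the same expression with $\lambda_3,\lambda_4$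 replaced by $\lambda_3+i\varepsilon\lambda_1$, $\lambda_4+i\varepsilon\lambda_2$ and with the root of $\det(-2\pi i\hbar(\lambda_3+i\varepsilon\lambda_1))$ that is continuous in $t$ and positive at $t=s$; the root in $G$ is the limit of this one as $\varepsilon\to0^+$. When $\det\lambda_3(t,s)=0$ (for instance $t=s$), where the Green function is only a distribution, put $\hat U_\varkappa(t,s,\psi)(\vec x)=\lim_{\varepsilon\to0^+}\int G_\varepsilon\psi\,d\vec y$. Write $\hat U_\varkappa(t,\psi)=\hat U_\varkappa(t,0,\psi)$. **Theorem.** For every nonzero Schwartz function $\psi$ and all $t,s\in\mathbb R$: 1. $\hat U_\varkappa(t,s,\psi)$ is well defined: $\int G_\varepsilon(\vec x,\vec y,t,s)\psi(\vec y)\,d\vec y\to\hat U_\varkappa(t,s,\psi)(\vec x)$ as $\varepsilon\to0^+$ for every $\vec x$ (also when $\det\lambda_3(t,s)\ne0$); it is again a nonzero Schwartz function, and $\hat U_\varkappa(s,s,\psi)=\psi$. 2. (Flow property.) With $\Psi(s)=\hat U_\varkappa(s,\psi)$, $$\hat U_\varkappa(t+s,\psi)=\hat U_\varkappa(t+s,s,\Psi(s)).$$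 3. (Group property.) If the coefficients $\mathcal H_{zz},\mathcal H_z,W_{zz},W_{zw},W_{ww}$ do not depend on time, then $$\hat U_\varkappa(t+s,\psi)=\hat U_\varkappa(t,\Psi(s)),\qquad\Psi(s)=\hat U_\varkappa(s,\psi).$$ -/

import Mathlib

open Filter Topology MeasureTheory Matrix
open scoped SchwartzMap

noncomputable section

namespace NonlocalGP

/-- Configuration space `ℝⁿ`. -/
abbrev Conf (n : ℕ) := EuclideanSpace ℝ (Fin n)

/-- Index set of the phase-space coordinates `z = (p, x)`:
`Sum.inl j` is `p_j` and `Sum.inr j` is `x_j`. -/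
abbrev PhaseIdx (n : ℕ) := Fin n ⊕ Fin n

/-- The time-dependent coefficients of the quadratic symbols
`H(z,t) = ½⟨z, Hzz(t) z⟩ + ⟨Hz(t), z⟩` and
`V(z,w,t) = ½⟨z, Wzz(t) z⟩ + ⟨z, Wzw(t) w⟩ + ½⟨w, Www(t) w⟩`. -/
structure Coeffs (n : ℕ) where
  Hzz : ℝ → Matrix (PhaseIdx n) (PhaseIdx n) ℝ
  Hz : ℝ → PhaseIdx n → ℝ
  Wzz : ℝ → Matrix (PhaseIdx n) (PhaseIdx n) ℝ
  Wzw : ℝ → Matrix (PhaseIdx n) (PhaseIdx n) ℝ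
  Www : ℝ → Matrix (PhaseIdx n) (PhaseIdx n) ℝ

variable {n : ℕ}

/-- The coefficients are continuous in time. -/
def Coeffs.IsContinuous (D : Coeffs n) : Prop :=
  Continuous D.Hzz ∧ Continuous D.Hz ∧ Continuous D.Wzz ∧ Continuous D.Wzw ∧ Continuous D.Www

/-- The matrices of the quadratic forms in `z` alone and in `w` alone are symmetric. -/
def Coeffs.IsSymmetric (D : Coeffs n) : Prop :=
  ∀ t, (D.Hzz t).IsSymm ∧ (D.Wzz t).IsSymm ∧ (D.Www t).IsSymm

/-- The coefficients do not depend on time. -/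
def Coeffs.IsAutonomous (D : Coeffs n) : Prop :=
  ∀ t, D.Hzz t = D.Hzz 0 ∧ D.Hz t = D.Hz 0 ∧ D.Wzz t = D.Wzz 0 ∧ D.Wzw t = D.Wzw 0 ∧
    D.Www t = D.Www 0

/-! ### Mean values of a state -/

/-- The operators `ẑ = (-iħ ∂/∂x, x)`. -/
def zOp (ħ : ℝ) (k : PhaseIdx n) (f : Conf n → ℂ) : Conf n → ℂ := fun x =>
  match k with
  | Sum.inl j => -Complex.I * ħ * fderiv ℝ f x (EuclideanSpace.single j 1)
  | Sum.inr j => (x j : ℂ) * f x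

/-- `‖ψ‖² = ∫ |ψ|² dx`. -/
def normSq (ψ : Conf n → ℂ) : ℝ := ∫ x, ‖ψ x‖ ^ 2

/-- The (real) mean value `⟨ψ|A|ψ⟩ / ‖ψ‖²` of a symmetric operator `A`. -/
def mean (A : (Conf n → ℂ) → Conf n → ℂ) (ψ : Conf n → ℂ) : ℝ :=
  (∫ x, star (ψ x) * A ψ x).re / normSq ψ

/-- First moments `z_ψ = (p_ψ, x_ψ)`. -/
def meanZ (ħ : ℝ) (ψ : Conf n → ℂ) : PhaseIdx n → ℝ := fun k => mean (zOp ħ k) ψ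

/-- The operators `Δẑ = ẑ - z_ψ`, for a given vector `z₀` in the place of `z_ψ`. -/
def dzOp (ħ : ℝ) (z₀ : PhaseIdx n → ℝ) (k : PhaseIdx n) (f : Conf n → ℂ) : Conf n → ℂ :=
  fun x => zOp ħ k f x - (z₀ k : ℂ) * f x

/-- Second centred moments `½ ⟨Δẑ_j Δẑ_k + Δẑ_k Δẑ_j⟩`. -/
def moment2 (ħ : ℝ) (ψ : Conf n → ℂ) : Matrix (PhaseIdx n) (PhaseIdx n) ℝ :=
  Matrix.of fun j k => (1 / 2) * mean (fun f x =>
    dzOp ħ (meanZ ħ ψ) j (dzOp ħ (meanZ ħ ψ) k f) x +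
      dzOp ħ (meanZ ħ ψ) k (dzOp ħ (meanZ ħ ψ) j f) x) ψ

/-! ### The Hamilton–Ehrenfest system; `κt` is `ϰ̃ = ϰ ‖ψ‖²` -/

/-- `𝔥_zz(t) = H_zz(t) + ϰ̃ W_zz(t)`. -/
def effHess (D : Coeffs n) (κt t : ℝ) : Matrix (PhaseIdx n) (PhaseIdx n) ℝ :=
  D.Hzz t + κt • D.Wzz t

/-- A curve `g = (z, Δ)` solves the Hamilton–Ehrenfest system
`ż = J {H_z + [H_zz + ϰ̃ (W_zz + W_zw)] z}`, `Δ̇ = J 𝔥_zz Δ - Δ 𝔥_zz J`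
with the value `g₀` at time `s`. Here `J = [[0, -1], [1, 0]]`. -/
def IsHESSolution (D : Coeffs n) (κt s : ℝ)
    (g₀ : (PhaseIdx n → ℝ) × Matrix (PhaseIdx n) (PhaseIdx n) ℝ)
    (g : ℝ → (PhaseIdx n → ℝ) × Matrix (PhaseIdx n) (PhaseIdx n) ℝ) : Prop :=
  g s = g₀ ∧
  (∀ t k, HasDerivAt (fun τ => (g τ).1 k)
    ((Matrix.J (Fin n) ℝ *ᵥ
      (D.Hz t + (D.Hzz t + κt • (D.Wzz t + D.Wzw t)) *ᵥ (g t).1)) k) t) ∧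
  (∀ t j k, HasDerivAt (fun τ => (g τ).2 j k)
    ((Matrix.J (Fin n) ℝ * effHess D κt t * (g t).2 -
      (g t).2 * effHess D κt t * Matrix.J (Fin n) ℝ) j k) t)

/-- The solution of the Hamilton–Ehrenfest system with value `g₀` at time `s`
(it exists globally and is unique when the coefficients are continuous). -/
def hesSolution (D : Coeffs n) (κt s : ℝ)
    (g₀ : (PhaseIdx n → ℝ) × Matrix (PhaseIdx n) (PhaseIdx n) ℝ) :
    ℝ → (PhaseIdx n → ℝ) × Matrix (PhaseIdx n) (PhaseIdx n) ℝ :=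
  Classical.epsilon (IsHESSolution D κt s g₀)

/-- The function `𝔥(t)`: the part of the associated linear Hamiltonian of degree `0` in `Δẑ`. -/
def effZero (D : Coeffs n) (κt t : ℝ)
    (g : (PhaseIdx n → ℝ) × Matrix (PhaseIdx n) (PhaseIdx n) ℝ) : ℝ :=
  (1 / 2) * (g.1 ⬝ᵥ
      ((D.Hzz t + κt • (D.Wzz t + (2 : ℝ) • D.Wzw t + D.Www t)) *ᵥ g.1)) +
    D.Hz t ⬝ᵥ g.1 + (1 / 2) * κt * (D.Www t * g.2).trace

/-- The action `S(t) = ∫₀ᵗ {⟨P, Ẋ⟩ - 𝔥} dτ` along a curve `g`, `g.1 = (P, X)`. -/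
def action (D : Coeffs n) (κt : ℝ)
    (g : ℝ → (PhaseIdx n → ℝ) × Matrix (PhaseIdx n) (PhaseIdx n) ℝ) (t : ℝ) : ℝ :=
  ∫ τ in (0 : ℝ)..t,
    ((∑ j, (g τ).1 (Sum.inl j) * deriv (fun σ => (g σ).1 (Sum.inr j)) τ) - effZero D κt τ (g τ))

/-! ### The system in variations and its blocks -/

/-- `A` is the matriciant of the system in variations: `Ȧ = J 𝔥_zz(t) A`, `A(s) = 1`. -/
def IsMatriciant (D : Coeffs n) (κt s : ℝ)
    (A : ℝ → Matrix (PhaseIdx n) (PhaseIdx n) ℝ) : Prop :=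
  A s = 1 ∧ ∀ t j k, HasDerivAt (fun τ => A τ j k)
    ((Matrix.J (Fin n) ℝ * effHess D κt t * A t) j k) t

/-- The matriciant `𝒜(t,s)` (it exists globally and is unique when the coefficients are
continuous). -/
def matriciant (D : Coeffs n) (κt t s : ℝ) : Matrix (PhaseIdx n) (PhaseIdx n) ℝ :=
  Classical.epsilon (IsMatriciant D κt s) t

/-! The blocks `λ₁, …, λ₄` in `𝒜 = [[λ₄ᵀ, -λ₂ᵀ], [-λ₃ᵀ, λ₁ᵀ]]`. -/

def lam1 (D : Coeffs n) (κt t s : ℝ) : Matrix (Fin n) (Fin n) ℝ :=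
  (matriciant D κt t s).toBlocks₂₂ᵀ

def lam2 (D : Coeffs n) (κt t s : ℝ) : Matrix (Fin n) (Fin n) ℝ :=
  -(matriciant D κt t s).toBlocks₁₂ᵀ

def lam3 (D : Coeffs n) (κt t s : ℝ) : Matrix (Fin n) (Fin n) ℝ :=
  -(matriciant D κt t s).toBlocks₂₁ᵀ

def lam4 (D : Coeffs n) (κt t s : ℝ) : Matrix (Fin n) (Fin n) ℝ :=
  (matriciant D κt t s).toBlocks₁₁ᵀ

/-- A real matrix as a complex one. -/
abbrev cplx (M : Matrix (Fin n) (Fin n) ℝ) : Matrix (Fin n) (Fin n) ℂ := M.map Complex.ofReal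

/-- `λ₃ + iε λ₁`, invertible for every `ε > 0` and all `t, s`. -/
def lam3Reg (D : Coeffs n) (κt ε t s : ℝ) : Matrix (Fin n) (Fin n) ℂ :=
  cplx (lam3 D κt t s) + (Complex.I * ε) • cplx (lam1 D κt t s)

/-- `λ₄ + iε λ₂`. -/
def lam4Reg (D : Coeffs n) (κt ε t s : ℝ) : Matrix (Fin n) (Fin n) ℂ :=
  cplx (lam4 D κt t s) + (Complex.I * ε) • cplx (lam2 D κt t s)

/-- `det (-2πiħ (λ₃(t,s) + iε λ₁(t,s)))`; it does not vanish for `ε > 0`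
and equals `(2πħε)ⁿ` at `t = s`. -/
def detReg (D : Coeffs n) (ħ κt ε t s : ℝ) : ℂ :=
  ((-Complex.I * 2 * Real.pi * ħ) • lam3Reg D κt ε t s).det

/-- For `ε > 0`: the square root of `det (-2πiħ (λ₃(t,s) + iε λ₁(t,s)))` that is continuous in `t`
and positive at `t = s`. -/
def rootReg (D : Coeffs n) (ħ κt ε t s : ℝ) : ℂ :=
  (Real.sqrt ((2 * Real.pi * ħ * ε) ^ n) : ℂ) *
    Complex.exp ((1 / 2) * ∫ τ in s..t, logDeriv (fun σ => detReg D ħ κt ε σ s) τ)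

/-- The branch of `√det(-2πiħ λ₃(t,s))` in the Green function (when `det λ₃(t,s) ≠ 0`). -/
def root (D : Coeffs n) (ħ κt t s : ℝ) : ℂ :=
  limUnder (𝓝[>] (0 : ℝ)) (fun ε => rootReg D ħ κt ε t s)

/-! ### Green function and evolution operator -/

/-- `Δx = x - X`, where `z = (P, X)`, as a complex vector. -/
def shift (z : PhaseIdx n → ℝ) (x : Conf n) : Fin n → ℂ := fun j => ((x j - z (Sum.inr j) : ℝ) : ℂ)

/-- `P`, where `z = (P, X)`, as a complex vector. -/
def mom (z : PhaseIdx n → ℝ) : Fin n → ℂ := fun j => ((z (Sum.inl j) : ℝ) : ℂ)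

/-- The expression
`r⁻¹ exp {(i/ħ) [S + ⟨P(t),Δx⟩ - ⟨P(s),Δy⟩ - ½⟨Δy, l₁ l₃⁻¹ Δy⟩ + ⟨Δx, l₃⁻¹ Δy⟩ - ½⟨Δx, l₃⁻¹ l₄ Δx⟩]}`. -/
def gaussKernel (ħ : ℝ) (r : ℂ) (l₁ l₃ l₄ : Matrix (Fin n) (Fin n) ℂ) (S : ℝ)
    (zt zs : PhaseIdx n → ℝ) (x y : Conf n) : ℂ :=
  r⁻¹ * Complex.exp ((Complex.I / ħ) *
    (S + mom zt ⬝ᵥ shift zt x - mom zs ⬝ᵥ shift zs y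
      - (1 / 2) * (shift zs y ⬝ᵥ ((l₁ * l₃⁻¹) *ᵥ shift zs y))
      + shift zt x ⬝ᵥ (l₃⁻¹ *ᵥ shift zs y)
      - (1 / 2) * (shift zt x ⬝ᵥ ((l₃⁻¹ * l₄) *ᵥ shift zt x))))

/-- The Green function of the associated linear equation along the curve `g`, for
`det λ₃(t,s) ≠ 0`. -/
def green (D : Coeffs n) (ħ κt : ℝ)
    (g : ℝ → (PhaseIdx n → ℝ) × Matrix (PhaseIdx n) (PhaseIdx n) ℝ) (t s : ℝ) (x y : Conf n) : ℂ :=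
  gaussKernel ħ (root D ħ κt t s) (cplx (lam1 D κt t s)) (cplx (lam3 D κt t s))
    (cplx (lam4 D κt t s)) (action D κt g t - action D κt g s) (g t).1 (g s).1 x y

/-- The Green function with `λ₃, λ₄` replaced by `λ₃ + iε λ₁, λ₄ + iε λ₂`, `ε > 0`: the initial
distribution `δ(x - y)` is replaced by a Gaussian of width of the order of `√(ħε)`. -/
def greenReg (D : Coeffs n) (ħ κt : ℝ)
    (g : ℝ → (PhaseIdx n → ℝ) × Matrix (PhaseIdx n) (PhaseIdx n) ℝ) (ε t s : ℝ)
    (x y : Conf n) : ℂ :=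
  gaussKernel ħ (rootReg D ħ κt ε t s) (cplx (lam1 D κt t s)) (lam3Reg D κt ε t s)
    (lam4Reg D κt ε t s) (action D κt g t - action D κt g s) (g t).1 (g s).1 x y

/-- `ϰ̃ = ϰ ‖ψ‖²`. -/
def kappaTilde (κ : ℝ) (ψ : Conf n → ℂ) : ℝ := κ * normSq ψ

/-- The curve `g(·, C(ψ))`: the solution of the Hamilton–Ehrenfest system whose value at time `s`
is the vector of first and second moments of `ψ`. -/
def trajectory (D : Coeffs n) (ħ κ s : ℝ) (ψ : Conf n → ℂ) :
    ℝ → (PhaseIdx n → ℝ) × Matrix (PhaseIdx n) (PhaseIdx n) ℝ :=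
  hesSolution D (kappaTilde κ ψ) s (meanZ ħ ψ, moment2 ħ ψ)

/-- `∫ G_ε(x, y, t, s, g(t,C(ψ)), g(s,C(ψ))) ψ(y) dy` with the regularized Green function. -/
def evolutionReg (D : Coeffs n) (ħ κ ε t s : ℝ) (ψ : Conf n → ℂ) (x : Conf n) : ℂ :=
  ∫ y, greenReg D ħ (kappaTilde κ ψ) (trajectory D ħ κ s ψ) ε t s x y * ψ y

open Classical in
/-- The nonlinear evolution operator
`U(t,s,ψ)(x) = ∫ G(x, y, t, s, g(t,C(ψ)), g(s,C(ψ))) ψ(y) dy`.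
When `det λ₃(t,s) = 0` (in particular for `t = s`), the Green function is a distribution, and the
integral is understood as the limit of the integrals with the regularized Green function. -/
def evolution (D : Coeffs n) (ħ κ t s : ℝ) (ψ : Conf n → ℂ) : Conf n → ℂ := fun x =>
  if (lam3 D (kappaTilde κ ψ) t s).det ≠ 0 then
    ∫ y, green D ħ (kappaTilde κ ψ) (trajectory D ħ κ s ψ) t s x y * ψ y
  else
    limUnder (𝓝[>] (0 : ℝ)) (fun ε => evolutionReg D ħ κ ε t s ψ x)

/-- `U(t, ψ) = U(t, 0, ψ)`. -/
def evolution₀ (D : Coeffs n) (ħ κ t : ℝ) (ψ : Conf n → ℂ) : Conf n → ℂ :=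
  evolution D ħ κ t 0 ψ

end NonlocalGP

end

open Filter Topology MeasureTheory Matrix
open scoped SchwartzMap

noncomputable section

namespace NonlocalGP

section

/-! ### Linear ordinary differential equations -/

section LinearODE

variable {E : Type*} [NormedAddCommGroup E] [NormedSpace ℝ E]

/-! For a fixed initial state the norm is conserved, so ϰ̃ is a constant and the nonlocal equation
becomes a linear Schrödinger equation with a quadratic Hamiltonian along a classical curve.
Accordingly the evolution operator has the form e^{iΔS/ħ} W(z_t) T(t,s) W(z_s)⁻¹, where W are
phase-space shifts (`weyl`) and T(t,s) is a metaplectic operator: a unitary map of Schwartz space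
which carries the operators ẑ by the symplectic matriciant 𝒜(t,s) (`IsPropagator`).

Existence of T up to a factor is algebra: chirps, linear substitutions and the Fourier transform
cover enough symplectic matrices to compose all of them (`exists_isIntertwiner`). Such an operator
sends a Gaussian to a multiple of an explicit complex Gaussian packet, because a Gaussian is
determined by first-order equations in ẑ (`IsIntertwiner.heatAt`). The remaining factor, including
the sign of the square root, is controlled dynamically. With the root continuous in time the packets
solve the Schrödinger equation, so their overlaps are conserved (`overlap_conserved`). This allows
one normalization of T for all widths and centres (`exists_isPropagator`), and it gives T(t,r)
T(r,s) = T(t,s) with no sign ambiguity (`IsPropagator.comp_eq`), since Gaussians are total.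

The integral against the regularized Green function is, up to the shifts, T applied to the
convolution of the shifted state with a Gaussian of width √(ħε). The convolution tends to the state
in the Schwartz topology, so the limit exists at caustics too
(`IsPropagator.tendsto_integral_wave`); away from caustics it is the integral with the limiting
kernel (`IsPropagator.integral_green`).

The flow property is then bookkeeping. The evolved state has the same norm, mean values z(t) and
second moments 𝒜Δ𝒜ᵀ, which are exactly the values of the Hamilton–Ehrenfest solution
(`trajectory_evoS`). Restarting therefore gives the same curve; the inner shifts cancel, the actions
add and the propagators compose. For constant coefficients every ingredient is invariant under time
translation, which turns the flow property into the group property. -/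

/-- The iterated integrals whose sum solves `x' = L(t) x` up to an inhomogeneity `f`. -/
def iterInt (L : ℝ → E →L[ℝ] E) (s : ℝ) (f : ℝ → E) : ℕ → ℝ → E
  | 0 => f
  | k + 1 => fun t => ∫ τ in s..t, L τ (iterInt L s f k τ)

lemma continuous_iterInt [CompleteSpace E] {L : ℝ → E →L[ℝ] E} (hL : Continuous L) (s : ℝ)
    {f : ℝ → E} (hf : Continuous f) (k : ℕ) : Continuous (iterInt L s f k) := by
  induction k with
  | zero => exact hf
  | succ k ih =>
    exact continuous_iff_continuousAt.2 fun t =>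
      ((hL.clm_apply ih).integral_hasStrictDerivAt s t).hasDerivAt.continuousAt

lemma hasDerivAt_iterInt_succ [CompleteSpace E] {L : ℝ → E →L[ℝ] E} (hL : Continuous L) (s : ℝ)
    {f : ℝ → E} (hf : Continuous f) (k : ℕ) (t : ℝ) :
    HasDerivAt (iterInt L s f (k + 1)) (L t (iterInt L s f k t)) t :=
  ((hL.clm_apply (continuous_iterInt hL s hf k)).integral_hasStrictDerivAt s t).hasDerivAt

/-- Each integration turns |τ - s|^k into |t - s|^(k+1)/(k+1), which builds up the factorial. The
resulting exponential series is what makes solutions global in time. -/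
lemma norm_iterInt_le {L : ℝ → E →L[ℝ] E} {s : ℝ} {f : ℝ → E} {K C T : ℝ} (hK : 0 ≤ K)
    (hC : 0 ≤ C) (hLK : ∀ t, |t - s| ≤ T → ‖L t‖ ≤ K) (hfC : ∀ t, |t - s| ≤ T → ‖f t‖ ≤ C)
    (k : ℕ) (t : ℝ) (ht : |t - s| ≤ T) :
    ‖iterInt L s f k t‖ ≤ C * (K ^ k * |t - s| ^ k / (k.factorial : ℝ)) := by
  induction k generalizing t with
  | zero => simpa [iterInt] using hfC t ht
  | succ k ih =>
    have hsub : ∀ τ ∈ Set.uIoc s t, |τ - s| ≤ T := by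
      intro τ hτ
      have := Set.abs_sub_left_of_mem_uIcc (Set.uIoc_subset_uIcc hτ)
      exact this.trans (by rwa [abs_sub_comm] at ht ⊢)
    have hb : ∀ τ ∈ Set.uIoc s t, ‖L τ (iterInt L s f k τ)‖ ≤
        (K ^ (k + 1) * C / (k.factorial : ℝ)) * |τ - s| ^ k := by
      intro τ hτ
      calc ‖L τ (iterInt L s f k τ)‖ ≤ ‖L τ‖ * ‖iterInt L s f k τ‖ := (L τ).le_opNorm _
        _ ≤ K * (C * (K ^ k * |τ - s| ^ k / (k.factorial : ℝ))) := by
          gcongr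
          · exact hLK τ (hsub τ hτ)
          · exact ih τ (hsub τ hτ)
        _ = _ := by ring
    calc ‖iterInt L s f (k + 1) t‖
        ≤ |∫ τ in s..t, (K ^ (k + 1) * C / (k.factorial : ℝ)) * |τ - s| ^ k| := by
          apply intervalIntegral.norm_integral_le_abs_of_norm_le
          · exact (ae_restrict_iff' measurableSet_uIoc).2 (ae_of_all _ hb)
          · exact (by fun_prop : Continuous fun τ : ℝ =>
              (K ^ (k + 1) * C / (k.factorial : ℝ)) * |τ - s| ^ k).intervalIntegrable _ _
      _ = (K ^ (k + 1) * C / (k.factorial : ℝ)) * (|t - s| ^ (k + 1) / (k + 1)) := by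
          rw [intervalIntegral.integral_const_mul, abs_mul,
            intervalIntegral.abs_intervalIntegral_eq, integral_pow_abs_sub_uIoc,
            abs_of_nonneg (by positivity), abs_of_nonneg (by positivity)]
      _ = _ := by
          rw [Nat.factorial_succ]
          push_cast
          field_simp

/-- Global solvability of linear equations with continuous coefficients. -/
lemma exists_linear_solution [CompleteSpace E] {L : ℝ → E →L[ℝ] E} (hL : Continuous L)
    {b : ℝ → E} (hb : Continuous b) (s : ℝ) (x₀ : E) :
    ∃ x : ℝ → E, x s = x₀ ∧ ∀ t, HasDerivAt x (L t (x t) + b t) t := by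
  -- The zeroth Picard iterate carries both the initial value and the inhomogeneity, so that the
  -- later terms of the series obey the homogeneous recursion and vanish at `s`.
  set f : ℝ → E := fun t => x₀ + ∫ τ in s..t, b τ with hfdef
  have hf' : ∀ t, HasDerivAt f (b t) t := fun t =>
    ((hb.integral_hasStrictDerivAt s t).hasDerivAt).const_add x₀
  have hf : Continuous f := continuous_iff_continuousAt.2 fun t => (hf' t).continuousAt
  have hu0 : ∀ k, iterInt L s f (k + 1) s = 0 := fun k => by simp [iterInt]
  have key : ∀ t, Summable (fun k => iterInt L s f k t) ∧
      HasDerivAt (fun t => ∑' k, iterInt L s f (k + 1) t) (∑' k, L t (iterInt L s f k t)) t := by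
    intro t
    set T := |t - s| + 1 with hT
    obtain ⟨K, hK⟩ := (isCompact_closedBall s T).exists_bound_of_continuousOn hL.continuousOn
    obtain ⟨C, hC⟩ := (isCompact_closedBall s T).exists_bound_of_continuousOn hf.continuousOn
    have hmem : ∀ τ, |τ - s| ≤ T → τ ∈ Metric.closedBall s T := fun τ h => by
      rwa [Metric.mem_closedBall, Real.dist_eq]
    have hT0 : 0 ≤ T := by positivity
    have hK0 : 0 ≤ K := (norm_nonneg _).trans (hK s (by simpa using hT0))
    have hC0 : 0 ≤ C := (norm_nonneg _).trans (hC s (by simpa using hT0))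
    have hbd := norm_iterInt_le hK0 hC0 (fun t ht => hK t (hmem t ht))
      (fun t ht => hC t (hmem t ht))
    have hbd' : ∀ k τ, |τ - s| ≤ T →
        ‖iterInt L s f k τ‖ ≤ C * ((K * T) ^ k / (k.factorial : ℝ)) := by
      intro k τ hτ
      refine (hbd k τ hτ).trans ?_
      rw [mul_pow]
      gcongr
    have hsum : Summable fun k : ℕ => C * ((K * T) ^ k / (k.factorial : ℝ)) :=
      (Real.summable_pow_div_factorial _).mul_left _
    refine ⟨.of_norm_bounded hsum fun k => hbd' k t (by linarith [hT]), ?_⟩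
    -- Termwise differentiation on a ball with `t` in its interior: the derivative of each term is
    -- `L` applied to the preceding one, hence summable by the same majorant.
    refine hasDerivAt_tsum_of_isPreconnected (t := Metric.ball s T) (hsum.mul_left K)
      Metric.isOpen_ball (convex_ball s T).isPreconnected
      (fun k y _ => hasDerivAt_iterInt_succ hL s hf k y) ?_ (y₀ := s)
      (by simpa using (by positivity : 0 < T)) (by simp [hu0]) (by
        rw [Metric.mem_ball, Real.dist_eq]; linarith [hT])
    intro k y hy
    have hy' : |y - s| ≤ T := by
      rw [Metric.mem_ball, Real.dist_eq] at hy; exact hy.le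
    refine ((L y).le_opNorm _).trans ?_
    exact mul_le_mul (hK y (hmem y hy')) (hbd' k y hy') (norm_nonneg _) hK0
  refine ⟨fun t => f t + ∑' k, iterInt L s f (k + 1) t, ?_, fun t => ?_⟩
  · simp only [hu0, tsum_zero, add_zero]
    simp [hfdef]
  · have h1 := (key t).1
    have h2 : ∑' k, L t (iterInt L s f k t) = L t (f t + ∑' k, iterInt L s f (k + 1) t) := by
      rw [← (L t).map_tsum h1, h1.tsum_eq_zero_add]
      rfl
    have := (hf' t).add (key t).2
    rw [h2, add_comm (b t)] at this
    exact this

/-- Uniqueness for linear equations with continuous coefficients. -/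
lemma linear_solution_unique {L : ℝ → E →L[ℝ] E} (hL : Continuous L)
    {b : ℝ → E} {s : ℝ} {x y : ℝ → E} (hx : ∀ t, HasDerivAt x (L t (x t) + b t) t)
    (hy : ∀ t, HasDerivAt y (L t (y t) + b t) t) (hs : x s = y s) : x = y := by
  ext t
  set T := |t - s| + 1 with hT
  obtain ⟨K, hK⟩ := (isCompact_closedBall s T).exists_bound_of_continuousOn hL.continuousOn
  have hK0 : 0 ≤ K := (norm_nonneg _).trans (hK s (by simp [hT]; positivity))
  -- On the bounded window of radius |t - s| + 1 the norm of `L` is bounded, which gives a uniform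
  -- Lipschitz constant.
  refine ODE_solution_unique_of_mem_Ioo (K := K.toNNReal) (v := fun t x => L t x + b t)
    (s := fun _ => Set.univ) (a := s - T) (b := s + T) (t₀ := s) ?_ ?_
    (fun t _ => ⟨hx t, trivial⟩) (fun t _ => ⟨hy t, trivial⟩) hs ?_
  · intro τ hτ
    refine LipschitzWith.lipschitzOnWith (LipschitzWith.of_dist_le_mul fun u v => ?_)
    rw [dist_add_right, dist_eq_norm, dist_eq_norm, ← map_sub, Real.coe_toNNReal _ hK0]
    refine ((L τ).le_opNorm _).trans ?_
    gcongr
    apply hK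
    rw [Metric.mem_closedBall, Real.dist_eq, abs_le]
    constructor <;> linarith [hτ.1, hτ.2]
  · constructor <;> simp [hT] <;> positivity
  · have := abs_lt.1 (by linarith [hT] : |t - s| < T)
    constructor <;> linarith [this.1, this.2]

end LinearODE

end

section

variable {n : ℕ}

/-! ### Entrywise derivatives of matrices -/

section MatrixDeriv

variable {ι κ μ : Type*} {R : Type*} [NormedField R] [NormedAlgebra ℝ R]

/-- Entrywise differentiability of a curve of matrices. -/
def HasMDerivAt (M : ℝ → Matrix ι κ R) (M' : Matrix ι κ R) (t : ℝ) : Prop :=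
  ∀ i j, HasDerivAt (fun τ => M τ i j) (M' i j) t

lemma HasMDerivAt.congr_deriv {M : ℝ → Matrix ι κ R} {M' N' : Matrix ι κ R} {t : ℝ}
    (h : HasMDerivAt M M' t) (e : M' = N') : HasMDerivAt M N' t := e ▸ h

lemma hasMDerivAt_const (M : Matrix ι κ R) (t : ℝ) : HasMDerivAt (fun _ => M) 0 t :=
  fun i j => hasDerivAt_const t (M i j)

lemma HasMDerivAt.mul [Fintype κ] {M : ℝ → Matrix ι κ R} {M' : Matrix ι κ R}
    {N : ℝ → Matrix κ μ R} {N' : Matrix κ μ R} {t : ℝ}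
    (hM : HasMDerivAt M M' t) (hN : HasMDerivAt N N' t) :
    HasMDerivAt (fun τ => M τ * N τ) (M' * N t + M t * N') t := by
  intro i j
  simp only [Matrix.mul_apply, Matrix.add_apply, ← Finset.sum_add_distrib]
  exact HasDerivAt.fun_sum fun k _ => (hM i k).mul (hN k j)

lemma HasMDerivAt.add {M N : ℝ → Matrix ι κ R} {M' N' : Matrix ι κ R} {t : ℝ}
    (hM : HasMDerivAt M M' t) (hN : HasMDerivAt N N' t) :
    HasMDerivAt (fun τ => M τ + N τ) (M' + N') t := fun i j => (hM i j).add (hN i j)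

lemma HasMDerivAt.neg {M : ℝ → Matrix ι κ R} {M' : Matrix ι κ R} {t : ℝ}
    (hM : HasMDerivAt M M' t) : HasMDerivAt (fun τ => -M τ) (-M') t := fun i j => (hM i j).neg

lemma HasMDerivAt.const_smul {M : ℝ → Matrix ι κ R} {M' : Matrix ι κ R} {t : ℝ} (c : R)
    (hM : HasMDerivAt M M' t) : HasMDerivAt (fun τ => c • M τ) (c • M') t :=
  fun i j => (hM i j).const_mul c

lemma HasMDerivAt.transpose {M : ℝ → Matrix ι κ R} {M' : Matrix ι κ R} {t : ℝ}
    (hM : HasMDerivAt M M' t) : HasMDerivAt (fun τ => (M τ)ᵀ) M'ᵀ t := fun i j => hM j i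

lemma HasMDerivAt.mulVec [Fintype κ] {M : ℝ → Matrix ι κ R} {M' : Matrix ι κ R} {t : ℝ}
    (hM : HasMDerivAt M M' t) (v : κ → R) (i : ι) :
    HasDerivAt (fun τ => (M τ *ᵥ v) i) ((M' *ᵥ v) i) t := by
  simp only [Matrix.mulVec, dotProduct]
  exact HasDerivAt.fun_sum fun k _ => (hM i k).mul_const (v k)

lemma HasMDerivAt.continuousAt {M : ℝ → Matrix ι κ R} {M' : Matrix ι κ R} {t : ℝ}
    (hM : HasMDerivAt M M' t) : ContinuousAt M t :=
  continuousAt_pi.2 fun i => continuousAt_pi.2 fun j => (hM i j).continuousAt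

lemma HasMDerivAt.unique {M : ℝ → Matrix ι κ R} {M' N' : Matrix ι κ R} {t : ℝ}
    (hM : HasMDerivAt M M' t) (hN : HasMDerivAt M N' t) : M' = N' := by
  ext i j
  exact (hM i j).unique (hN i j)

lemma HasMDerivAt.eq_of_forall_zero {M : ℝ → Matrix ι κ R}
    (h : ∀ t, HasMDerivAt M 0 t) (s t : ℝ) : M s = M t := by
  ext i j
  exact is_const_of_deriv_eq_zero (fun t => (h t i j).differentiableAt)
    (fun t => (h t i j).deriv) s t

variable [Fintype ι] [DecidableEq ι]

/-- Jacobi's formula. -/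
lemma HasMDerivAt.det {M : ℝ → Matrix ι ι R} {M' : Matrix ι ι R} {t : ℝ}
    (hM : HasMDerivAt M M' t) :
    HasDerivAt (fun τ => (M τ).det) ((M t).adjugate * M').trace t := by
  have h1 : HasDerivAt (fun τ => (M τ).det)
      (∑ σ : Equiv.Perm ι, ((Equiv.Perm.sign σ : ℤ) : R) *
        ∑ i, (∏ j ∈ Finset.univ.erase i, M t (σ j) j) * M' (σ i) i) t := by
    simp only [Matrix.det_apply']
    refine HasDerivAt.fun_sum fun σ _ => HasDerivAt.const_mul _ ?_
    have := HasDerivAt.fun_finsetProd (u := Finset.univ) (x := t)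
      (f := fun i τ => M τ (σ i) i) (f' := fun i => M' (σ i) i) (fun i _ => hM (σ i) i)
    simpa only [smul_eq_mul] using this
  convert h1 using 1
  simp only [Finset.mul_sum]
  rw [Finset.sum_comm, Matrix.trace]
  refine Finset.sum_congr rfl fun i _ => ?_
  -- Diagonal entries of `adjugate * M'` are determinants with one column differentiated, by
  -- Cramer's rule; these are the terms of the product rule.
  have : ((M t).adjugate * M').diag i = ((M t).updateCol i fun k => M' k i).det := by
    rw [← Matrix.cramer_apply, Matrix.cramer_eq_adjugate_mulVec]
    rfl
  rw [this, Matrix.det_apply']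
  refine Finset.sum_congr rfl fun σ _ => ?_
  rw [← Finset.prod_erase_mul _ _ (Finset.mem_univ i), Matrix.updateCol_self]
  congr 2
  refine Finset.prod_congr rfl fun j hj => ?_
  rw [Matrix.updateCol_ne (Finset.ne_of_mem_erase hj)]

/-- Entries of the inverse are quotients of determinants, hence differentiable. Once this is known,
the value of the derivative follows from differentiating M M⁻¹ = 1. -/
lemma HasMDerivAt.inv {M : ℝ → Matrix ι ι ℂ} {M' : Matrix ι ι ℂ} {t : ℝ}
    (hM : HasMDerivAt M M' t) (hdet : ∀ τ, (M τ).det ≠ 0) :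
    HasMDerivAt (fun τ => (M τ)⁻¹) (-((M t)⁻¹ * M' * (M t)⁻¹)) t := by
  have hd : ∀ i j, ∃ d, HasDerivAt (fun τ => (M τ)⁻¹ i j) d t := by
    intro i j
    -- The entry (i, j) of the adjugate is the determinant of `M` with row j replaced by a unit
    -- vector, so Jacobi's formula applies to it.
    have h2 : HasMDerivAt (fun τ => ((M τ).updateRow j (Pi.single i 1)))
        (M'.updateRow j 0) t := by
      intro k l
      by_cases hk : k = j
      · subst hk
        simp only [Matrix.updateRow_self]
        exact hasDerivAt_const t _
      · simpa only [Matrix.updateRow_ne hk] using hM k l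
    have h3 := (hM.det.fun_inv (hdet t)).mul h2.det
    have h4 : (fun τ => (M τ)⁻¹ i j) =
        fun τ => (M τ).det⁻¹ * ((M τ).updateRow j (Pi.single i 1)).det := by
      funext τ
      rw [Matrix.inv_def, Matrix.smul_apply, Matrix.adjugate_apply, Ring.inverse_eq_inv',
        smul_eq_mul]
    rw [h4]
    exact ⟨_, h3⟩
  choose d hd using hd
  have hN : HasMDerivAt (fun τ => (M τ)⁻¹) (Matrix.of d) t := fun i j => hd i j
  have h1 := hM.mul hN
  have h2 : (fun τ => M τ * (M τ)⁻¹) = fun _ => (1 : Matrix ι ι ℂ) := by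
    funext τ
    exact Matrix.mul_nonsing_inv _ (hdet τ).isUnit
  rw [h2] at h1
  have h3 := h1.unique (hasMDerivAt_const _ t)
  have h4 : (M t)⁻¹ * (M' * (M t)⁻¹ + M t * Matrix.of d) = 0 := by rw [h3, Matrix.mul_zero]
  rw [Matrix.mul_add, ← Matrix.mul_assoc, ← Matrix.mul_assoc,
    Matrix.nonsing_inv_mul _ (hdet t).isUnit, Matrix.one_mul] at h4
  refine hN.congr_deriv ?_
  rw [eq_neg_iff_add_eq_zero, add_comm]
  exact h4

end MatrixDeriv

/-! ### The matriciant -/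

section Matriciant

variable {D : Coeffs n}

lemma continuous_effHess (hD : D.IsContinuous) (κt : ℝ) : Continuous (effHess D κt) :=
  hD.1.add (hD.2.2.1.const_smul κt)

lemma effHess_isSymm (hS : D.IsSymmetric) (κt t : ℝ) : (effHess D κt t).IsSymm :=
  (hS t).1.add ((hS t).2.1.smul κt)

/-- A matrix as a continuous linear map on tuples. -/
def mulVecCLM {ι : Type*} [Fintype ι] (M : Matrix ι ι ℝ) : (ι → ℝ) →L[ℝ] (ι → ℝ) :=
  LinearMap.toContinuousLinearMap (Matrix.mulVecLin M)

@[simp] lemma mulVecCLM_apply {ι : Type*} [Fintype ι] (M : Matrix ι ι ℝ) (v : ι → ℝ) :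
    mulVecCLM M v = M *ᵥ v := rfl

lemma continuous_mulVecCLM {ι X : Type*} [Fintype ι] [TopologicalSpace X] {M : X → Matrix ι ι ℝ}
    (hM : Continuous M) : Continuous fun x => mulVecCLM (M x) := by
  rw [continuous_clm_apply]
  intro v
  simp only [mulVecCLM_apply]
  exact hM.matrix_mulVec continuous_const

/-- Solutions of a linear system given by a continuous matrix. -/
lemma exists_mulVec_solution {ι : Type*} [Fintype ι] {B : ℝ → Matrix ι ι ℝ} (hB : Continuous B)
    {b : ℝ → ι → ℝ} (hb : Continuous b) (s : ℝ) (x₀ : ι → ℝ) :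
    ∃ x : ℝ → ι → ℝ, x s = x₀ ∧ ∀ t, HasDerivAt x (B t *ᵥ x t + b t) t :=
  exists_linear_solution (continuous_mulVecCLM hB) hb s x₀

lemma mulVec_solution_unique {ι : Type*} [Fintype ι] {B : ℝ → Matrix ι ι ℝ} (hB : Continuous B)
    {b : ℝ → ι → ℝ} {s : ℝ} {x y : ℝ → ι → ℝ} (hx : ∀ t, HasDerivAt x (B t *ᵥ x t + b t) t)
    (hy : ∀ t, HasDerivAt y (B t *ᵥ y t + b t) t) (hs : x s = y s) : x = y :=
  linear_solution_unique (continuous_mulVecCLM hB) hx hy hs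

lemma continuous_J_mul_effHess (hD : D.IsContinuous) (κt : ℝ) :
    Continuous fun t => Matrix.J (Fin n) ℝ * effHess D κt t :=
  continuous_const.matrix_mul (continuous_effHess hD κt)

lemma exists_isMatriciant (hD : D.IsContinuous) (κt s : ℝ) : ∃ A, IsMatriciant D κt s A := by
  choose x hx0 hx using fun k : PhaseIdx n =>
    exists_mulVec_solution (continuous_J_mul_effHess hD κt) (continuous_const (y := 0)) s
      (Pi.single k 1)
  refine ⟨fun t => Matrix.of fun j k => x k t j, ?_, fun t j k => ?_⟩
  · ext j k
    simp [hx0, Matrix.one_apply, Pi.single_apply]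
  · have := hasDerivAt_pi.1 (hx k t) j
    simp only [add_zero] at this
    exact this

lemma matriciant_spec (hD : D.IsContinuous) (κt s : ℝ) :
    IsMatriciant D κt s (fun t => matriciant D κt t s) :=
  Classical.epsilon_spec (exists_isMatriciant hD κt s)

lemma matriciant_self (hD : D.IsContinuous) (κt s : ℝ) : matriciant D κt s s = 1 :=
  (matriciant_spec hD κt s).1

lemma hasMDerivAt_matriciant (hD : D.IsContinuous) (κt s t : ℝ) :
    HasMDerivAt (fun t => matriciant D κt t s)
      (Matrix.J (Fin n) ℝ * effHess D κt t * matriciant D κt t s) t :=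
  (matriciant_spec hD κt s).2 t

/-- Solutions of the matrix equation `Ȧ = J 𝔥 A` are determined by one value. -/
lemma matrix_solution_unique (hD : D.IsContinuous) (κt : ℝ) {κ : Type*} {s : ℝ}
    {A B : ℝ → Matrix (PhaseIdx n) κ ℝ}
    (hA : ∀ t, HasMDerivAt A (Matrix.J (Fin n) ℝ * effHess D κt t * A t) t)
    (hB : ∀ t, HasMDerivAt B (Matrix.J (Fin n) ℝ * effHess D κt t * B t) t)
    (hs : A s = B s) : A = B := by
  funext t
  ext j k
  have h : ∀ C : ℝ → Matrix (PhaseIdx n) κ ℝ,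
      (∀ t, HasMDerivAt C (Matrix.J (Fin n) ℝ * effHess D κt t * C t) t) →
      ∀ t, HasDerivAt (fun τ j => C τ j k)
        ((Matrix.J (Fin n) ℝ * effHess D κt t) *ᵥ (fun j => C t j k) + 0) t := by
    intro C hC t
    rw [add_zero, hasDerivAt_pi]
    exact fun j => hC t j k
  exact congrFun (congrFun (mulVec_solution_unique (continuous_J_mul_effHess hD κt)
    (h A hA) (h B hB) (s := s) (by simp only [hs])) t) j

/-- The derivative of AᵀJA is zero, because 𝔥 is symmetric, Jᵀ = -J and J² = -1; at t = s the
product equals J. -/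
lemma matriciant_symplectic (hD : D.IsContinuous) (hS : D.IsSymmetric) (κt t s : ℝ) :
    (matriciant D κt t s)ᵀ * Matrix.J (Fin n) ℝ * matriciant D κt t s = Matrix.J (Fin n) ℝ := by
  have h : ∀ t, HasMDerivAt (fun t => (matriciant D κt t s)ᵀ * Matrix.J (Fin n) ℝ *
      matriciant D κt t s) 0 t := by
    intro t
    have hA := hasMDerivAt_matriciant hD κt s t
    refine ((hA.transpose.mul (hasMDerivAt_const _ t)).mul hA).congr_deriv ?_
    have hJ : Matrix.J (Fin n) ℝ * (Matrix.J (Fin n) ℝ) = -1 := Matrix.J_squared _ _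
    rw [Matrix.transpose_mul, Matrix.transpose_mul, Matrix.J_transpose,
      (effHess_isSymm hS κt t).eq]
    simp only [Matrix.mul_zero, add_zero, Matrix.mul_neg, Matrix.neg_mul, ← Matrix.mul_assoc]
    rw [Matrix.mul_assoc _ (Matrix.J (Fin n) ℝ) (Matrix.J (Fin n) ℝ),
      Matrix.mul_assoc _ (Matrix.J (Fin n) ℝ) (Matrix.J (Fin n) ℝ), hJ]
    simp
  have := HasMDerivAt.eq_of_forall_zero h t s
  simpa [matriciant_self hD] using this

end Matriciant

/-! ### The Hamilton–Ehrenfest system -/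

section HES

variable {D : Coeffs n}

/-- The equation for z is an ordinary linear system. The two-sided equation for Δ is handled by a
conserved quantity: AᵀJΔJA is constant in time, and since A is symplectic this can be solved for Δ,
giving Δ = AΔ₀Aᵀ. -/
lemma isHESSolution_unique (hD : D.IsContinuous) (hS : D.IsSymmetric) {κt s : ℝ}
    {g₀ : (PhaseIdx n → ℝ) × Matrix (PhaseIdx n) (PhaseIdx n) ℝ}
    {g g' : ℝ → (PhaseIdx n → ℝ) × Matrix (PhaseIdx n) (PhaseIdx n) ℝ}
    (hg : IsHESSolution D κt s g₀ g) (hg' : IsHESSolution D κt s g₀ g') : g = g' := by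
  have hJ : Continuous fun t => Matrix.J (Fin n) ℝ * (D.Hzz t + κt • (D.Wzz t + D.Wzw t)) :=
    continuous_const.matrix_mul (hD.1.add ((hD.2.2.1.add hD.2.2.2.1).const_smul κt))
  have h1 : (fun t => (g t).1) = fun t => (g' t).1 := by
    have h : ∀ g, IsHESSolution D κt s g₀ g → ∀ t, HasDerivAt (fun t => (g t).1)
        ((Matrix.J (Fin n) ℝ * (D.Hzz t + κt • (D.Wzz t + D.Wzw t))) *ᵥ (g t).1 +
          Matrix.J (Fin n) ℝ *ᵥ D.Hz t) t := by
      intro g hg t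
      refine hasDerivAt_pi.2 fun k => ?_
      have := hg.2.1 t k
      rwa [Matrix.mulVec_add, Matrix.mulVec_mulVec, add_comm] at this
    exact mulVec_solution_unique hJ (h g hg) (h g' hg') (s := s) (by simp only [hg.1, hg'.1])
  have h2 : ∀ t, (g t).2 = (g' t).2 := by
    intro t
    have hd : ∀ g, IsHESSolution D κt s g₀ g → ∀ t,
        (g t).2 = matriciant D κt t s * g₀.2 * (matriciant D κt t s)ᵀ := by
      intro g hg t
      have hA := fun t => hasMDerivAt_matriciant hD κt s t
      have hΔ : ∀ t, HasMDerivAt (fun t => (g t).2) _ t := hg.2.2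
      set J := Matrix.J (Fin n) ℝ
      have hJ2 : J * J = -1 := Matrix.J_squared _ _
      have hJT : Jᵀ = -J := Matrix.J_transpose _ _
      have key : ∀ t, HasMDerivAt (fun t => (matriciant D κt t s)ᵀ * J * (g t).2 * J *
          matriciant D κt t s) 0 t := by
        intro t
        refine (((((hA t).transpose.mul (hasMDerivAt_const J t)).mul (hΔ t)).mul
          (hasMDerivAt_const J t)).mul (hA t)).congr_deriv ?_
        rw [Matrix.transpose_mul, Matrix.transpose_mul, hJT, (effHess_isSymm hS κt t).eq]
        generalize (matriciant D κt t s)ᵀ = B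
        generalize (matriciant D κt t s) = A
        generalize effHess D κt t = h
        generalize (g t).2 = X
        have e1 : ∀ Y : Matrix (PhaseIdx n) (PhaseIdx n) ℝ, J * (J * Y) = -Y := fun Y => by
          rw [← Matrix.mul_assoc, hJ2, Matrix.neg_mul, Matrix.one_mul]
        simp only [Matrix.mul_zero, add_zero, Matrix.mul_neg, Matrix.neg_mul, Matrix.mul_assoc,
          Matrix.mul_sub, Matrix.sub_mul, Matrix.add_mul, e1, neg_neg]
        abel
      have h0 := HasMDerivAt.eq_of_forall_zero key t s
      rw [matriciant_self hD, hg.1] at h0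
      have hs := matriciant_symplectic hD hS κt t s
      -- Symplecticity makes -JAᵀJ a left inverse of A; for square matrices it is also a right
      -- inverse. The transpose of this identity gives the companion `hs''`.
      have hs' : matriciant D κt t s * (J * ((matriciant D κt t s)ᵀ * J)) = -1 := by
        have := mul_eq_one_comm.1 (show -(J * ((matriciant D κt t s)ᵀ * J)) *
          matriciant D κt t s = 1 by
            rw [Matrix.neg_mul, Matrix.mul_assoc J, hs, hJ2, neg_neg])
        rw [Matrix.mul_neg] at this
        rw [← this, neg_neg]
      have hs'' : J * matriciant D κt t s * J * (matriciant D κt t s)ᵀ = -1 := by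
        have := congrArg Matrix.transpose hs'
        simpa [hJT, Matrix.transpose_mul, ← Matrix.mul_assoc] using this
      have h3 := congrArg (fun Y => matriciant D κt t s * J * Y * (J * (matriciant D κt t s)ᵀ)) h0
      have e2 : ∀ X : Matrix (PhaseIdx n) (PhaseIdx n) ℝ, matriciant D κt t s * J *
          ((matriciant D κt t s)ᵀ * J * X * J * matriciant D κt t s) *
            (J * (matriciant D κt t s)ᵀ) =
          (matriciant D κt t s * (J * ((matriciant D κt t s)ᵀ * J))) * X *
            (J * matriciant D κt t s * J * (matriciant D κt t s)ᵀ) := fun X => by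
        simp only [Matrix.mul_assoc]
      beta_reduce at h3
      rw [e2, hs', hs''] at h3
      simp only [Matrix.neg_mul, Matrix.one_mul, Matrix.mul_neg, Matrix.mul_one, neg_neg,
        Matrix.transpose_one] at h3
      rw [h3]
      have e3 : ∀ Y : Matrix (PhaseIdx n) (PhaseIdx n) ℝ, J * (J * Y) = -Y := fun Y => by
        rw [← Matrix.mul_assoc, hJ2, Matrix.neg_mul, Matrix.one_mul]
      simp only [Matrix.mul_assoc, e3, Matrix.mul_neg, Matrix.neg_mul, neg_neg]
    rw [hd g hg t, hd g' hg' t]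
  funext t
  exact Prod.ext (congrFun h1 t) (h2 t)

lemma exists_isHESSolution (hD : D.IsContinuous) (hS : D.IsSymmetric) (κt s : ℝ)
    (g₀ : (PhaseIdx n → ℝ) × Matrix (PhaseIdx n) (PhaseIdx n) ℝ) :
    ∃ g, IsHESSolution D κt s g₀ g ∧
      ∀ t, (g t).2 = matriciant D κt t s * g₀.2 * (matriciant D κt t s)ᵀ := by
  have hJ : Continuous fun t => Matrix.J (Fin n) ℝ * (D.Hzz t + κt • (D.Wzz t + D.Wzw t)) :=
    continuous_const.matrix_mul (hD.1.add ((hD.2.2.1.add hD.2.2.2.1).const_smul κt))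
  have hb : Continuous fun t => Matrix.J (Fin n) ℝ *ᵥ D.Hz t :=
    continuous_const.matrix_mulVec hD.2.1
  obtain ⟨z, hz0, hz⟩ := exists_mulVec_solution hJ hb s g₀.1
  refine ⟨fun t => (z t, matriciant D κt t s * g₀.2 * (matriciant D κt t s)ᵀ), ⟨?_, ?_, ?_⟩,
    fun t => rfl⟩
  · simp [hz0, matriciant_self hD]
  · intro t k
    have := hasDerivAt_pi.1 (hz t) k
    rwa [Matrix.mulVec_add, Matrix.mulVec_mulVec, add_comm]
  · intro t
    have hA := hasMDerivAt_matriciant hD κt s t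
    refine HasMDerivAt.congr_deriv ((hA.mul (hasMDerivAt_const g₀.2 t)).mul hA.transpose) ?_
    rw [Matrix.transpose_mul, Matrix.transpose_mul, Matrix.J_transpose,
      (effHess_isSymm hS κt t).eq]
    simp only [Matrix.mul_zero, add_zero, Matrix.mul_neg, Matrix.mul_assoc, sub_eq_add_neg]

lemma hesSolution_spec (hD : D.IsContinuous) (hS : D.IsSymmetric) (κt s : ℝ)
    (g₀ : (PhaseIdx n → ℝ) × Matrix (PhaseIdx n) (PhaseIdx n) ℝ) :
    IsHESSolution D κt s g₀ (hesSolution D κt s g₀) :=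
  Classical.epsilon_spec ((exists_isHESSolution hD hS κt s g₀).imp fun _ h => h.1)

lemma hesSolution_eq (hD : D.IsContinuous) (hS : D.IsSymmetric) {κt s : ℝ}
    {g₀ : (PhaseIdx n → ℝ) × Matrix (PhaseIdx n) (PhaseIdx n) ℝ}
    {g : ℝ → (PhaseIdx n → ℝ) × Matrix (PhaseIdx n) (PhaseIdx n) ℝ}
    (hg : IsHESSolution D κt s g₀ g) : hesSolution D κt s g₀ = g :=
  isHESSolution_unique hD hS (hesSolution_spec hD hS κt s g₀) hg

/-- The second moments evolve by conjugation with the matriciant. -/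
lemma hesSolution_snd (hD : D.IsContinuous) (hS : D.IsSymmetric) (κt s : ℝ)
    (g₀ : (PhaseIdx n → ℝ) × Matrix (PhaseIdx n) (PhaseIdx n) ℝ) (t : ℝ) :
    (hesSolution D κt s g₀ t).2 =
      matriciant D κt t s * g₀.2 * (matriciant D κt t s)ᵀ := by
  obtain ⟨g, hg, h⟩ := exists_isHESSolution hD hS κt s g₀
  rw [hesSolution_eq hD hS hg, h]

/-- Restarting the Hamilton–Ehrenfest system on a trajectory. -/
lemma hesSolution_restart (hD : D.IsContinuous) (hS : D.IsSymmetric) (κt s r : ℝ)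
    (g₀ : (PhaseIdx n → ℝ) × Matrix (PhaseIdx n) (PhaseIdx n) ℝ) :
    hesSolution D κt r (hesSolution D κt s g₀ r) = hesSolution D κt s g₀ :=
  hesSolution_eq hD hS ⟨rfl, (hesSolution_spec hD hS κt s g₀).2⟩

end HES

end

section

variable {n : ℕ}

/-! ### Position and momentum on Schwartz functions -/

open LineDeriv FourierTransform in
/-- The operators `ẑ` on Schwartz functions. -/
def zS (ħ : ℝ) (k : PhaseIdx n) : 𝓢(Conf n, ℂ) →L[ℂ] 𝓢(Conf n, ℂ) :=
  match k with
  | Sum.inl j => (-Complex.I * ħ) • lineDerivOpCLM ℂ 𝓢(Conf n, ℂ) (EuclideanSpace.single j (1 : ℝ))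
  | Sum.inr j => SchwartzMap.smulLeftCLM ℂ (fun x : Conf n => (x j : ℂ))

lemma hasTemperateGrowth_coord (j : Fin n) :
    Function.HasTemperateGrowth (fun x : Conf n => (x j : ℂ)) :=
  (Complex.ofRealCLM.comp (EuclideanSpace.proj (𝕜 := ℝ) j)).hasTemperateGrowth

lemma zS_inl_apply (ħ : ℝ) (j : Fin n) (f : 𝓢(Conf n, ℂ)) (x : Conf n) :
    zS ħ (Sum.inl j) f x =
      -Complex.I * ħ * fderiv ℝ f x (EuclideanSpace.single j 1) := rfl

lemma zS_inr_apply (ħ : ℝ) (j : Fin n) (f : 𝓢(Conf n, ℂ)) (x : Conf n) :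
    zS ħ (Sum.inr j) f x = (x j : ℂ) * f x := by
  change SchwartzMap.smulLeftCLM ℂ (fun x : Conf n => (x j : ℂ)) f x = _
  rw [SchwartzMap.smulLeftCLM_apply_apply (hasTemperateGrowth_coord j), smul_eq_mul]

lemma coe_zS (ħ : ℝ) (k : PhaseIdx n) (f : 𝓢(Conf n, ℂ)) : ⇑(zS ħ k f) = zOp ħ k f := by
  funext x
  cases k with
  | inl j => exact zS_inl_apply ħ j f x
  | inr j => exact zS_inr_apply ħ j f x

/-- The inner product of Schwartz functions, antilinear in the first argument. -/
def ip (f g : 𝓢(Conf n, ℂ)) : ℂ := ∫ x, star (f x) * g x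

lemma integrable_star_mul (f g : 𝓢(Conf n, ℂ)) :
    Integrable fun x => star (f x) * g x := by
  have h := (SchwartzMap.pairing (ContinuousLinearMap.mul ℝ ℂ)
    (SchwartzMap.postcompCLM (𝕜 := ℝ) Complex.conjCLE.toContinuousLinearMap f) g).integrable
    (μ := volume)
  exact h

lemma ip_add_right (f g h : 𝓢(Conf n, ℂ)) : ip f (g + h) = ip f g + ip f h := by
  rw [ip, ip, ip, ← integral_add (integrable_star_mul f g) (integrable_star_mul f h)]
  simp [mul_add]

lemma ip_smul_right (c : ℂ) (f g : 𝓢(Conf n, ℂ)) : ip f (c • g) = c * ip f g := by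
  rw [ip, ip, ← integral_const_mul]
  congr 1; funext x
  simp; ring

lemma ip_sub_right (f g h : 𝓢(Conf n, ℂ)) : ip f (g - h) = ip f g - ip f h := by
  rw [ip, ip, ip, ← integral_sub (integrable_star_mul f g) (integrable_star_mul f h)]
  simp [mul_sub]

lemma ip_sum_right {ι : Type*} (s : Finset ι) (f : 𝓢(Conf n, ℂ)) (g : ι → 𝓢(Conf n, ℂ)) :
    ip f (∑ i ∈ s, g i) = ∑ i ∈ s, ip f (g i) := by
  classical
  induction s using Finset.induction_on with
  | empty => simp [ip]
  | insert a s ha ih => rw [Finset.sum_insert ha, Finset.sum_insert ha, ip_add_right, ih]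

lemma star_ip (f g : 𝓢(Conf n, ℂ)) : star (ip f g) = ip g f := by
  rw [ip, ip]
  have := integral_conj (μ := volume) (f := fun x => star (f x) * g x)
  rw [← starRingEnd_apply, ← this]
  congr 1; funext x
  simp [mul_comm]

lemma ip_smul_left (c : ℂ) (f g : 𝓢(Conf n, ℂ)) : ip (c • f) g = star c * ip f g := by
  rw [← star_ip, ip_smul_right, star_mul', star_ip]

lemma ip_self (f : 𝓢(Conf n, ℂ)) : ip f f = (normSq f : ℂ) := by
  rw [ip, normSq, ← integral_complex_ofReal]
  congr 1; funext x
  rw [Complex.star_def, ← Complex.normSq_eq_conj_mul_self, Complex.normSq_eq_norm_sq]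

lemma eq_zero_of_ip_self {f : 𝓢(Conf n, ℂ)} (h : ip f f = 0) : f = 0 := by
  rw [ip_self, Complex.ofReal_eq_zero, normSq, integral_eq_zero_iff_of_nonneg
    (fun x => by positivity)] at h
  · have hc : Continuous fun x => ‖f x‖ ^ 2 := by fun_prop
    have := (Continuous.ae_eq_iff_eq volume hc continuous_const).1 h
    ext x
    exact norm_eq_zero.1 (pow_eq_zero_iff two_ne_zero |>.1 (congrFun this x))
  · have := (integrable_star_mul f f).norm
    refine this.congr (Eventually.of_forall fun x => ?_)
    simp [sq]

/-! ### Intertwining operators of symplectic matrices -/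

/-- `T` transports `ẑ` by the matrix `A`, is onto, and is isometric up to a factor. -/
structure IsIntertwiner (ħ : ℝ) (T : 𝓢(Conf n, ℂ) →L[ℂ] 𝓢(Conf n, ℂ))
    (A : Matrix (PhaseIdx n) (PhaseIdx n) ℝ) : Prop where
  zS_map : ∀ k f, zS ħ k (T f) = T (∑ l, (A k l : ℂ) • zS ħ l f)
  surj : Function.Surjective T
  isometry : ∃ C : ℝ, 0 < C ∧ ∀ f g, ip (T f) (T g) = C * ip f g

lemma sum_smul_sum_smul {ι R V : Type*} [Fintype ι] [CommRing R] [AddCommGroup V] [Module R V]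
    (a : ι → R) (b : ι → ι → R) (v : ι → V) :
    ∑ l, a l • ∑ m, b l m • v m = ∑ m, (∑ l, a l * b l m) • v m := by
  simp only [Finset.smul_sum, smul_smul, Finset.sum_smul]
  exact Finset.sum_comm

lemma IsIntertwiner.comp {ħ : ℝ} {T T' : 𝓢(Conf n, ℂ) →L[ℂ] 𝓢(Conf n, ℂ)}
    {A A' : Matrix (PhaseIdx n) (PhaseIdx n) ℝ}
    (hT : IsIntertwiner ħ T A) (hT' : IsIntertwiner ħ T' A') :
    IsIntertwiner ħ (T.comp T') (A * A') := by
  refine ⟨fun k f => ?_, hT.surj.comp hT'.surj, ?_⟩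
  · have e : ∀ m, ∑ l, (A k l : ℂ) * (A' l m : ℂ) = (((A * A') k m : ℝ) : ℂ) := fun l => by
      rw [Matrix.mul_apply]; push_cast; rfl
    have h1 : ∑ l, (A k l : ℂ) • zS ħ l (T' f) =
        T' (∑ m, (((A * A') k m : ℝ) : ℂ) • zS ħ m f) := by
      simp only [hT'.zS_map]
      rw [← Finset.sum_congr rfl fun m _ => congrArg (fun c => c • zS ħ m f) (e m),
        ← sum_smul_sum_smul, map_sum]
      exact Finset.sum_congr rfl fun l _ => (map_smul T' _ _).symm
    rw [ContinuousLinearMap.comp_apply, hT.zS_map, h1]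
    rfl
  · obtain ⟨C, hC, h⟩ := hT.isometry
    obtain ⟨C', hC', h'⟩ := hT'.isometry
    refine ⟨C * C', by positivity, fun f g => ?_⟩
    rw [ContinuousLinearMap.comp_apply, ContinuousLinearMap.comp_apply, h, h']
    push_cast; ring

lemma IsIntertwiner.smul {ħ : ℝ} {T : 𝓢(Conf n, ℂ) →L[ℂ] 𝓢(Conf n, ℂ)}
    {A : Matrix (PhaseIdx n) (PhaseIdx n) ℝ} (hT : IsIntertwiner ħ T A) {c : ℂ} (hc : c ≠ 0) :
    IsIntertwiner ħ (c • T) A := by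
  refine ⟨fun k f => ?_, fun g => ?_, ?_⟩
  · rw [_root_.smul_apply, map_smul, hT.zS_map, _root_.smul_apply]
  · obtain ⟨f, hf⟩ := hT.surj g
    refine ⟨c⁻¹ • f, ?_⟩
    rw [_root_.smul_apply, map_smul, hf, smul_inv_smul₀ hc]
  · obtain ⟨C, hC, h⟩ := hT.isometry
    refine ⟨‖c‖ ^ 2 * C, by positivity, fun f g => ?_⟩
    rw [_root_.smul_apply, _root_.smul_apply, ip_smul_left,
      ip_smul_right, h]
    push_cast
    rw [← Complex.conj_mul', Complex.star_def]
    ring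

lemma IsIntertwiner.injective {ħ : ℝ} {T : 𝓢(Conf n, ℂ) →L[ℂ] 𝓢(Conf n, ℂ)}
    {A : Matrix (PhaseIdx n) (PhaseIdx n) ℝ} (hT : IsIntertwiner ħ T A) {f : 𝓢(Conf n, ℂ)}
    (hf : T f = 0) : f = 0 := by
  obtain ⟨C, hC, h⟩ := hT.isometry
  apply eq_zero_of_ip_self
  have := h f f
  rw [hf] at this
  have h0 : ip (0 : 𝓢(Conf n, ℂ)) 0 = 0 := by simp [ip]
  rw [h0, eq_comm, mul_eq_zero] at this
  exact this.resolve_left (by exact_mod_cast hC.ne')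

/-! Chirps. -/

/-- All derivatives have modulus one. Composition with real polynomials then covers chirps and plane
waves. -/
lemma hasTemperateGrowth_cexp_I : Function.HasTemperateGrowth
    (fun s : ℝ => Complex.exp (s * Complex.I)) := by
  have hd : ∀ m : ℕ, iteratedDeriv m (fun s : ℝ => Complex.exp (s * Complex.I)) =
      fun s : ℝ => Complex.I ^ m * Complex.exp (s * Complex.I) := by
    intro m
    induction m with
    | zero => simp
    | succ m ih =>
      rw [iteratedDeriv_succ, ih]
      funext s
      have h : HasDerivAt (fun s : ℝ => Complex.exp (s * Complex.I))
          (Complex.exp (s * Complex.I) * Complex.I) s := by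
        have := ((Complex.ofRealCLM.hasDerivAt (x := s)).mul_const Complex.I).cexp
        simpa using this
      rw [(h.const_mul _).deriv]
      ring
  refine ⟨(Complex.ofRealCLM.contDiff.mul contDiff_const).cexp, fun m => ⟨0, 1, fun s => ?_⟩⟩
  rw [norm_iteratedFDeriv_eq_norm_iteratedDeriv, hd]
  simp [Complex.norm_exp_ofReal_mul_I]

/-- A configuration as a complex vector. -/
def cvec (x : Conf n) : Fin n → ℂ := fun j => (x j : ℂ)

/-- The quadratic phase `½⟨x, Γx⟩ + ⟨q, x⟩`. -/
def quadPhase (Γ : Matrix (Fin n) (Fin n) ℂ) (q : Fin n → ℂ) (x : Conf n) : ℂ :=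
  (1 / 2) * (cvec x ⬝ᵥ (Γ *ᵥ cvec x)) + q ⬝ᵥ cvec x

/-- The function `exp ((i/ħ) (½⟨x, Γx⟩ + ⟨q, x⟩))`. -/
def gauss (ħ : ℝ) (Γ : Matrix (Fin n) (Fin n) ℂ) (q : Fin n → ℂ) (x : Conf n) : ℂ :=
  Complex.exp (Complex.I / ħ * quadPhase Γ q x)

/-- The coordinates as complex-valued linear maps. -/
def coordCLM (j : Fin n) : Conf n →L[ℝ] ℂ :=
  Complex.ofRealCLM.comp (EuclideanSpace.proj (𝕜 := ℝ) j)

lemma coordCLM_apply (j : Fin n) (x : Conf n) : coordCLM j x = (x j : ℂ) := rfl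

lemma quadPhase_eq_sum (Γ : Matrix (Fin n) (Fin n) ℂ) (q : Fin n → ℂ) (x : Conf n) :
    quadPhase Γ q x = (1 / 2) * ∑ i, ∑ j, coordCLM i x * (Γ i j * coordCLM j x) +
      ∑ j, q j * coordCLM j x := by
  simp [quadPhase, dotProduct, Matrix.mulVec, Finset.mul_sum, cvec, coordCLM_apply]

lemma hasFDerivAt_quadPhase {Γ : Matrix (Fin n) (Fin n) ℂ} (hΓ : Γ.IsSymm) (q : Fin n → ℂ)
    (x : Conf n) :
    HasFDerivAt (quadPhase Γ q) (∑ j, (Γ *ᵥ cvec x + q) j • coordCLM j) x := by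
  have hc : ∀ i : Fin n, HasFDerivAt (fun x => coordCLM i x) (coordCLM i) x :=
    fun i => (coordCLM i).hasFDerivAt
  have h := ((HasFDerivAt.fun_sum (u := Finset.univ) fun i _ => HasFDerivAt.fun_sum
    (u := Finset.univ) fun k _ => (hc i).mul ((hc k).const_mul (Γ i k))).const_mul
      (1 / 2 : ℂ)).add (HasFDerivAt.fun_sum (u := Finset.univ) fun j _ => (hc j).const_mul (q j))
  rw [funext (quadPhase_eq_sum Γ q)]
  refine h.congr_fderiv ?_
  ext v
  simp only [_root_.add_apply, _root_.smul_apply, _root_.sum_apply, smul_eq_mul,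
    Pi.add_apply, Matrix.mulVec, dotProduct, cvec, ← coordCLM_apply, add_mul,
    Finset.sum_add_distrib]
  congr 1
  have h1 : ∀ i k, coordCLM i x * (Γ i k * coordCLM k v) =
      (Γ k i * coordCLM i x) * coordCLM k v := fun i k => by rw [hΓ.apply k i]; ring
  simp only [h1, Finset.sum_mul]
  rw [Finset.sum_comm (f := fun i k => (Γ k i * coordCLM i x) * coordCLM k v)]
  ring

lemma hasFDerivAt_gauss (ħ : ℝ) {Γ : Matrix (Fin n) (Fin n) ℂ} (hΓ : Γ.IsSymm) (q : Fin n → ℂ)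
    (x : Conf n) :
    HasFDerivAt (gauss ħ Γ q)
      ((Complex.I / ħ * gauss ħ Γ q x) • ∑ j, (Γ *ᵥ cvec x + q) j • coordCLM j) x := by
  refine (((hasFDerivAt_quadPhase hΓ q x).const_mul (Complex.I / ħ)).cexp).congr_fderiv ?_
  rw [smul_smul, mul_comm]
  rfl

lemma sum_coordCLM_single (v : Fin n → ℂ) (j : Fin n) :
    (∑ i, v i • coordCLM i) (EuclideanSpace.single j (1 : ℝ)) = v j := by
  simp [_root_.sum_apply, coordCLM_apply, PiLp.single_apply, apply_ite]

/-- The quadratic form of a real matrix on configuration space. -/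
def quadForm (S : Matrix (Fin n) (Fin n) ℝ) (x : Conf n) : ℝ := (x : Fin n → ℝ) ⬝ᵥ (S *ᵥ x)

lemma quadPhase_cplx (S : Matrix (Fin n) (Fin n) ℝ) (x : Conf n) :
    quadPhase (cplx S) 0 x = ((1 / 2 * quadForm S x : ℝ) : ℂ) := by
  simp [quadPhase, quadForm, dotProduct, Matrix.mulVec, cvec]

lemma hasTemperateGrowth_quadForm (S : Matrix (Fin n) (Fin n) ℝ) :
    Function.HasTemperateGrowth (quadForm S) := by
  have h : quadForm S = fun x => ∑ i, ∑ j, x i * (S i j * x j) := by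
    funext x; simp [quadForm, dotProduct, Matrix.mulVec, Finset.mul_sum]
  rw [h]
  have hc : ∀ i : Fin n, Function.HasTemperateGrowth (fun x : Conf n => x i) := fun i =>
    (EuclideanSpace.proj (𝕜 := ℝ) i).hasTemperateGrowth
  exact Function.HasTemperateGrowth.sum fun i _ => Function.HasTemperateGrowth.sum fun j _ =>
    (hc i).mul ((Function.HasTemperateGrowth.const (S i j)).mul (hc j))

lemma gauss_cplx (ħ : ℝ) (S : Matrix (Fin n) (Fin n) ℝ) (x : Conf n) :
    gauss ħ (cplx S) 0 x = Complex.exp ((1 / (2 * ħ) * quadForm S x : ℝ) * Complex.I) := by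
  rw [gauss, quadPhase_cplx]
  congr 1
  push_cast
  simp only [div_eq_mul_inv, mul_inv]
  ring

lemma hasTemperateGrowth_chirp (ħ : ℝ) (S : Matrix (Fin n) (Fin n) ℝ) :
    Function.HasTemperateGrowth (gauss ħ (cplx S) 0) := by
  have h : Function.HasTemperateGrowth (fun x : Conf n => 1 / (2 * ħ) * quadForm S x) :=
    (Function.HasTemperateGrowth.const _).mul (hasTemperateGrowth_quadForm S)
  rw [funext (gauss_cplx ħ S)]
  exact hasTemperateGrowth_cexp_I.comp h

/-- Multiplication by the chirp `exp (i⟨x, Sx⟩ / 2ħ)`. -/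
def chirpCLM (ħ : ℝ) (S : Matrix (Fin n) (Fin n) ℝ) : 𝓢(Conf n, ℂ) →L[ℂ] 𝓢(Conf n, ℂ) :=
  SchwartzMap.smulLeftCLM ℂ (gauss ħ (cplx S) 0)

lemma chirpCLM_apply (ħ : ℝ) (S : Matrix (Fin n) (Fin n) ℝ) (f : 𝓢(Conf n, ℂ)) (x : Conf n) :
    chirpCLM ħ S f x = gauss ħ (cplx S) 0 x * f x := by
  rw [chirpCLM, SchwartzMap.smulLeftCLM_apply_apply (hasTemperateGrowth_chirp ħ S), smul_eq_mul]

lemma sum_smul_apply {ι : Type*} (s : Finset ι) (c : ι → ℂ) (f : ι → 𝓢(Conf n, ℂ)) (x : Conf n) :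
    (∑ i ∈ s, c i • f i) x = ∑ i ∈ s, c i * f i x := by
  classical
  induction s using Finset.induction_on with
  | empty => simp
  | insert a s ha ih => rw [Finset.sum_insert ha, Finset.sum_insert ha, ← ih]; rfl

lemma ofReal_one_apply_mul_sum {ι : Type*} [Fintype ι] [DecidableEq ι] (j : ι) (v : ι → ℂ) :
    ∑ i, (((1 : Matrix ι ι ℝ) j i : ℝ) : ℂ) * v i = v j := by
  simp [Matrix.one_apply, ite_mul, apply_ite]

/-- Differentiating the chirp e gives p(ef) = e(p + Sx)f, while x commutes with e. The chirp has
modulus one and its reciprocal is the chirp of -S. -/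
lemma isIntertwiner_chirp {ħ : ℝ} (hħ : 0 < ħ) {S : Matrix (Fin n) (Fin n) ℝ} (hS : S.IsSymm) :
    IsIntertwiner ħ (chirpCLM ħ S) (Matrix.fromBlocks 1 S 0 1) := by
  have hħ' : (ħ : ℂ) ≠ 0 := by exact_mod_cast hħ.ne'
  have hS' : (cplx S).IsSymm := by
    rw [Matrix.IsSymm, ← Matrix.transpose_map, hS.eq]
  refine ⟨fun k f => ?_, fun f => ⟨chirpCLM ħ (-S) f, ?_⟩, 1, one_pos, fun f g => ?_⟩
  · ext x
    rw [chirpCLM_apply, sum_smul_apply, Fintype.sum_sum_type]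
    cases k with
    | inl j =>
      have h4 := ((hasFDerivAt_gauss ħ hS' 0 x).fun_mul (f.hasFDerivAt x)).fderiv
      rw [zS_inl_apply, funext (chirpCLM_apply ħ S f), h4]
      simp only [zS_inl_apply, zS_inr_apply, Matrix.fromBlocks_apply₁₁, Matrix.fromBlocks_apply₁₂,
        ofReal_one_apply_mul_sum, _root_.add_apply, _root_.smul_apply, sum_coordCLM_single,
        smul_eq_mul, add_zero, Matrix.mulVec, dotProduct, cvec, Matrix.map_apply]
      simp only [← mul_assoc, ← Finset.sum_mul]
      field_simp
      ring_nf
      rw [Complex.I_sq]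
      ring
    | inr j =>
      simp only [zS_inr_apply, chirpCLM_apply, Matrix.fromBlocks_apply₂₁,
        Matrix.fromBlocks_apply₂₂, ofReal_one_apply_mul_sum, Matrix.zero_apply,
        Complex.ofReal_zero, zero_mul, Finset.sum_const_zero, zero_add]
      ring
  · ext x
    rw [chirpCLM_apply, chirpCLM_apply, ← mul_assoc, gauss_cplx, gauss_cplx, ← Complex.exp_add]
    simp [quadForm, Matrix.neg_mulVec]
  · rw [Complex.ofReal_one, one_mul, ip, ip]
    congr 1; funext x
    rw [chirpCLM_apply, chirpCLM_apply, star_mul']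
    have h : star (gauss ħ (cplx S) 0 x) * gauss ħ (cplx S) 0 x = 1 := by
      rw [Complex.star_def, ← Complex.normSq_eq_conj_mul_self, Complex.normSq_eq_norm_sq,
        gauss_cplx, Complex.norm_exp_ofReal_mul_I]
      simp
    linear_combination (star (f x) * g x) * h

/-! Linear substitutions. -/

/-- Substitution by an invertible matrix. -/
def substCLM (g : Conf n ≃L[ℝ] Conf n) : 𝓢(Conf n, ℂ) →L[ℂ] 𝓢(Conf n, ℂ) :=
  SchwartzMap.compCLMOfContinuousLinearEquiv ℂ g

lemma substCLM_apply (g : Conf n ≃L[ℝ] Conf n) (f : 𝓢(Conf n, ℂ)) (x : Conf n) :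
    substCLM g f x = f (g x) := rfl

lemma ip_substCLM (g : Conf n ≃L[ℝ] Conf n) :
    ∃ C : ℝ, 0 < C ∧ ∀ f h : 𝓢(Conf n, ℂ), ip (substCLM g f) (substCLM g h) = C * ip f h := by
  have hdet : LinearMap.det (g : Conf n →ₗ[ℝ] Conf n) ≠ 0 :=
    (LinearEquiv.isUnit_det' g.toLinearEquiv).ne_zero
  refine ⟨|(LinearMap.det (g : Conf n →ₗ[ℝ] Conf n))⁻¹|, by positivity, fun f h => ?_⟩
  have hmap := MeasureTheory.Measure.map_linearMap_addHaar_eq_smul_addHaar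
    (volume : Measure (Conf n)) hdet
  have h1 : ∫ x, star (f (g x)) * h (g x) =
      ∫ x, star (f x) * h x ∂(Measure.map (g : Conf n →ₗ[ℝ] Conf n) volume) := by
    symm
    exact (g.toHomeomorph.measurableEmbedding).integral_map (fun x => star (f x) * h x)
  rw [ip, ip]
  simp only [substCLM_apply]
  rw [h1, hmap, integral_smul_measure, ENNReal.toReal_ofReal (abs_nonneg _), Complex.real_smul]

/-- The chain rule produces Gᵀ on momenta, and x = G⁻¹(Gx) produces the inverse on positions. -/
lemma isIntertwiner_subst (ħ : ℝ) (g : Conf n ≃L[ℝ] Conf n) {G G' : Matrix (Fin n) (Fin n) ℝ}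
    (hG : ∀ x i, g x i = (G *ᵥ x) i) (hG' : G' * G = 1) :
    IsIntertwiner ħ (substCLM g) (Matrix.fromBlocks Gᵀ 0 0 G') := by
  refine ⟨fun k f => ?_, fun f => ⟨substCLM g.symm f, ?_⟩, ip_substCLM g⟩
  · ext x
    rw [substCLM_apply, sum_smul_apply, Fintype.sum_sum_type]
    cases k with
    | inl j =>
      have h1 : fderiv ℝ (substCLM g f) x (EuclideanSpace.single j 1) =
          fderiv ℝ f (g x) (g (EuclideanSpace.single j 1)) := by
        have := ((f.hasFDerivAt (g x)).comp x g.hasFDerivAt).fderiv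
        change fderiv ℝ (f ∘ g) x _ = _
        rw [this]; rfl
      have h2 : g (EuclideanSpace.single j 1) =
          ∑ i, G i j • EuclideanSpace.single i (1 : ℝ) := by
        ext i
        rw [hG]
        simp [Matrix.mulVec, dotProduct, Pi.single_apply]
      rw [zS_inl_apply, h1, h2]
      simp [map_sum, zS_inl_apply, Finset.mul_sum]
      exact Finset.sum_congr rfl fun i _ => by ring
    | inr j =>
      have h3 : x j = ∑ i, G' j i * g x i := by
        have : (G' *ᵥ (G *ᵥ x)) j = x j := by rw [Matrix.mulVec_mulVec, hG', Matrix.one_mulVec]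
        rw [← this]
        simp only [Matrix.mulVec, dotProduct, hG]
      simp [zS_inr_apply, substCLM_apply, h3, Finset.sum_mul]
      exact Finset.sum_congr rfl fun i _ => by ring
  · ext x
    simp [substCLM_apply]

/-! The Fourier transform. -/

-- The Fourier transform exchanges differentiation and multiplication by a coordinate. With the
-- kernel e^{-2πi⟨x,ξ⟩}, the dilation by 1/(2πħ) is what turns this exchange into p ↦ -x, x ↦ p
-- without constants.
open FourierTransform LineDeriv in
lemma exists_isIntertwiner_J {ħ : ℝ} (hħ : 0 < ħ) :
    ∃ T : 𝓢(Conf n, ℂ) →L[ℂ] 𝓢(Conf n, ℂ), IsIntertwiner ħ T (Matrix.J (Fin n) ℝ) := by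
  have hħ' : (ħ : ℂ) ≠ 0 := by exact_mod_cast hħ.ne'
  have hπ : (Real.pi : ℂ) ≠ 0 := by exact_mod_cast Real.pi_ne_zero
  have hu : (2 * Real.pi * ħ)⁻¹ ≠ 0 := by positivity
  set g : Conf n ≃L[ℝ] Conf n := ContinuousLinearEquiv.smulLeft (Units.mk0 _ hu) with hg
  have hgx : ∀ x, g x = (2 * Real.pi * ħ)⁻¹ • x := fun x => rfl
  have hin : ∀ (j : Fin n) (f : 𝓢(Conf n, ℂ)) (x : Conf n),
      SchwartzMap.smulLeftCLM ℂ (inner ℝ · (EuclideanSpace.single j (1 : ℝ))) f x =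
        (x j : ℂ) * f x := by
    intro j f x
    rw [SchwartzMap.smulLeftCLM_apply_apply (by fun_prop)]
    simp [EuclideanSpace.inner_single_right]
  refine ⟨(substCLM g).comp (SchwartzMap.fourierTransformCLM ℂ), fun k f => ?_, fun f => ?_, ?_⟩
  · have hT : ∀ f x, ((substCLM g).comp (SchwartzMap.fourierTransformCLM ℂ)) f x =
        𝓕 f (g x) := fun f x => rfl
    cases k with
    | inl j =>
      have h0 : ∑ l, ((Matrix.J (Fin n) ℝ (Sum.inl j) l : ℝ) : ℂ) • zS ħ l f =
          -zS ħ (Sum.inr j) f := by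
        rw [Fintype.sum_sum_type]
        simp [Matrix.J, Matrix.one_apply, Finset.sum_ite_eq, apply_ite, ite_smul]
      rw [h0]
      ext x
      have h1 : zS ħ (Sum.inl j) (((substCLM g).comp (SchwartzMap.fourierTransformCLM ℂ)) f) x =
          -Complex.I * ħ * ((2 * Real.pi * ħ)⁻¹ : ℝ) *
            (∂_{EuclideanSpace.single j (1 : ℝ)} (𝓕 f)) (g x) := by
        rw [zS_inl_apply]
        have := (((𝓕 f).hasFDerivAt (g x)).comp x g.hasFDerivAt).fderiv
        change _ * fderiv ℝ ((𝓕 f : 𝓢(Conf n, ℂ)) ∘ g) x _ = _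
        rw [this, SchwartzMap.lineDerivOp_apply_eq_fderiv, ContinuousLinearMap.comp_apply]
        change _ * fderiv ℝ (𝓕 f : 𝓢(Conf n, ℂ)) (g x) (g (EuclideanSpace.single j 1)) = _
        rw [hgx (EuclideanSpace.single j 1), map_smul, Complex.real_smul]
        ring
      rw [h1, SchwartzMap.lineDerivOp_fourier_eq, hT]
      have h2 : SchwartzMap.smulLeftCLM ℂ (inner ℝ · (EuclideanSpace.single j (1 : ℝ))) f =
          zS ħ (Sum.inr j) f := by
        ext y; rw [hin, zS_inr_apply]
      rw [h2, FourierTransform.fourier_smul, FourierTransform.fourier_neg]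
      simp only [_root_.neg_apply, _root_.smul_apply, smul_eq_mul]
      push_cast
      field_simp
      rw [Complex.I_sq]; ring
    | inr j =>
      have h0 : ∑ l, ((Matrix.J (Fin n) ℝ (Sum.inr j) l : ℝ) : ℂ) • zS ħ l f =
          zS ħ (Sum.inl j) f := by
        rw [Fintype.sum_sum_type]
        simp [Matrix.J, Matrix.one_apply, Finset.sum_ite_eq, apply_ite, ite_smul]
      rw [h0]
      ext x
      rw [zS_inr_apply, hT, hT]
      change _ = 𝓕 ((-Complex.I * ħ) • ∂_{EuclideanSpace.single j (1 : ℝ)} f) (g x)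
      rw [FourierTransform.fourier_smul, SchwartzMap.fourier_lineDerivOp_eq]
      simp only [_root_.smul_apply, smul_eq_mul, hin, hgx, PiLp.smul_apply]
      push_cast
      field_simp
      rw [Complex.I_sq]; ring
  · refine ⟨𝓕⁻ (substCLM g.symm f), ?_⟩
    ext x
    change 𝓕 (𝓕⁻ (substCLM g.symm f)) (g x) = f x
    rw [FourierTransform.fourier_fourierInv_eq, substCLM_apply]
    simp
  · obtain ⟨C, hC, h⟩ := ip_substCLM (n := n) g
    refine ⟨C, hC, fun f h' => ?_⟩
    rw [ContinuousLinearMap.comp_apply, ContinuousLinearMap.comp_apply, h]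
    congr 1
    have := SchwartzMap.integral_inner_fourier_fourier f h'
    simp only [RCLike.inner_apply'] at this
    exact this

end

section

variable {n : ℕ}

/-! ### Blocks of symplectic matrices -/

/-- The relations between the blocks of a symplectic matrix `[[a, b], [c, d]]`. -/
structure IsSympl (a b c d : Matrix (Fin n) (Fin n) ℝ) : Prop where
  ac : aᵀ * c = cᵀ * a
  bd : bᵀ * d = dᵀ * b
  adcb : aᵀ * d - cᵀ * b = 1

namespace IsSympl

variable {a b c d : Matrix (Fin n) (Fin n) ℝ}

lemma dabc (h : IsSympl a b c d) : dᵀ * a - bᵀ * c = 1 := by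
  have := congrArg Matrix.transpose h.adcb
  simpa [Matrix.transpose_sub, Matrix.transpose_mul] using this

lemma of_fromBlocks
    (h : (Matrix.fromBlocks a b c d)ᵀ * Matrix.J (Fin n) ℝ * Matrix.fromBlocks a b c d =
      Matrix.J (Fin n) ℝ) : IsSympl a b c d := by
  rw [Matrix.J, Matrix.fromBlocks_transpose, Matrix.fromBlocks_multiply,
    Matrix.fromBlocks_multiply, Matrix.fromBlocks_inj] at h
  simp only [Matrix.mul_zero, Matrix.mul_one, zero_add, add_zero, Matrix.mul_neg,
    Matrix.neg_mul] at h
  obtain ⟨h1, h2, h3, h4⟩ := h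
  refine ⟨?_, ?_, ?_⟩
  · rw [← sub_eq_zero, ← neg_eq_zero, ← h1]; abel
  · rw [← sub_eq_zero, ← neg_eq_zero, ← h4]; abel
  · rw [← neg_inj, ← h2]; abel

end IsSympl

lemma cplx_mul (M N : Matrix (Fin n) (Fin n) ℝ) : cplx (M * N) = cplx M * cplx N :=
  Matrix.map_mul (f := Complex.ofRealHom)

lemma cplx_transpose (M : Matrix (Fin n) (Fin n) ℝ) : cplx Mᵀ = (cplx M)ᵀ := rfl

lemma cplx_conjTranspose (M : Matrix (Fin n) (Fin n) ℝ) : (cplx M)ᴴ = (cplx M)ᵀ := by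
  ext i j; simp

lemma cplx_sub (M N : Matrix (Fin n) (Fin n) ℝ) : cplx (M - N) = cplx M - cplx N := by
  ext i j; simp

lemma cplx_add (M N : Matrix (Fin n) (Fin n) ℝ) : cplx (M + N) = cplx M + cplx N := by
  ext i j; simp

lemma cplx_neg (M : Matrix (Fin n) (Fin n) ℝ) : cplx (-M) = -cplx M := by
  ext i j; simp

lemma cplx_one : cplx (1 : Matrix (Fin n) (Fin n) ℝ) = 1 := by
  ext i j; simp [Matrix.one_apply, apply_ite]

lemma cplx_det (M : Matrix (Fin n) (Fin n) ℝ) : (cplx M).det = ((M.det : ℝ) : ℂ) :=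
  (RingHom.map_det Complex.ofRealHom M).symm

/-- `-c + iε d`. -/
def frameM (c d : Matrix (Fin n) (Fin n) ℝ) (ε : ℝ) : Matrix (Fin n) (Fin n) ℂ :=
  -cplx c + (Complex.I * ε) • cplx d

/-- `a - iε b`. -/
def frameL (a b : Matrix (Fin n) (Fin n) ℝ) (ε : ℝ) : Matrix (Fin n) (Fin n) ℂ :=
  cplx a - (Complex.I * ε) • cplx b

/-- The complex symmetric matrix `Γ = -(a - iε b)(-c + iε d)⁻¹`. -/
def frameG (a b c d : Matrix (Fin n) (Fin n) ℝ) (ε : ℝ) : Matrix (Fin n) (Fin n) ℂ :=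
  -(frameL a b ε * (frameM c d ε)⁻¹)

namespace IsSympl

variable {a b c d : Matrix (Fin n) (Fin n) ℝ}

lemma cplx_rel (h : IsSympl a b c d) :
    (cplx a)ᵀ * cplx c = (cplx c)ᵀ * cplx a ∧ (cplx b)ᵀ * cplx d = (cplx d)ᵀ * cplx b ∧
      (cplx a)ᵀ * cplx d - (cplx c)ᵀ * cplx b = 1 ∧
      (cplx d)ᵀ * cplx a - (cplx b)ᵀ * cplx c = 1 := by
  simp only [← cplx_transpose, ← cplx_mul, ← cplx_sub, h.ac, h.bd, h.adcb, h.dabc, cplx_one,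
    and_self]

/-- The columns of L stacked over -M are the image under [[a, b], [c, d]] of the complex Lagrangian
plane x = -iεp. This identity says that the image is Lagrangian; the next one is its symplectic
pairing with the image of the plane p = 0; the third is the conserved Hermitian form, definite for ε
≠ 0. -/
lemma frame_symm (h : IsSympl a b c d) (ε : ℝ) :
    (frameL a b ε)ᵀ * frameM c d ε = (frameM c d ε)ᵀ * frameL a b ε := by
  obtain ⟨h1, h2, h3, h4⟩ := h.cplx_rel
  rw [frameL, frameM]
  simp only [Matrix.transpose_add, Matrix.transpose_sub, Matrix.transpose_neg,
    Matrix.transpose_smul, Matrix.add_mul, Matrix.sub_mul, Matrix.mul_add, Matrix.mul_sub,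
    Matrix.neg_mul, Matrix.mul_neg, Matrix.smul_mul, Matrix.mul_smul, h1, h2,
    eq_add_of_sub_eq h3, eq_add_of_sub_eq h4]
  module

lemma frame_dual (h : IsSympl a b c d) (ε : ℝ) :
    (frameM c d ε)ᵀ * cplx b + (frameL a b ε)ᵀ * cplx d = 1 := by
  obtain ⟨h1, h2, h3, h4⟩ := h.cplx_rel
  rw [frameL, frameM]
  simp only [Matrix.transpose_add, Matrix.transpose_sub, Matrix.transpose_neg,
    Matrix.transpose_smul, Matrix.add_mul, Matrix.sub_mul, Matrix.neg_mul, Matrix.smul_mul, h2,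
    eq_add_of_sub_eq h3]
  module

lemma frame_star (h : IsSympl a b c d) (ε : ℝ) :
    (frameM c d ε)ᴴ * frameL a b ε - (frameL a b ε)ᴴ * frameM c d ε =
      (-2 * Complex.I * ε) • (1 : Matrix (Fin n) (Fin n) ℂ) := by
  obtain ⟨h1, h2, h3, h4⟩ := h.cplx_rel
  have hs : star (Complex.I * (ε : ℂ)) = -(Complex.I * ε) := by simp
  rw [frameL, frameM]
  simp only [Matrix.conjTranspose_add, Matrix.conjTranspose_sub, Matrix.conjTranspose_neg,
    Matrix.conjTranspose_smul, cplx_conjTranspose, hs,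
    Matrix.add_mul, Matrix.sub_mul, Matrix.mul_add, Matrix.mul_sub,
    Matrix.neg_mul, Matrix.mul_neg, Matrix.smul_mul, Matrix.mul_smul, h1, h2,
    eq_add_of_sub_eq h3, eq_add_of_sub_eq h4]
  module

-- On a kernel vector v of M the Hermitian identity `frame_star` reduces to ε|v|² = 0. This is why
-- the regularized kernel has no caustics.
open scoped ComplexOrder in
lemma frameM_det_ne_zero (h : IsSympl a b c d) {ε : ℝ} (hε : ε ≠ 0) :
    (frameM c d ε).det ≠ 0 := by
  intro h0
  obtain ⟨v, hv, hv0⟩ := Matrix.exists_mulVec_eq_zero_iff.2 h0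
  have h1 := congrArg (fun M => star v ⬝ᵥ (M *ᵥ v)) (h.frame_star ε)
  simp only [Matrix.sub_mulVec, ← Matrix.mulVec_mulVec, hv0, Matrix.mulVec_zero, sub_zero,
    Matrix.smul_mulVec, Matrix.one_mulVec, dotProduct_smul] at h1
  rw [Matrix.dotProduct_mulVec, ← Matrix.star_mulVec, hv0, star_zero, zero_dotProduct,
    eq_comm, smul_eq_zero] at h1
  rcases h1 with h1 | h1
  · have : (ε : ℂ) ≠ 0 := by exact_mod_cast hε
    simp [this] at h1
  · exact hv ((dotProduct_star_self_eq_zero.1 h1))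

/-- Some real combination `c + μ d` is invertible. -/
lemma exists_det_ne_zero (h : IsSympl a b c d) : ∃ μ : ℝ, (c + μ • d).det ≠ 0 := by
  by_contra! hall
  -- If every real μ failed, the polynomial det(c + μd) would vanish identically, and hence also at
  -- μ = i. But c + id is, up to sign, the frame with ε = -1, which is invertible.
  set p : Polynomial ℝ := ((c.map Polynomial.C + (Polynomial.X : Polynomial ℝ) • d.map Polynomial.C :
      Matrix (Fin n) (Fin n) (Polynomial ℝ))).det with hp
  have hpe : ∀ μ : ℝ, p.eval μ = 0 := by
    intro μ
    rw [← hall μ, hp, ← Polynomial.coe_evalRingHom, RingHom.map_det]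
    congr 1
    ext i j
    simp
    exact mul_comm _ _
  have hp0 : p = 0 := Polynomial.funext fun μ => by rw [hpe μ, Polynomial.eval_zero]
  have h1 : (cplx c + Complex.I • cplx d).det = Polynomial.eval₂ Complex.ofRealHom Complex.I p := by
    rw [hp, ← Polynomial.coe_eval₂RingHom, RingHom.map_det]
    congr 1
    ext i j
    simp
    exact mul_comm _ _
  rw [hp0, Polynomial.eval₂_zero] at h1
  refine h.frameM_det_ne_zero (ε := -1) (by norm_num) ?_
  have h2 : frameM c d (-1) = -(cplx c + Complex.I • cplx d) := by
    rw [frameM]; push_cast; module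
  rw [h2, Matrix.det_neg, h1, mul_zero]

end IsSympl

/-! ### Existence of intertwining operators -/

lemma IsIntertwiner.congr {ħ : ℝ} {T : 𝓢(Conf n, ℂ) →L[ℂ] 𝓢(Conf n, ℂ)}
    {A B : Matrix (PhaseIdx n) (PhaseIdx n) ℝ} (hT : IsIntertwiner ħ T A) (h : A = B) :
    IsIntertwiner ħ T B := h ▸ hT

/-- When c is invertible the matrix factors as [[1, ac⁻¹], [0, 1]] · diag(c⁻ᵀ, c) · J · [[1, c⁻¹d],
[0, 1]]: chirp, substitution, Fourier transform, chirp. The symplectic relations make ac⁻¹ and c⁻¹d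
symmetric and determine b. -/
lemma exists_isIntertwiner_of_block {ħ : ℝ} (hħ : 0 < ħ) {a b c d : Matrix (Fin n) (Fin n) ℝ}
    (h : IsSympl a b c d) (hc : c.det ≠ 0) :
    ∃ T, IsIntertwiner ħ T (Matrix.fromBlocks a b c d) := by
  have hcu : IsUnit c.det := hc.isUnit
  have hcT : c⁻¹ᵀ * cᵀ = 1 := by
    rw [← Matrix.transpose_mul, Matrix.mul_nonsing_inv _ hcu, Matrix.transpose_one]
  have hs1 : c⁻¹ᵀ * aᵀ = a * c⁻¹ := by
    calc c⁻¹ᵀ * aᵀ = c⁻¹ᵀ * (aᵀ * c) * c⁻¹ := by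
          rw [Matrix.mul_assoc, Matrix.mul_assoc, Matrix.mul_nonsing_inv _ hcu, Matrix.mul_one]
      _ = c⁻¹ᵀ * cᵀ * a * c⁻¹ := by rw [h.ac]; simp only [Matrix.mul_assoc]
      _ = a * c⁻¹ := by rw [hcT, Matrix.one_mul]
  have hS1 : (a * c⁻¹).IsSymm := by rw [Matrix.IsSymm, Matrix.transpose_mul, hs1]
  have hb : b = a * c⁻¹ * d - c⁻¹ᵀ := by
    have h1 : c⁻¹ᵀ * (aᵀ * d - cᵀ * b) = c⁻¹ᵀ := by rw [h.adcb, Matrix.mul_one]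
    rw [Matrix.mul_sub, ← Matrix.mul_assoc, ← Matrix.mul_assoc, hcT, hs1, Matrix.one_mul] at h1
    rw [← h1]; abel
  have hS2 : (c⁻¹ * d).IsSymm := by
    have h1 := h.bd
    rw [hb, Matrix.transpose_sub, Matrix.transpose_mul, hS1.eq, Matrix.transpose_transpose,
      Matrix.sub_mul, Matrix.mul_sub, Matrix.mul_assoc dᵀ] at h1
    rw [Matrix.IsSymm, Matrix.transpose_mul]
    exact (sub_right_inj.1 h1).symm
  have hci : IsUnit (c⁻¹).det := by rwa [Matrix.isUnit_nonsing_inv_det_iff]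
  set g : Conf n ≃L[ℝ] Conf n := ((WithLp.linearEquiv 2 ℝ (Fin n → ℝ)).trans
    ((Matrix.toLinearEquiv' c⁻¹ (Matrix.invertibleOfIsUnitDet _ hci)).trans
      (WithLp.linearEquiv 2 ℝ (Fin n → ℝ)).symm)).toContinuousLinearEquiv with hg
  have hgx : ∀ (x : Conf n) i, g x i = (c⁻¹ *ᵥ x) i := fun x i => rfl
  obtain ⟨F, hF⟩ := exists_isIntertwiner_J (n := n) hħ
  have key := (isIntertwiner_chirp hħ hS1).comp
    (((isIntertwiner_subst ħ g hgx (Matrix.mul_nonsing_inv _ hcu)).comp hF).comp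
      (isIntertwiner_chirp hħ hS2))
  refine ⟨_, key.congr ?_⟩
  rw [Matrix.J]
  simp only [Matrix.fromBlocks_multiply, Matrix.mul_zero, Matrix.mul_one, zero_add, add_zero,
    Matrix.mul_neg, Matrix.zero_mul, Matrix.one_mul, neg_zero,
    Matrix.mul_nonsing_inv_cancel_left _ _ hcu, Matrix.nonsing_inv_mul_cancel_right _ _ hcu]
  congr 1
  rw [hb]; abel

/-- Every symplectic matrix has an intertwining operator. -/
lemma exists_isIntertwiner {ħ : ℝ} (hħ : 0 < ħ) {a b c d : Matrix (Fin n) (Fin n) ℝ}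
    (h : IsSympl a b c d) : ∃ T, IsIntertwiner ħ T (Matrix.fromBlocks a b c d) := by
  obtain ⟨μ, hμ⟩ := h.exists_det_ne_zero
  -- Right multiplication by the shear [[1, 0], [μ, 1]] moves an invertible matrix into the lower
  -- left corner.
  have h' : IsSympl (a + μ • b) b (c + μ • d) d := by
    refine ⟨?_, h.bd, ?_⟩
    · have h1 := eq_add_of_sub_eq h.adcb
      have h2 := eq_add_of_sub_eq h.dabc
      simp only [Matrix.transpose_add, Matrix.transpose_smul, Matrix.add_mul, Matrix.mul_add,
        Matrix.smul_mul, Matrix.mul_smul, h.ac, h.bd, h1, h2]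
      module
    · simp only [Matrix.transpose_add, Matrix.transpose_smul, Matrix.add_mul, Matrix.smul_mul,
        h.bd, eq_add_of_sub_eq h.adcb]
      module
  obtain ⟨T, hT⟩ := exists_isIntertwiner_of_block hħ h' hμ
  -- The inverse shear, which undoes the correction, is a chirp conjugated by J. The matrix J⁻¹ has
  -- lower left block -1, so the preceding lemma supplies its operator.
  obtain ⟨N, hN⟩ : ∃ N, IsIntertwiner ħ N
      (Matrix.fromBlocks (1 : Matrix (Fin n) (Fin n) ℝ) 0 ((-μ) • 1) 1) := by
    obtain ⟨F, hF⟩ := exists_isIntertwiner_J (n := n) hħ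
    have hS : (μ • (1 : Matrix (Fin n) (Fin n) ℝ)).IsSymm := by simp [Matrix.IsSymm]
    obtain ⟨P, hP⟩ := exists_isIntertwiner_of_block (n := n) hħ (a := 0) (b := 1) (c := -1) (d := 0)
      (by refine ⟨?_, ?_, ?_⟩ <;> simp) (by simp [Matrix.det_neg])
    refine ⟨_, ((hF.comp (isIntertwiner_chirp hħ hS)).comp hP).congr ?_⟩
    rw [Matrix.J]
    simp [Matrix.fromBlocks_multiply]
  refine ⟨_, (hT.comp hN).congr ?_⟩
  simp [Matrix.fromBlocks_multiply]

end

section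

variable {n : ℕ}

/-! ### Gaussian packets -/

/-- The Gaussian packet which a symplectic matrix `[[a, b], [c, d]]` makes out of a Gaussian of
width `√(ħε)` centred at `y`; `r` is a root of the determinant. -/
def packet (ħ : ℝ) (r : ℂ) (a b c d : Matrix (Fin n) (Fin n) ℝ) (ε : ℝ) (y x : Conf n) : ℂ :=
  r⁻¹ * Complex.exp (Complex.I / ħ *
    (-(1 / 2) * (cvec y ⬝ᵥ (((frameM c d ε)⁻¹ * cplx d) *ᵥ cvec y)))) *
    gauss ħ (frameG a b c d ε) ((frameM c d ε)⁻¹ᵀ *ᵥ cvec y) x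

lemma dotProduct_mulVec_symm {R ι : Type*} [Fintype ι] [CommRing R] (M : Matrix ι ι R)
    (v w : ι → R) : v ⬝ᵥ (M *ᵥ w) = w ⬝ᵥ (Mᵀ *ᵥ v) := by
  rw [Matrix.dotProduct_mulVec, ← Matrix.mulVec_transpose, dotProduct_comm]

lemma mulVec_dotProduct_eq {R ι : Type*} [Fintype ι] [CommRing R] (M : Matrix ι ι R)
    (v w : ι → R) : (M *ᵥ v) ⬝ᵥ w = v ⬝ᵥ (Mᵀ *ᵥ w) := by
  rw [dotProduct_comm, dotProduct_mulVec_symm]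

namespace IsSympl

variable {a b c d : Matrix (Fin n) (Fin n) ℝ}

section

variable (h : IsSympl a b c d) {ε : ℝ} (hε : ε ≠ 0)
include h hε

lemma frameM_isUnit : IsUnit (frameM c d ε).det := (h.frameM_det_ne_zero hε).isUnit

lemma frameM_mul_inv : frameM c d ε * (frameM c d ε)⁻¹ = 1 :=
  Matrix.mul_nonsing_inv _ (h.frameM_isUnit hε)

lemma frameM_inv_mul : (frameM c d ε)⁻¹ * frameM c d ε = 1 :=
  Matrix.nonsing_inv_mul _ (h.frameM_isUnit hε)

lemma frameM_invT_mul : (frameM c d ε)⁻¹ᵀ * (frameM c d ε)ᵀ = 1 := by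
  rw [← Matrix.transpose_mul, h.frameM_mul_inv hε, Matrix.transpose_one]

lemma frameG_symm : (frameG a b c d ε).IsSymm := by
  rw [Matrix.IsSymm, frameG, Matrix.transpose_neg, Matrix.transpose_mul]
  congr 1
  calc (frameM c d ε)⁻¹ᵀ * (frameL a b ε)ᵀ
      = (frameM c d ε)⁻¹ᵀ * ((frameL a b ε)ᵀ * frameM c d ε) * (frameM c d ε)⁻¹ := by
        rw [Matrix.mul_assoc, Matrix.mul_assoc, h.frameM_mul_inv hε, Matrix.mul_one]
    _ = (frameM c d ε)⁻¹ᵀ * (frameM c d ε)ᵀ * frameL a b ε * (frameM c d ε)⁻¹ := by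
        rw [h.frame_symm]; simp only [Matrix.mul_assoc]
    _ = _ := by rw [h.frameM_invT_mul hε, Matrix.one_mul]

lemma frameG_mul_frameM : frameG a b c d ε * frameM c d ε = -frameL a b ε := by
  rw [frameG, Matrix.neg_mul, Matrix.mul_assoc, h.frameM_inv_mul hε, Matrix.mul_one]

/-- This is `frame_dual` multiplied by M⁻ᵀ, with M⁻ᵀLᵀ = -Γ by symmetry of Γ. It removes M⁻¹ from
the phase of a packet in favour of Γ and real matrices. -/
lemma frameM_invT_eq : (frameM c d ε)⁻¹ᵀ = cplx b - frameG a b c d ε * cplx d := by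
  have h1 := congrArg (fun M => (frameM c d ε)⁻¹ᵀ * M) (h.frame_dual ε)
  simp only [Matrix.mul_add, Matrix.mul_one, ← Matrix.mul_assoc, h.frameM_invT_mul hε,
    Matrix.one_mul] at h1
  have h2 := h.frameG_symm hε
  rw [Matrix.IsSymm, frameG, Matrix.transpose_neg, Matrix.transpose_mul] at h2
  rw [← h1, frameG, ← h2, Matrix.neg_mul, sub_neg_eq_add]

/-- Completing the square about the transported centre dy. The terms left over are real, so only the
square contributes to the modulus of a packet. -/
lemma packet_phase (y x : Conf n) :
    -(1 / 2) * (cvec y ⬝ᵥ (((frameM c d ε)⁻¹ * cplx d) *ᵥ cvec y)) +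
      quadPhase (frameG a b c d ε) ((frameM c d ε)⁻¹ᵀ *ᵥ cvec y) x =
    (1 / 2) * ((cvec x - cplx d *ᵥ cvec y) ⬝ᵥ
        (frameG a b c d ε *ᵥ (cvec x - cplx d *ᵥ cvec y))) +
      (cplx b *ᵥ cvec y) ⬝ᵥ cvec x -
      (1 / 2) * ((cplx b *ᵥ cvec y) ⬝ᵥ (cplx d *ᵥ cvec y)) := by
  have h1 : (frameM c d ε)⁻¹ * cplx d =
      (cplx b)ᵀ * cplx d - (cplx d)ᵀ * frameG a b c d ε * cplx d := by
    have := congrArg Matrix.transpose (h.frameM_invT_eq hε)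
    rw [Matrix.transpose_transpose, Matrix.transpose_sub, Matrix.transpose_mul,
      (h.frameG_symm hε).eq] at this
    rw [this, Matrix.sub_mul]
  rw [h1, h.frameM_invT_eq hε, quadPhase]
  have hG := h.frameG_symm hε
  generalize frameG a b c d ε = G at *
  simp only [Matrix.sub_mulVec, Matrix.mulVec_sub, dotProduct_sub, sub_dotProduct,
    ← Matrix.mulVec_mulVec]
  have e1 : cvec y ⬝ᵥ ((cplx b)ᵀ *ᵥ (cplx d *ᵥ cvec y)) =
      (cplx b *ᵥ cvec y) ⬝ᵥ (cplx d *ᵥ cvec y) := (mulVec_dotProduct_eq _ _ _).symm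
  have e2 : cvec y ⬝ᵥ ((cplx d)ᵀ *ᵥ (G *ᵥ (cplx d *ᵥ cvec y))) =
      (cplx d *ᵥ cvec y) ⬝ᵥ (G *ᵥ (cplx d *ᵥ cvec y)) := (mulVec_dotProduct_eq _ _ _).symm
  have e3 : (G *ᵥ (cplx d *ᵥ cvec y)) ⬝ᵥ cvec x = (cplx d *ᵥ cvec y) ⬝ᵥ (G *ᵥ cvec x) := by
    rw [mulVec_dotProduct_eq, hG.eq]
  have e4 : cvec x ⬝ᵥ (G *ᵥ (cplx d *ᵥ cvec y)) = (cplx d *ᵥ cvec y) ⬝ᵥ (G *ᵥ cvec x) := by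
    rw [dotProduct_mulVec_symm, hG.eq]
  rw [e1, e2, e3, e4]
  ring

/-- The imaginary part of the quadratic form of `Γ` on real vectors. -/
lemma im_frameG (u : Fin n → ℂ) (hu : star u = u) :
    (u ⬝ᵥ (frameG a b c d ε *ᵥ u)).im = ε * ∑ j, ‖((frameM c d ε)⁻¹ *ᵥ u) j‖ ^ 2 := by
  -- For real u = Mw the form uᵀΓu becomes -w*(M*L)w, and `frame_star` gives its imaginary part.
  obtain ⟨w, hw⟩ : ∃ w, w = (frameM c d ε)⁻¹ *ᵥ u := ⟨_, rfl⟩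
  rw [← hw]
  have hu' : frameM c d ε *ᵥ w = u := by
    rw [hw, Matrix.mulVec_mulVec, h.frameM_mul_inv hε, Matrix.one_mulVec]
  have h1 : u ⬝ᵥ (frameG a b c d ε *ᵥ u) =
      -(star w ⬝ᵥ (((frameM c d ε)ᴴ * frameL a b ε) *ᵥ w)) := by
    conv_lhs => rw [← hu', Matrix.mulVec_mulVec, h.frameG_mul_frameM hε, hu', ← hu, ← hu']
    rw [Matrix.neg_mulVec, dotProduct_neg, Matrix.star_mulVec, ← Matrix.dotProduct_mulVec,
      Matrix.mulVec_mulVec]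
  have h2 : star (star w ⬝ᵥ (((frameM c d ε)ᴴ * frameL a b ε) *ᵥ w)) =
      star w ⬝ᵥ (((frameL a b ε)ᴴ * frameM c d ε) *ᵥ w) := by
    rw [← Matrix.star_dotProduct_star, star_star, Matrix.star_mulVec,
      Matrix.conjTranspose_mul, Matrix.conjTranspose_conjTranspose, ← Matrix.dotProduct_mulVec]
  have h3 : star w ⬝ᵥ w = ((∑ j, ‖w j‖ ^ 2 : ℝ) : ℂ) := by
    rw [dotProduct]
    push_cast
    exact Finset.sum_congr rfl fun j _ => by
      rw [Pi.star_apply, Complex.star_def, Complex.conj_mul']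
  have h4 := congrArg (fun M => star w ⬝ᵥ (M *ᵥ w)) (h.frame_star ε)
  simp only [Matrix.sub_mulVec, dotProduct_sub, Matrix.smul_mulVec, Matrix.one_mulVec,
    dotProduct_smul, h3, ← h2] at h4
  have h5 := congrArg Complex.im h4
  rw [h1, Complex.neg_im]
  simp only [Complex.sub_im, Complex.star_def, Complex.conj_im, smul_eq_mul] at h5
  have h6 : (-2 * Complex.I * (ε : ℂ) * ((∑ j, ‖w j‖ ^ 2 : ℝ) : ℂ)).im =
      -2 * (ε * ∑ j, ‖w j‖ ^ 2) := by
    have : (-2 * Complex.I * (ε : ℂ) * ((∑ j, ‖w j‖ ^ 2 : ℝ) : ℂ)) =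
      ((-2 * (ε * ∑ j, ‖w j‖ ^ 2) : ℝ) : ℂ) * Complex.I := by push_cast; ring
    rw [this, Complex.im_ofReal_mul, Complex.I_im, mul_one]
  rw [h6] at h5
  linarith

lemma norm_packet {ħ : ℝ} (hħ : 0 < ħ) (r : ℂ) (y x : Conf n) :
    ‖packet ħ r a b c d ε y x‖ = ‖r‖⁻¹ * Real.exp (-(ε / (2 * ħ)) *
      ∑ j, ‖((frameM c d ε)⁻¹ *ᵥ (cvec x - cplx d *ᵥ cvec y)) j‖ ^ 2) := by
  have hreal : ∀ (M : Matrix (Fin n) (Fin n) ℝ) (y : Conf n),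
      cplx M *ᵥ cvec y = fun j => (((M *ᵥ y) j : ℝ) : ℂ) := by
    intro M y; funext j; simp [Matrix.mulVec, dotProduct, cvec]
  have hu : star (cvec x - cplx d *ᵥ cvec y) = cvec x - cplx d *ᵥ cvec y := by
    rw [hreal]; funext j; simp [cvec]
  rw [packet, gauss, mul_assoc, ← Complex.exp_add, ← mul_add, h.packet_phase hε, norm_mul,
    norm_inv, Complex.norm_exp]
  congr 2
  have h1 : ∀ z : ℂ, (Complex.I / (ħ : ℂ) * z).re = -z.im / ħ := by
    intro z
    have : Complex.I / (ħ : ℂ) * z = ((ħ⁻¹ : ℝ) : ℂ) * (Complex.I * z) := by push_cast; ring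
    rw [this, Complex.re_ofReal_mul, Complex.I_mul_re]
    ring
  have h2 : ((cplx b *ᵥ cvec y) ⬝ᵥ cvec x).im = 0 := by
    rw [hreal]; simp [dotProduct, cvec]
  have h3 : ((1 / 2 : ℂ) * ((cplx b *ᵥ cvec y) ⬝ᵥ (cplx d *ᵥ cvec y))).im = 0 := by
    rw [hreal, hreal]
    have : (1 / 2 : ℂ) = ((1 / 2 : ℝ) : ℂ) := by push_cast; rfl
    rw [this, Complex.im_ofReal_mul]
    simp [dotProduct]
  have h4 : ∀ z : ℂ, ((1 / 2 : ℂ) * z).im = z.im / 2 := by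
    intro z
    have : (1 / 2 : ℂ) = ((1 / 2 : ℝ) : ℂ) := by push_cast; rfl
    rw [this, Complex.im_ofReal_mul]; ring
  rw [h1, Complex.sub_im, Complex.add_im, h2, h3, h4, h.im_frameG hε _ hu]
  field_simp
  ring

/-- The bound does not involve x, y, nor ε when r is fixed. It supplies both the bounded kernels
needed for Fubini and the domination in the limit ε → 0⁺. -/
lemma norm_packet_le {ħ : ℝ} (hħ : 0 < ħ) (hε' : 0 < ε) (r : ℂ) (y x : Conf n) :
    ‖packet ħ r a b c d ε y x‖ ≤ ‖r‖⁻¹ := by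
  rw [h.norm_packet hε hħ]
  refine mul_le_of_le_one_right (by positivity) (Real.exp_le_one_iff.2 ?_)
  have : 0 ≤ ε / (2 * ħ) := by positivity
  have h2 : 0 ≤ ∑ j, ‖((frameM c d ε)⁻¹ *ᵥ (cvec x - cplx d *ᵥ cvec y)) j‖ ^ 2 := by positivity
  nlinarith

end

end IsSympl

/-- Cauchy–Schwarz for matrices, with the Frobenius norm. -/
lemma sum_norm_mulVec_sq_le (M : Matrix (Fin n) (Fin n) ℂ) (w : Fin n → ℂ) :
    ∑ i, ‖(M *ᵥ w) i‖ ^ 2 ≤ (∑ i, ∑ j, ‖M i j‖ ^ 2) * ∑ j, ‖w j‖ ^ 2 := by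
  rw [Finset.sum_mul]
  refine Finset.sum_le_sum fun i _ => ?_
  calc ‖(M *ᵥ w) i‖ ^ 2 ≤ (∑ j, ‖M i j‖ * ‖w j‖) ^ 2 := by
        gcongr
        rw [Matrix.mulVec, dotProduct]
        exact (norm_sum_le _ _).trans (le_of_eq (Finset.sum_congr rfl fun j _ => norm_mul _ _))
    _ ≤ _ := Finset.sum_mul_sq_le_sq_mul_sq _ _ _

/-- The real vector `M y` as a configuration. -/
def confMul (M : Matrix (Fin n) (Fin n) ℝ) (y : Conf n) : Conf n := WithLp.toLp 2 (M *ᵥ y)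

lemma cvec_sub_mulVec (d : Matrix (Fin n) (Fin n) ℝ) (x y : Conf n) :
    cvec x - cplx d *ᵥ cvec y = cvec (x - confMul d y) := by
  funext j
  simp [cvec, confMul, Matrix.mulVec, dotProduct]

lemma sum_norm_cvec_sq (x : Conf n) : ∑ j, ‖cvec x j‖ ^ 2 = ‖x‖ ^ 2 := by
  rw [EuclideanSpace.norm_sq_eq]
  simp [cvec]

/-- Gaussian decay of a packet away from its centre. -/
lemma IsSympl.norm_packet_le_exp {a b c d : Matrix (Fin n) (Fin n) ℝ} (h : IsSympl a b c d)
    {ε ħ : ℝ} (hħ : 0 < ħ) (hε : 0 < ε) {K : ℝ} (hK : 0 < K)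
    (hMK : ∑ i, ∑ j, ‖frameM c d ε i j‖ ^ 2 ≤ K) (r : ℂ) (y x : Conf n) :
    ‖packet ħ r a b c d ε y x‖ ≤
      ‖r‖⁻¹ * Real.exp (-(ε / (2 * ħ * K)) * ‖x - confMul d y‖ ^ 2) := by
  rw [h.norm_packet hε.ne' hħ, cvec_sub_mulVec]
  refine mul_le_mul_of_nonneg_left (Real.exp_le_exp.2 ?_) (by positivity)
  have h1 := sum_norm_mulVec_sq_le (frameM c d ε)
    ((frameM c d ε)⁻¹ *ᵥ cvec (x - confMul d y))
  rw [Matrix.mulVec_mulVec, h.frameM_mul_inv hε.ne', Matrix.one_mulVec, sum_norm_cvec_sq] at h1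
  have h2 : ‖x - confMul d y‖ ^ 2 ≤ K *
      ∑ j, ‖((frameM c d ε)⁻¹ *ᵥ cvec (x - confMul d y)) j‖ ^ 2 :=
    h1.trans (mul_le_mul_of_nonneg_right hMK (by positivity))
  have h3 : ε / (2 * ħ * K) * ‖x - confMul d y‖ ^ 2 ≤ ε / (2 * ħ * K) * (K *
      ∑ j, ‖((frameM c d ε)⁻¹ *ᵥ cvec (x - confMul d y)) j‖ ^ 2) := by gcongr
  have h4 : ε / (2 * ħ * K) * (K *
      ∑ j, ‖((frameM c d ε)⁻¹ *ᵥ cvec (x - confMul d y)) j‖ ^ 2) = ε / (2 * ħ) *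
      ∑ j, ‖((frameM c d ε)⁻¹ *ᵥ cvec (x - confMul d y)) j‖ ^ 2 := by
    field_simp
  linarith

end

section

variable {n : ℕ}

/-! ### Gaussians as Schwartz functions -/

lemma iteratedDeriv_cexp_neg_mul (a : ℝ) (m : ℕ) :
    iteratedDeriv m (fun s : ℝ => Complex.exp (-(a * s : ℝ))) =
      fun s : ℝ => (-(a : ℂ)) ^ m * Complex.exp (-(a * s : ℝ)) := by
  induction m with
  | zero => simp
  | succ m ih =>
    rw [iteratedDeriv_succ, ih]
    funext s
    have h : HasDerivAt (fun s : ℝ => Complex.exp (-(a * s : ℝ)))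
        (Complex.exp (-(a * s : ℝ)) * (-(a : ℂ))) s := by
      have := ((Complex.ofRealCLM.hasDerivAt (x := s)).const_mul (-(a : ℂ))).cexp
      simpa using this
    rw [(h.const_mul _).deriv]
    ring

lemma contDiff_cexp_neg_mul (a : ℝ) {N : WithTop ℕ∞} :
    ContDiff ℝ N (fun s : ℝ => Complex.exp (-(a * s : ℝ))) :=
  (Complex.ofRealCLM.contDiff.comp (contDiff_const.mul contDiff_id)).neg.cexp

lemma exists_one_add_pow_mul_exp_le {a : ℝ} (ha : 0 < a) (p : ℕ) :
    ∃ C : ℝ, ∀ r : ℝ, 0 ≤ r → (1 + r) ^ p * Real.exp (-(a * r ^ 2)) ≤ C := by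
  -- The constant combines (1 + r)^p ≤ p! e^{1+r} with r ≤ ar² + 1/(4a).
  refine ⟨p.factorial * Real.exp (1 + 1 / (4 * a)), fun r hr => ?_⟩
  have h1 : (1 + r) ^ p ≤ p.factorial * Real.exp (1 + r) := by
    have := Real.pow_div_factorial_le_exp (1 + r) (by linarith) p
    rw [div_le_iff₀ (by positivity)] at this
    linarith
  have h2 : r ≤ a * r ^ 2 + 1 / (4 * a) := by
    have : a * r ^ 2 + 1 / (4 * a) - r = (2 * a * r - 1) ^ 2 / (4 * a) := by field_simp; ring
    have h3 : 0 ≤ (2 * a * r - 1) ^ 2 / (4 * a) := by positivity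
    linarith
  calc (1 + r) ^ p * Real.exp (-(a * r ^ 2))
      ≤ p.factorial * Real.exp (1 + r) * Real.exp (-(a * r ^ 2)) := by gcongr
    _ = p.factorial * Real.exp (1 + r - a * r ^ 2) := by
      rw [mul_assoc, ← Real.exp_add]; rfl
    _ ≤ _ := by gcongr; linarith

/-- The Gaussian is e^{-as} composed with s = ‖x‖². The composition estimate bounds each derivative
by a polynomial times the Gaussian itself, and the Gaussian absorbs the polynomial. -/
lemma exists_schwartz_gaussian {a : ℝ} (ha : 0 < a) :
    ∃ g : 𝓢(Conf n, ℂ), ∀ x, g x = Complex.exp (-(a * ‖x‖ ^ 2 : ℝ)) := by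
  have hs : ContDiff ℝ ((⊤ : ℕ∞) : WithTop ℕ∞) (fun x : Conf n => ‖x‖ ^ 2) := contDiff_norm_sq ℝ
  refine ⟨⟨fun x => Complex.exp (-(a * ‖x‖ ^ 2 : ℝ)), (contDiff_cexp_neg_mul a).comp hs,
    fun k m => ?_⟩, fun x => rfl⟩
  obtain ⟨q, C₀, hC₀, hq⟩ := (Function.hasTemperateGrowth_norm_sq (H := Conf n)).norm_iteratedFDeriv_le_uniform m
  obtain ⟨B, hB⟩ := exists_one_add_pow_mul_exp_le ha (k + q * m)
  refine ⟨m.factorial * max 1 a ^ m * (1 + C₀) ^ m * B, fun x => ?_⟩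
  have key := norm_iteratedFDeriv_comp_le (𝕜 := ℝ) (n := m)
    (N := ((⊤ : ℕ∞) : WithTop ℕ∞)) (contDiff_cexp_neg_mul a) hs (by exact_mod_cast le_top) x
    (C := max 1 a ^ m * Real.exp (-(a * ‖x‖ ^ 2))) (D := (1 + C₀) * (1 + ‖x‖) ^ q)
    (fun i hi => ?_) (fun i h1 hi => ?_)
  · calc ‖x‖ ^ k * ‖iteratedFDeriv ℝ m (fun x : Conf n => Complex.exp (-(a * ‖x‖ ^ 2 : ℝ))) x‖
        ≤ (1 + ‖x‖) ^ k * (m.factorial * (max 1 a ^ m * Real.exp (-(a * ‖x‖ ^ 2))) *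
          ((1 + C₀) * (1 + ‖x‖) ^ q) ^ m) := by
          gcongr
          · linarith
          · exact key
      _ = m.factorial * max 1 a ^ m * (1 + C₀) ^ m *
          ((1 + ‖x‖) ^ (k + q * m) * Real.exp (-(a * ‖x‖ ^ 2))) := by
          rw [mul_pow, ← pow_mul, pow_add]; ring
      _ ≤ _ := by gcongr; exact hB _ (norm_nonneg _)
  · rw [norm_iteratedFDeriv_eq_norm_iteratedDeriv, iteratedDeriv_cexp_neg_mul, norm_mul, norm_pow,
      norm_neg, Complex.norm_real, Real.norm_of_nonneg ha.le, ← Complex.ofReal_neg,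
      Complex.norm_exp_ofReal]
    gcongr
    calc a ^ i ≤ max 1 a ^ i := by gcongr; exact le_max_right _ _
      _ ≤ _ := pow_le_pow_right₀ (le_max_left _ _) hi
  · refine (hq i hi x).trans ?_
    rw [mul_pow]
    have e1 : (1 + ‖x‖) ^ q ≤ ((1 + ‖x‖) ^ q) ^ i :=
      le_self_pow₀ (one_le_pow₀ (by linarith [norm_nonneg x])) (by omega)
    have e2 : C₀ ≤ (1 + C₀) ^ i := (by linarith : C₀ ≤ 1 + C₀).trans
      (le_self_pow₀ (by linarith) (by omega))
    gcongr

/-- The normalized Gaussian of width `√(ħε)`, for `ħ, ε > 0`. -/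
def heat (ħ ε : ℝ) : 𝓢(Conf n, ℂ) := Classical.epsilon fun g => ∀ x,
  g x = (Real.sqrt ((2 * Real.pi * ħ * ε) ^ n) : ℂ)⁻¹ *
    Complex.exp (-(1 / (2 * ħ * ε) * ‖x‖ ^ 2 : ℝ))

lemma heat_apply {ħ ε : ℝ} (hħ : 0 < ħ) (hε : 0 < ε) (x : Conf n) :
    heat ħ ε x = (Real.sqrt ((2 * Real.pi * ħ * ε) ^ n) : ℂ)⁻¹ *
      Complex.exp (-(1 / (2 * ħ * ε) * ‖x‖ ^ 2 : ℝ)) := by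
  refine Classical.epsilon_spec (p := fun g : 𝓢(Conf n, ℂ) => ∀ x,
    g x = (Real.sqrt ((2 * Real.pi * ħ * ε) ^ n) : ℂ)⁻¹ *
    Complex.exp (-(1 / (2 * ħ * ε) * ‖x‖ ^ 2 : ℝ))) ?_ x
  obtain ⟨g, hg⟩ := exists_schwartz_gaussian (n := n) (a := 1 / (2 * ħ * ε)) (by positivity)
  exact ⟨(Real.sqrt ((2 * Real.pi * ħ * ε) ^ n) : ℂ)⁻¹ • g, fun x => by
    rw [_root_.smul_apply, hg, smul_eq_mul]⟩

/-- The normalized Gaussian of width `√(ħε)` centred at `y`. -/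
def heatAt (ħ ε : ℝ) (y : Conf n) : 𝓢(Conf n, ℂ) := SchwartzMap.compSubConstCLM ℂ y (heat ħ ε)

lemma heatAt_apply {ħ ε : ℝ} (hħ : 0 < ħ) (hε : 0 < ε) (y x : Conf n) :
    heatAt ħ ε y x = (Real.sqrt ((2 * Real.pi * ħ * ε) ^ n) : ℂ)⁻¹ *
      Complex.exp (-(1 / (2 * ħ * ε) * ‖x - y‖ ^ 2 : ℝ)) := heat_apply hħ hε (x - y)

lemma isSympl_one : IsSympl (1 : Matrix (Fin n) (Fin n) ℝ) 0 0 1 := ⟨by simp, by simp, by simp⟩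

lemma frameM_one (ε : ℝ) : frameM (0 : Matrix (Fin n) (Fin n) ℝ) 1 ε = (Complex.I * ε) • 1 := by
  rw [frameM, cplx_one]
  ext i j
  simp

lemma frameM_one_inv {ε : ℝ} (hε : ε ≠ 0) :
    (frameM (0 : Matrix (Fin n) (Fin n) ℝ) 1 ε)⁻¹ = (Complex.I * ε)⁻¹ • 1 := by
  have hc : Complex.I * (ε : ℂ) ≠ 0 := by simp [hε]
  rw [frameM_one]
  apply Matrix.inv_eq_left_inv
  rw [Matrix.smul_mul, Matrix.mul_smul, smul_smul, inv_mul_cancel₀ hc, one_smul, Matrix.one_mul]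

lemma frameG_one {ε : ℝ} (hε : ε ≠ 0) :
    frameG (1 : Matrix (Fin n) (Fin n) ℝ) 0 0 1 ε = (Complex.I / ε) • 1 := by
  have hε' : (ε : ℂ) ≠ 0 := by exact_mod_cast hε
  have hl : frameL (1 : Matrix (Fin n) (Fin n) ℝ) 0 ε = 1 := by
    rw [frameL, cplx_one]; ext i j; simp
  rw [frameG, hl, Matrix.one_mul, frameM_one_inv hε, ← neg_smul]
  congr 1
  field_simp
  rw [Complex.I_sq]

lemma sum_cvec_mul (x y : Conf n) : cvec x ⬝ᵥ cvec y = ((inner ℝ x y : ℝ) : ℂ) := by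
  simp [dotProduct, cvec, PiLp.inner_apply, mul_comm]

lemma packet_one_eq_heatAt {ħ ε : ℝ} (hħ : 0 < ħ) (hε : 0 < ε) (y x : Conf n) :
    packet ħ (Real.sqrt ((2 * Real.pi * ħ * ε) ^ n) : ℂ) 1 0 0 1 ε y x = heatAt ħ ε y x := by
  have hħ' : (ħ : ℂ) ≠ 0 := by exact_mod_cast hħ.ne'
  have hε' : (ε : ℂ) ≠ 0 := by exact_mod_cast hε.ne'
  rw [heatAt_apply hħ hε, packet, gauss, mul_assoc, ← Complex.exp_add, frameG_one hε.ne',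
    frameM_one_inv hε.ne', cplx_one]
  congr 2
  simp only [quadPhase, Matrix.smul_mulVec, Matrix.one_mulVec, dotProduct_smul, smul_dotProduct,
    Matrix.transpose_smul, Matrix.transpose_one, Matrix.mul_one, sum_cvec_mul, smul_eq_mul]
  rw [real_inner_self_eq_norm_sq, real_inner_self_eq_norm_sq, norm_sub_sq_real, real_inner_comm]
  push_cast
  field_simp
  rw [Complex.I_sq]
  ring

/-- This is the annihilation equation (x - y + iεp)g = 0 of a coherent state. Because it is linear
in ẑ, an intertwining operator transports it to an equation of the same kind. -/
lemma zS_heatAt {ħ ε : ℝ} (hħ : 0 < ħ) (hε : 0 < ε) (y : Conf n) (j : Fin n) :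
    zS ħ (Sum.inr j) (heatAt ħ ε y) =
      (-(Complex.I * ε)) • zS ħ (Sum.inl j) (heatAt ħ ε y) + (y j : ℂ) • heatAt ħ ε y := by
  have hħ' : (ħ : ℂ) ≠ 0 := by exact_mod_cast hħ.ne'
  have hε' : (ε : ℂ) ≠ 0 := by exact_mod_cast hε.ne'
  ext x
  have hf : ⇑(heatAt ħ ε y) = fun x =>
      (Real.sqrt ((2 * Real.pi * ħ * ε) ^ n) : ℂ)⁻¹ * Complex.exp (Complex.I / ħ *
        (-(1 / 2) * (cvec y ⬝ᵥ (((frameM 0 1 ε)⁻¹ * cplx 1) *ᵥ cvec y)))) *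
        gauss ħ (frameG 1 0 0 1 ε) ((frameM 0 1 ε)⁻¹ᵀ *ᵥ cvec y) x :=
    funext fun x => (packet_one_eq_heatAt hħ hε y x).symm
  have hd := (hasFDerivAt_gauss ħ (isSympl_one.frameG_symm hε.ne')
    ((frameM 0 1 ε)⁻¹ᵀ *ᵥ cvec y) x).const_mul ((Real.sqrt ((2 * Real.pi * ħ * ε) ^ n) : ℂ)⁻¹ *
      Complex.exp (Complex.I / ħ *
        (-(1 / 2) * (cvec y ⬝ᵥ (((frameM 0 1 ε)⁻¹ * cplx 1) *ᵥ cvec y)))))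
  rw [← hf] at hd
  rw [_root_.add_apply, _root_.smul_apply, _root_.smul_apply, zS_inr_apply, zS_inl_apply, hd.fderiv,
    _root_.smul_apply, _root_.smul_apply, sum_coordCLM_single, congrFun hf x]
  generalize gauss ħ (frameG 1 0 0 1 ε) ((frameM 0 1 ε)⁻¹ᵀ *ᵥ cvec y) x = G
  generalize (Real.sqrt ((2 * Real.pi * ħ * ε) ^ n) : ℂ)⁻¹ * Complex.exp _ = c
  rw [frameG_one hε.ne', frameM_one_inv hε.ne']
  simp only [Matrix.smul_mulVec, Matrix.one_mulVec, Matrix.transpose_smul, Matrix.transpose_one,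
    Pi.add_apply, Pi.smul_apply, smul_eq_mul, cvec]
  field_simp
  ring_nf
  simp only [Complex.I_sq, show Complex.I ^ 4 = 1 from Complex.I_pow_four]
  ring

/-! ### Images of Gaussians under intertwining operators -/

/-- The logarithmic gradient is that of the Gaussian, so the product with the reciprocal Gaussian
has zero derivative. -/
lemma eq_const_mul_gauss {ħ : ℝ} {Γ : Matrix (Fin n) (Fin n) ℂ} (hħ : 0 < ħ) (hΓ : Γ.IsSymm)
    (q : Fin n → ℂ) (τ : 𝓢(Conf n, ℂ))
    (h : ∀ j x, zS ħ (Sum.inl j) τ x = (Γ *ᵥ cvec x + q) j * τ x) :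
    ∃ C : ℂ, ∀ x, τ x = C * gauss ħ Γ q x := by
  have hħ' : (ħ : ℂ) ≠ 0 := by exact_mod_cast hħ.ne'
  have hτ : ∀ x, HasFDerivAt τ ((Complex.I / ħ * τ x) • ∑ j, (Γ *ᵥ cvec x + q) j • coordCLM j) x := by
    intro x
    refine (τ.hasFDerivAt x).congr_fderiv ?_
    have hl : (fderiv ℝ τ x : Conf n →ₗ[ℝ] ℂ) =
        (((Complex.I / ħ * τ x) • ∑ j, (Γ *ᵥ cvec x + q) j • coordCLM j : Conf n →L[ℝ] ℂ) :
          Conf n →ₗ[ℝ] ℂ) := by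
      refine (EuclideanSpace.basisFun (Fin n) ℝ).toBasis.ext fun j => ?_
      have := h j x
      rw [zS_inl_apply] at this
      simp only [OrthonormalBasis.coe_toBasis, EuclideanSpace.basisFun_apply,
        ContinuousLinearMap.coe_coe, _root_.smul_apply, sum_coordCLM_single, smul_eq_mul]
      field_simp
      linear_combination (Complex.I) * this + (ħ : ℂ) *
        fderiv ℝ τ x (EuclideanSpace.single j 1) * Complex.I_sq
    exact ContinuousLinearMap.coe_injective hl
  have hΓ' : (-Γ).IsSymm := by rw [Matrix.IsSymm, Matrix.transpose_neg, hΓ.eq]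
  have hinv : ∀ x, gauss ħ (-Γ) (-q) x * gauss ħ Γ q x = 1 := by
    intro x
    rw [gauss, gauss, ← Complex.exp_add, ← mul_add, quadPhase, quadPhase, Matrix.neg_mulVec,
      dotProduct_neg, neg_dotProduct, ← Complex.exp_zero]
    congr 1
    ring
  have hconst : ∀ x y, τ x * gauss ħ (-Γ) (-q) x = τ y * gauss ħ (-Γ) (-q) y := by
    have hd : ∀ x, HasFDerivAt (fun x => τ x * gauss ħ (-Γ) (-q) x) (0 : Conf n →L[ℝ] ℂ) x := by
      intro x
      refine ((hτ x).fun_mul (hasFDerivAt_gauss ħ hΓ' (-q) x)).congr_fderiv ?_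
      ext v
      simp only [_root_.add_apply, _root_.smul_apply, _root_.sum_apply, smul_eq_mul,
        Matrix.neg_mulVec, ← neg_add, Pi.neg_apply, neg_mul, Finset.sum_neg_distrib,
        _root_.zero_apply]
      ring
    exact is_const_of_fderiv_eq_zero (𝕜 := ℝ) (fun x => (hd x).differentiableAt)
      (fun x => (hd x).fderiv)
  refine ⟨τ 0 * gauss ħ (-Γ) (-q) 0, fun x => ?_⟩
  rw [← hconst x 0, mul_assoc, hinv, mul_one]

/-- An intertwining operator takes Gaussians to multiples of packets. -/
lemma IsIntertwiner.heatAt {ħ : ℝ} (hħ : 0 < ħ) {a b c d : Matrix (Fin n) (Fin n) ℝ}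
    (h : IsSympl a b c d) {T : 𝓢(Conf n, ℂ) →L[ℂ] 𝓢(Conf n, ℂ)}
    (hT : IsIntertwiner ħ T (Matrix.fromBlocks a b c d)) {ε : ℝ} (hε : 0 < ε) {r : ℂ} (hr : r ≠ 0)
    (y : Conf n) : ∃ C : ℂ, ∀ x, T (heatAt ħ ε y) x = C * packet ħ r a b c d ε y x := by
  obtain ⟨α, hα⟩ : ∃ α : Fin n → 𝓢(Conf n, ℂ),
    α = fun l => T (zS ħ (Sum.inl l) (NonlocalGP.heatAt ħ ε y)) := ⟨_, rfl⟩
  -- Positions are eliminated by the annihilation equation, so the image is described by the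
  -- momentum terms `α` and by itself alone.
  have hmap : ∀ k x, zS ħ k (T (NonlocalGP.heatAt ħ ε y)) x =
      ∑ l, (((fromBlocks a b c d k (Sum.inl l) : ℝ) : ℂ) -
        Complex.I * ε * ((fromBlocks a b c d k (Sum.inr l) : ℝ) : ℂ)) * α l x +
      (∑ l, ((fromBlocks a b c d k (Sum.inr l) : ℝ) : ℂ) * y l) * T (NonlocalGP.heatAt ħ ε y) x := by
    intro k x
    have h1 : ∑ l, ((fromBlocks a b c d k l : ℝ) : ℂ) • zS ħ l (NonlocalGP.heatAt ħ ε y) =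
        ∑ l, (((fromBlocks a b c d k (Sum.inl l) : ℝ) : ℂ) -
          Complex.I * ε * ((fromBlocks a b c d k (Sum.inr l) : ℝ) : ℂ)) •
            zS ħ (Sum.inl l) (NonlocalGP.heatAt ħ ε y) +
        (∑ l, ((fromBlocks a b c d k (Sum.inr l) : ℝ) : ℂ) * y l) • NonlocalGP.heatAt ħ ε y := by
      rw [Fintype.sum_sum_type, Finset.sum_smul, ← Finset.sum_add_distrib,
        ← Finset.sum_add_distrib]
      refine Finset.sum_congr rfl fun l _ => ?_
      rw [zS_heatAt hħ hε y l]
      module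
    have h2 := hT.zS_map k (NonlocalGP.heatAt ħ ε y)
    rw [h2, h1, map_add, map_smul, map_sum, _root_.add_apply, _root_.smul_apply, smul_eq_mul]
    congr 1
    rw [← sum_smul_apply]
    congr 1
    refine Finset.sum_congr rfl fun l _ => ?_
    rw [map_smul, hα]
  obtain ⟨τ, hτ⟩ : ∃ τ, τ = T (NonlocalGP.heatAt ħ ε y) := ⟨_, rfl⟩
  rw [← hτ] at hmap ⊢
  -- The position rows form a linear system for `α` with the invertible matrix M. Substituting its
  -- solution into the momentum rows shows that the momenta act as Γx + M⁻ᵀy.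
  have hx : ∀ x, frameM c d ε *ᵥ (fun l => α l x) = τ x • (cplx d *ᵥ cvec y - cvec x) := by
    intro x
    funext j
    have := hmap (Sum.inr j) x
    rw [zS_inr_apply] at this
    simp only [fromBlocks_apply₂₁, fromBlocks_apply₂₂] at this
    simp only [Matrix.mulVec, dotProduct, frameM, Matrix.add_apply, Matrix.neg_apply,
      Matrix.smul_apply, Matrix.map_apply, smul_eq_mul, Pi.smul_apply, Pi.sub_apply, cvec]
    have e : ∑ l, (-(c j l : ℂ) + Complex.I * ε * (d j l : ℂ)) * α l x =
        -∑ l, ((c j l : ℂ) - Complex.I * ε * (d j l : ℂ)) * α l x := by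
      rw [← Finset.sum_neg_distrib]
      exact Finset.sum_congr rfl fun l _ => by ring
    rw [e]
    linear_combination this
  have hpot : ∀ j x, zS ħ (Sum.inl j) τ x =
      (frameG a b c d ε *ᵥ cvec x + (frameM c d ε)⁻¹ᵀ *ᵥ cvec y) j * τ x := by
    intro j x
    have h1 : zS ħ (Sum.inl j) τ x =
        (frameL a b ε *ᵥ (fun l => α l x)) j + (cplx b *ᵥ cvec y) j * τ x := by
      rw [hmap]
      simp only [fromBlocks_apply₁₁, fromBlocks_apply₁₂, Matrix.mulVec, dotProduct, frameL,
        Matrix.sub_apply, Matrix.smul_apply, Matrix.map_apply, smul_eq_mul, cvec]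
    have h2 : (fun l => α l x) = (frameM c d ε)⁻¹ *ᵥ (τ x • (cplx d *ᵥ cvec y - cvec x)) := by
      rw [← hx, Matrix.mulVec_mulVec, h.frameM_inv_mul hε.ne', Matrix.one_mulVec]
    have h3 : frameL a b ε *ᵥ (fun l => α l x) =
        τ x • (frameG a b c d ε *ᵥ cvec x - (frameG a b c d ε * cplx d) *ᵥ cvec y) := by
      rw [h2, Matrix.mulVec_mulVec, Matrix.mulVec_smul, ← Matrix.mulVec_mulVec (cvec y),
        ← Matrix.mulVec_sub]
      rw [frameG, Matrix.neg_mulVec, ← Matrix.mulVec_neg, neg_sub]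
    rw [h1, h3, h.frameM_invT_eq hε.ne', Matrix.sub_mulVec]
    simp only [Pi.smul_apply, Pi.sub_apply, Pi.add_apply, smul_eq_mul]
    ring
  obtain ⟨C, hC⟩ := eq_const_mul_gauss hħ (h.frameG_symm hε.ne')
    ((frameM c d ε)⁻¹ᵀ *ᵥ cvec y) τ hpot
  refine ⟨C * r * (Complex.exp (Complex.I / ħ *
      (-(1 / 2) * (cvec y ⬝ᵥ (((frameM c d ε)⁻¹ * cplx d) *ᵥ cvec y)))))⁻¹, fun x => ?_⟩
  rw [hC, packet]
  have := Complex.exp_ne_zero (Complex.I / ħ *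
      (-(1 / 2) * (cvec y ⬝ᵥ (((frameM c d ε)⁻¹ * cplx d) *ᵥ cvec y))))
  generalize Complex.exp (Complex.I / ħ * _) = w at *
  field_simp

end

section

variable {n : ℕ}

/-! ### Quadratic Hamiltonians on Schwartz functions -/

lemma star_zS_inr (ħ : ℝ) (j : Fin n) (f g : 𝓢(Conf n, ℂ)) :
    ip (zS ħ (Sum.inr j) f) g = ip f (zS ħ (Sum.inr j) g) := by
  rw [ip, ip]
  congr 1; funext x
  rw [zS_inr_apply, zS_inr_apply, star_mul', Complex.star_def, Complex.conj_ofReal]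
  ring

open LineDeriv in
/-- The operators `ẑ` are symmetric. -/
lemma ip_zS (ħ : ℝ) (k : PhaseIdx n) (f g : 𝓢(Conf n, ℂ)) :
    ip (zS ħ k f) g = ip f (zS ħ k g) := by
  cases k with
  | inr j => exact star_zS_inr ħ j f g
  | inl j =>
    obtain ⟨fc, hfc⟩ : ∃ fc : 𝓢(Conf n, ℂ), ∀ x, fc x = star (f x) :=
      ⟨SchwartzMap.postcompCLM (𝕜 := ℝ) Complex.conjCLE.toContinuousLinearMap f, fun x => rfl⟩
    -- The sign from integration by parts is compensated by the conjugation of -iħ.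
    have h := SchwartzMap.integral_mul_lineDerivOp_right_eq_neg_left (μ := volume) fc g
      (EuclideanSpace.single j (1 : ℝ))
    have hd : ∀ x, ∂_{EuclideanSpace.single j (1 : ℝ)} fc x =
        star (∂_{EuclideanSpace.single j (1 : ℝ)} f x) := by
      intro x
      rw [SchwartzMap.lineDerivOp_apply_eq_fderiv, SchwartzMap.lineDerivOp_apply_eq_fderiv]
      have h1 : HasFDerivAt fc
          ((Complex.conjCLE : ℂ →L[ℝ] ℂ).comp (fderiv ℝ f x)) x := by
        have := (Complex.conjCLE : ℂ →L[ℝ] ℂ).hasFDerivAt.comp x (f.hasFDerivAt x)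
        rwa [show (⇑(Complex.conjCLE : ℂ →L[ℝ] ℂ) ∘ ⇑f) = ⇑fc from
          funext fun y => (hfc y).symm] at this
      rw [h1.fderiv]
      rfl
    have h2 : ∀ u : 𝓢(Conf n, ℂ), zS ħ (Sum.inl j) u =
      (-Complex.I * ħ) • ∂_{EuclideanSpace.single j (1 : ℝ)} u := fun u => rfl
    have h3 : star (-Complex.I * (ħ : ℂ)) = Complex.I * ħ := by simp
    rw [h2, h2, ip_smul_left, ip_smul_right, h3, ip, ip]
    simp only [hfc, hd] at h
    rw [h]
    ring

/-- The quadratic Hamiltonian `½⟨ẑ, h ẑ⟩`. -/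
def hamS (ħ : ℝ) (h : Matrix (PhaseIdx n) (PhaseIdx n) ℝ) (f : 𝓢(Conf n, ℂ)) : 𝓢(Conf n, ℂ) :=
  (1 / 2 : ℂ) • ∑ k, ∑ l, (h k l : ℂ) • zS ħ k (zS ħ l f)

lemma ip_sum_left {ι : Type*} (s : Finset ι) (f : ι → 𝓢(Conf n, ℂ)) (g : 𝓢(Conf n, ℂ)) :
    ip (∑ i ∈ s, f i) g = ∑ i ∈ s, ip (f i) g := by
  rw [← star_ip, ip_sum_right, star_sum]
  simp only [star_ip]

lemma ip_hamS (ħ : ℝ) {h : Matrix (PhaseIdx n) (PhaseIdx n) ℝ} (hh : h.IsSymm)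
    (f g : 𝓢(Conf n, ℂ)) : ip (hamS ħ h f) g = ip f (hamS ħ h g) := by
  rw [hamS, hamS, ip_smul_left, ip_smul_right]
  simp only [ip_sum_left, ip_sum_right, ip_smul_left, ip_smul_right, ip_zS, Complex.star_def,
    Complex.conj_ofReal]
  rw [Finset.sum_comm]
  have : (starRingEnd ℂ) (1 / 2 : ℂ) = 1 / 2 := by
    rw [show (1 / 2 : ℂ) = ((1 / 2 : ℝ) : ℂ) by push_cast; rfl, Complex.conj_ofReal]
  rw [this]
  congr 1
  exact Finset.sum_congr rfl fun k _ => Finset.sum_congr rfl fun l _ => by rw [hh.apply k l]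

/-- Canonical commutation relations. -/
lemma zS_inl_inr (ħ : ℝ) (j k : Fin n) (f : 𝓢(Conf n, ℂ)) (x : Conf n) :
    zS ħ (Sum.inl j) (zS ħ (Sum.inr k) f) x =
      x k * zS ħ (Sum.inl j) f x + (if k = j then -Complex.I * ħ else 0) * f x := by
  have h1 : ⇑(zS ħ (Sum.inr k) f) = fun x => coordCLM k x * f x :=
    funext fun x => zS_inr_apply ħ k f x
  have h2 := ((coordCLM k).hasFDerivAt (x := x)).fun_mul (f.hasFDerivAt x)
  rw [← h1] at h2
  rw [zS_inl_apply, h2.fderiv, zS_inl_apply]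
  simp only [_root_.add_apply, _root_.smul_apply, smul_eq_mul, coordCLM_apply,
    PiLp.single_apply]
  split_ifs with h
  · push_cast; ring
  · push_cast; ring

/-! ### Quadratic Hamiltonians acting on Gaussians -/

section Potential

variable {ħ : ℝ} {Γ : Matrix (Fin n) (Fin n) ℂ} {q : Fin n → ℂ} {τ : 𝓢(Conf n, ℂ)}

/-- The inner momentum is replaced by multiplication by Γx + q; moving the outer one past the
coordinates produces the commutator term -iħΓ. -/
lemma zS_inl_inl_of_potential
    (h : ∀ j x, zS ħ (Sum.inl j) τ x = (Γ *ᵥ cvec x + q) j * τ x) (j k : Fin n) (x : Conf n) :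
    zS ħ (Sum.inl j) (zS ħ (Sum.inl k) τ) x =
      ((Γ *ᵥ cvec x + q) j * (Γ *ᵥ cvec x + q) k - Complex.I * ħ * Γ k j) * τ x := by
  have h1 : zS ħ (Sum.inl k) τ = ∑ i, Γ k i • zS ħ (Sum.inr i) τ + q k • τ := by
    ext x
    rw [h, _root_.add_apply, sum_smul_apply, _root_.smul_apply, Pi.add_apply, Matrix.mulVec,
      dotProduct, add_mul, Finset.sum_mul]
    simp only [zS_inr_apply, smul_eq_mul, mul_assoc, cvec]
  rw [h1, map_add, map_sum, map_smul, _root_.add_apply, _root_.smul_apply]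
  simp only [map_smul]
  rw [sum_smul_apply]
  simp only [zS_inl_inr, h, smul_eq_mul, mul_add, Finset.sum_add_distrib]
  have e1 : ∑ i, Γ k i * ((if i = j then -Complex.I * ħ else 0) * τ x) =
      Γ k j * (-Complex.I * ħ * τ x) := by
    simp [ite_mul, mul_ite]
  have e2 : ∑ i, Γ k i * ((x i : ℂ) * ((Γ *ᵥ cvec x + q) j * τ x)) =
      (Γ *ᵥ cvec x) k * ((Γ *ᵥ cvec x + q) j * τ x) := by
    rw [Matrix.mulVec, dotProduct, Finset.sum_mul]
    exact Finset.sum_congr rfl fun i _ => by rw [cvec]; ring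
  rw [e1, e2]
  simp only [Pi.add_apply]
  ring

/-- The action of a quadratic Hamiltonian on a Gaussian. -/
lemma hamS_of_potential {h : Matrix (PhaseIdx n) (PhaseIdx n) ℝ} (hh : h.IsSymm)
    (hτ : ∀ j x, zS ħ (Sum.inl j) τ x = (Γ *ᵥ cvec x + q) j * τ x) (x : Conf n) :
    hamS ħ h τ x =
      ((1 / 2) * ((Γ *ᵥ cvec x + q) ⬝ᵥ (cplx h.toBlocks₁₁ *ᵥ (Γ *ᵥ cvec x + q))) +
        (Γ *ᵥ cvec x + q) ⬝ᵥ (cplx h.toBlocks₁₂ *ᵥ cvec x) +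
        (1 / 2) * (cvec x ⬝ᵥ (cplx h.toBlocks₂₂ *ᵥ cvec x)) -
        Complex.I * ħ / 2 * (cplx h.toBlocks₁₁ * Γ + cplx h.toBlocks₁₂).trace) * τ x := by
  have h0 : hamS ħ h τ x = (1 / 2) * ∑ k, ∑ l, (h k l : ℂ) * zS ħ k (zS ħ l τ) x := by
    rw [hamS, _root_.smul_apply, smul_eq_mul]
    congr 1
    rw [show (∑ k, ∑ l, (h k l : ℂ) • zS ħ k (zS ħ l τ)) =
      ∑ k, (1 : ℂ) • ∑ l, (h k l : ℂ) • zS ħ k (zS ħ l τ) by simp only [one_smul], sum_smul_apply]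
    simp only [sum_smul_apply, one_mul]
  obtain ⟨u, hu⟩ : ∃ u, u = Γ *ᵥ cvec x + q := ⟨_, rfl⟩
  rw [h0]
  simp only [Fintype.sum_sum_type, zS_inl_inl_of_potential hτ, zS_inl_inr, hτ, zS_inr_apply,
    ← hu]
  have e1 : ∑ j, ∑ k, (h (Sum.inl j) (Sum.inl k) : ℂ) *
      ((u j * u k - Complex.I * ħ * Γ k j) * τ x) =
      (u ⬝ᵥ (cplx h.toBlocks₁₁ *ᵥ u) - Complex.I * ħ * (cplx h.toBlocks₁₁ * Γ).trace) * τ x := by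
    simp only [dotProduct, Matrix.mulVec, Matrix.trace, Matrix.diag, Matrix.mul_apply, sub_mul,
      Finset.mul_sum, Finset.sum_mul, ← Finset.sum_sub_distrib, Matrix.map_apply,
      Matrix.toBlocks₁₁, Matrix.of_apply]
    exact Finset.sum_congr rfl fun j _ => Finset.sum_congr rfl fun k _ => by ring
  -- Only here does momentum act after position, so only this mixed block yields a commutator; the
  -- transposed block in `e3` yields none. Together they give half the trace of the commutator, as
  -- Weyl ordering requires.
  have e2 : ∑ j, ∑ k, (h (Sum.inl j) (Sum.inr k) : ℂ) *
      (x k * (u j * τ x) + (if k = j then -Complex.I * ħ else 0) * τ x) =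
      (u ⬝ᵥ (cplx h.toBlocks₁₂ *ᵥ cvec x) - Complex.I * ħ * (cplx h.toBlocks₁₂).trace) * τ x := by
    simp only [mul_add, Finset.sum_add_distrib, sub_eq_add_neg]
    rw [add_mul]
    congr 1
    · simp only [dotProduct, Matrix.mulVec, Finset.mul_sum, Finset.sum_mul, Matrix.map_apply,
        Matrix.toBlocks₁₂, Matrix.of_apply, cvec]
      exact Finset.sum_congr rfl fun j _ => Finset.sum_congr rfl fun k _ => by ring
    · simp only [ite_mul, zero_mul, mul_ite, mul_zero, Finset.sum_ite_eq', Finset.mem_univ, if_true,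
        Matrix.trace, Matrix.diag, Matrix.map_apply, Matrix.toBlocks₁₂, Matrix.of_apply,
        Finset.mul_sum, Finset.sum_mul, ← Finset.sum_neg_distrib]
      exact Finset.sum_congr rfl fun j _ => by ring
  have e3 : ∑ j, ∑ k, (h (Sum.inr j) (Sum.inl k) : ℂ) * (x j * (u k * τ x)) =
      (u ⬝ᵥ (cplx h.toBlocks₁₂ *ᵥ cvec x)) * τ x := by
    rw [Finset.sum_comm]
    simp only [dotProduct, Matrix.mulVec, Finset.mul_sum, Finset.sum_mul, Matrix.map_apply,
        Matrix.toBlocks₁₂, Matrix.of_apply, cvec]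
    exact Finset.sum_congr rfl fun j _ => Finset.sum_congr rfl fun k _ => by
      rw [hh.apply (Sum.inl j) (Sum.inr k)]; ring
  have e4 : ∑ j, ∑ k, (h (Sum.inr j) (Sum.inr k) : ℂ) * (x j * (x k * τ x)) =
      (cvec x ⬝ᵥ (cplx h.toBlocks₂₂ *ᵥ cvec x)) * τ x := by
    simp only [dotProduct, Matrix.mulVec, Finset.mul_sum, Finset.sum_mul, Matrix.map_apply,
        Matrix.toBlocks₂₂, Matrix.of_apply, cvec]
    exact Finset.sum_congr rfl fun j _ => Finset.sum_congr rfl fun k _ => by ring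
  simp only [Finset.sum_add_distrib] at e2 ⊢
  rw [e1, e2, e3, e4, Matrix.trace_add]
  ring

end Potential

/-- Packets are Schwartz functions. -/
lemma IsSympl.exists_schwartz_packet {ħ : ℝ} (hħ : 0 < ħ) {a b c d : Matrix (Fin n) (Fin n) ℝ}
    (h : IsSympl a b c d) {ε : ℝ} (hε : 0 < ε) {r : ℂ} (hr : r ≠ 0) (y : Conf n) :
    ∃ τ : 𝓢(Conf n, ℂ), ∀ x, τ x = packet ħ r a b c d ε y x := by
  obtain ⟨T, hT⟩ := exists_isIntertwiner hħ h
  obtain ⟨C, hC⟩ := hT.heatAt hħ h hε hr y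
  -- An intertwining operator is injective, so the image of a Gaussian is not zero.
  have hC0 : C ≠ 0 := by
    rintro rfl
    have h0 : T (heatAt ħ ε y) = 0 := by ext x; rw [hC, zero_mul]; rfl
    have h1 := congrArg (fun f : 𝓢(Conf n, ℂ) => f y) (hT.injective h0)
    beta_reduce at h1
    have h2 : (Real.sqrt ((2 * Real.pi * ħ * ε) ^ n) : ℂ) ≠ 0 := by
      have : Real.sqrt ((2 * Real.pi * ħ * ε) ^ n) ≠ 0 := by positivity
      exact_mod_cast this
    rw [heatAt_apply hħ hε] at h1
    exact mul_ne_zero (inv_ne_zero h2) (Complex.exp_ne_zero _) h1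
  refine ⟨C⁻¹ • T (heatAt ħ ε y), fun x => ?_⟩
  rw [_root_.smul_apply, hC, smul_eq_mul, inv_mul_cancel_left₀ hC0]

lemma IsSympl.zS_packet {ħ : ℝ} (hħ : 0 < ħ) {a b c d : Matrix (Fin n) (Fin n) ℝ}
    (h : IsSympl a b c d) {ε : ℝ} (hε : 0 < ε) {r : ℂ} {y : Conf n} {τ : 𝓢(Conf n, ℂ)}
    (hτ : ∀ x, τ x = packet ħ r a b c d ε y x) (j : Fin n) (x : Conf n) :
    zS ħ (Sum.inl j) τ x =
      (frameG a b c d ε *ᵥ cvec x + (frameM c d ε)⁻¹ᵀ *ᵥ cvec y) j * τ x := by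
  have hħ' : (ħ : ℂ) ≠ 0 := by exact_mod_cast hħ.ne'
  have hd := (hasFDerivAt_gauss ħ (h.frameG_symm hε.ne')
    ((frameM c d ε)⁻¹ᵀ *ᵥ cvec y) x).const_mul (r⁻¹ * Complex.exp (Complex.I / ħ *
    (-(1 / 2) * (cvec y ⬝ᵥ (((frameM c d ε)⁻¹ * cplx d) *ᵥ cvec y)))))
  have hf : ⇑τ = fun x => r⁻¹ * Complex.exp (Complex.I / ħ *
    (-(1 / 2) * (cvec y ⬝ᵥ (((frameM c d ε)⁻¹ * cplx d) *ᵥ cvec y)))) *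
    gauss ħ (frameG a b c d ε) ((frameM c d ε)⁻¹ᵀ *ᵥ cvec y) x := funext hτ
  rw [← hf] at hd
  rw [zS_inl_apply, hd.fderiv, _root_.smul_apply, _root_.smul_apply, sum_coordCLM_single, hτ,
    packet]
  generalize gauss ħ _ _ x = G
  generalize r⁻¹ * Complex.exp _ = w
  simp only [smul_eq_mul]
  field_simp
  rw [Complex.I_sq]
  ring

end

section

variable {n : ℕ}

/-! ### Packets driven by a linear Hamiltonian flow -/

lemma HasMDerivAt.cplx {M : ℝ → Matrix (Fin n) (Fin n) ℝ} {M' : Matrix (Fin n) (Fin n) ℝ} {t : ℝ}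
    (hM : HasMDerivAt M M' t) : HasMDerivAt (fun τ => cplx (M τ)) (cplx M') t :=
  fun i j => (hM i j).ofReal_comp

lemma HasMDerivAt.dotProduct_mulVec {M : ℝ → Matrix (Fin n) (Fin n) ℂ}
    {M' : Matrix (Fin n) (Fin n) ℂ} {t : ℝ} (hM : HasMDerivAt M M' t) (v w : Fin n → ℂ) :
    HasDerivAt (fun τ => v ⬝ᵥ (M τ *ᵥ w)) (v ⬝ᵥ (M' *ᵥ w)) t :=
  HasDerivAt.fun_sum fun i _ => (hM.mulVec w i).const_mul (v i)

/-- The blocks of a curve of symplectic matrices with `Ȧ = J h A`. -/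
structure BlockFlow (h : ℝ → Matrix (PhaseIdx n) (PhaseIdx n) ℝ)
    (a b c d : ℝ → Matrix (Fin n) (Fin n) ℝ) : Prop where
  symm : ∀ t, (h t).IsSymm
  cont : Continuous h
  sympl : ∀ t, IsSympl (a t) (b t) (c t) (d t)
  da : ∀ t, HasMDerivAt a (-((h t).toBlocks₂₁ * a t) - (h t).toBlocks₂₂ * c t) t
  db : ∀ t, HasMDerivAt b (-((h t).toBlocks₂₁ * b t) - (h t).toBlocks₂₂ * d t) t
  dc : ∀ t, HasMDerivAt c ((h t).toBlocks₁₁ * a t + (h t).toBlocks₁₂ * c t) t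
  dd : ∀ t, HasMDerivAt d ((h t).toBlocks₁₁ * b t + (h t).toBlocks₁₂ * d t) t

/-- The logarithmic derivative of the root which accompanies a packet. -/
def rootRate (h : Matrix (PhaseIdx n) (PhaseIdx n) ℝ) (Γ : Matrix (Fin n) (Fin n) ℂ) : ℂ :=
  (1 / 2) * (cplx h.toBlocks₁₁ * Γ + cplx h.toBlocks₁₂).trace

/-- The symbol of `½⟨ẑ, h ẑ⟩` at the point `(u, x)`. -/
def quadSymbol (h : Matrix (PhaseIdx n) (PhaseIdx n) ℝ) (u v : Fin n → ℂ) : ℂ :=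
  (1 / 2) * (u ⬝ᵥ (cplx h.toBlocks₁₁ *ᵥ u)) + u ⬝ᵥ (cplx h.toBlocks₁₂ *ᵥ v) +
    (1 / 2) * (v ⬝ᵥ (cplx h.toBlocks₂₂ *ᵥ v))

lemma cplx_toBlocks_symm {h : Matrix (PhaseIdx n) (PhaseIdx n) ℝ} (hh : h.IsSymm) :
    (cplx h.toBlocks₁₁)ᵀ = cplx h.toBlocks₁₁ ∧ (cplx h.toBlocks₁₂)ᵀ = cplx h.toBlocks₂₁ := by
  constructor
  · ext i j
    exact congrArg Complex.ofReal (hh.apply (Sum.inl i) (Sum.inl j))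
  · ext i j
    exact congrArg Complex.ofReal (hh.apply (Sum.inr i) (Sum.inl j))

/-- The Hamilton–Jacobi equation for the phase of a packet. With N = M⁻¹, the left side is the time
derivative of the phase along the flow, and Γx + Nᵀy is its gradient in x. -/
lemma phase_rate {h : Matrix (PhaseIdx n) (PhaseIdx n) ℝ} (hh : h.IsSymm)
    {Γ : Matrix (Fin n) (Fin n) ℂ} (hΓ : Γ.IsSymm) (N : Matrix (Fin n) (Fin n) ℂ)
    (y x : Fin n → ℂ) :
    -(1 / 2) * (y ⬝ᵥ ((N * cplx h.toBlocks₁₁ * Nᵀ) *ᵥ y)) +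
      ((1 / 2) * (x ⬝ᵥ ((-(cplx h.toBlocks₂₁ * Γ) - cplx h.toBlocks₂₂ -
        Γ * (cplx h.toBlocks₁₁ * Γ + cplx h.toBlocks₁₂)) *ᵥ x)) +
      x ⬝ᵥ ((-(N * (cplx h.toBlocks₁₁ * Γ + cplx h.toBlocks₁₂)))ᵀ *ᵥ y)) =
    -quadSymbol h (Γ *ᵥ x + Nᵀ *ᵥ y) x := by
  obtain ⟨hpp, hpx⟩ := cplx_toBlocks_symm hh
  rw [quadSymbol]
  generalize cplx h.toBlocks₁₁ = P at *
  generalize cplx h.toBlocks₁₂ = Q at *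
  generalize cplx h.toBlocks₂₁ = R at *
  generalize cplx h.toBlocks₂₂ = S at *
  subst hpx
  have e1 : y ⬝ᵥ ((N * P * Nᵀ) *ᵥ y) = (Nᵀ *ᵥ y) ⬝ᵥ (P *ᵥ (Nᵀ *ᵥ y)) := by
    rw [mulVec_dotProduct_eq, Matrix.transpose_transpose, Matrix.mulVec_mulVec,
      Matrix.mulVec_mulVec, Matrix.mul_assoc]
  have e0 : ∀ w, y ⬝ᵥ (N *ᵥ w) = (Nᵀ *ᵥ y) ⬝ᵥ w := fun w => by
    rw [mulVec_dotProduct_eq, Matrix.transpose_transpose]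
  have e2 : x ⬝ᵥ ((-(N * (P * Γ + Q)))ᵀ *ᵥ y) =
      -((Nᵀ *ᵥ y) ⬝ᵥ (P *ᵥ (Γ *ᵥ x))) - (Nᵀ *ᵥ y) ⬝ᵥ (Q *ᵥ x) := by
    rw [← dotProduct_mulVec_symm, Matrix.neg_mulVec, dotProduct_neg, ← Matrix.mulVec_mulVec,
      e0, Matrix.add_mulVec, dotProduct_add, ← Matrix.mulVec_mulVec]
    ring
  have e3 : x ⬝ᵥ ((Qᵀ * Γ) *ᵥ x) = (Γ *ᵥ x) ⬝ᵥ (Q *ᵥ x) := by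
    rw [← Matrix.mulVec_mulVec, ← dotProduct_mulVec_symm]
  have e4 : x ⬝ᵥ ((Γ * (P * Γ + Q)) *ᵥ x) =
      (Γ *ᵥ x) ⬝ᵥ (P *ᵥ (Γ *ᵥ x)) + (Γ *ᵥ x) ⬝ᵥ (Q *ᵥ x) := by
    rw [← Matrix.mulVec_mulVec, Matrix.add_mulVec, ← Matrix.mulVec_mulVec, ← dotProduct_add,
      mulVec_dotProduct_eq, hΓ.eq]
  rw [Matrix.sub_mulVec, Matrix.sub_mulVec, Matrix.neg_mulVec, dotProduct_sub, dotProduct_sub,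
    dotProduct_neg, e1, e2, e3, e4]
  have e5 : (Γ *ᵥ x) ⬝ᵥ (P *ᵥ (Nᵀ *ᵥ y)) = (Nᵀ *ᵥ y) ⬝ᵥ (P *ᵥ (Γ *ᵥ x)) := by
    rw [dotProduct_mulVec_symm, hpp]
  simp only [Matrix.mulVec_add, dotProduct_add, add_dotProduct]
  rw [e5]
  ring

namespace BlockFlow

variable {h : ℝ → Matrix (PhaseIdx n) (PhaseIdx n) ℝ} {a b c d : ℝ → Matrix (Fin n) (Fin n) ℝ}
  (hf : BlockFlow h a b c d)
include hf

lemma hasMDerivAt_frameM (ε t : ℝ) : HasMDerivAt (fun t => frameM (c t) (d t) ε)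
    (-(cplx (h t).toBlocks₁₁ * frameL (a t) (b t) ε) +
      cplx (h t).toBlocks₁₂ * frameM (c t) (d t) ε) t := by
  refine ((hf.dc t).cplx.neg.add ((hf.dd t).cplx.const_smul (Complex.I * ε))).congr_deriv ?_
  simp only [frameM, frameL, cplx_add, cplx_mul, Matrix.mul_sub, Matrix.mul_add, Matrix.mul_neg,
    Matrix.mul_smul, smul_add]
  abel

lemma hasMDerivAt_frameL (ε t : ℝ) : HasMDerivAt (fun t => frameL (a t) (b t) ε)
    (-(cplx (h t).toBlocks₂₁ * frameL (a t) (b t) ε) +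
      cplx (h t).toBlocks₂₂ * frameM (c t) (d t) ε) t := by
  have h0 : (fun t => frameL (a t) (b t) ε) =
      fun t => cplx (a t) + (-(Complex.I * ε)) • cplx (b t) := by
    funext t; rw [frameL, neg_smul, sub_eq_add_neg]
  rw [h0]
  refine ((hf.da t).cplx.add ((hf.db t).cplx.const_smul (-(Complex.I * ε)))).congr_deriv ?_
  simp only [frameM, frameL, cplx_sub, cplx_neg, cplx_mul, Matrix.mul_sub, Matrix.mul_add,
    Matrix.mul_neg, Matrix.mul_smul, smul_sub, neg_smul, smul_neg]
  abel

section

variable {ε : ℝ} (hε : ε ≠ 0)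
include hε

lemma hasMDerivAt_frameM_inv (t : ℝ) : HasMDerivAt (fun t => (frameM (c t) (d t) ε)⁻¹)
    (-((frameM (c t) (d t) ε)⁻¹ * (cplx (h t).toBlocks₁₁ * frameG (a t) (b t) (c t) (d t) ε +
      cplx (h t).toBlocks₁₂))) t := by
  refine ((hf.hasMDerivAt_frameM ε t).inv
    (fun τ => (hf.sympl τ).frameM_det_ne_zero hε)).congr_deriv ?_
  congr 1
  rw [Matrix.mul_assoc, Matrix.add_mul, Matrix.neg_mul, Matrix.mul_assoc, Matrix.mul_assoc,
    (hf.sympl t).frameM_mul_inv hε, Matrix.mul_one, frameG, Matrix.mul_neg]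

/-- The Riccati equation for Γ = -LM⁻¹, obtained from the linear equations of the frame. -/
lemma hasMDerivAt_frameG (t : ℝ) : HasMDerivAt (fun t => frameG (a t) (b t) (c t) (d t) ε)
    (-(cplx (h t).toBlocks₂₁ * frameG (a t) (b t) (c t) (d t) ε) - cplx (h t).toBlocks₂₂ -
      frameG (a t) (b t) (c t) (d t) ε * (cplx (h t).toBlocks₁₁ *
        frameG (a t) (b t) (c t) (d t) ε + cplx (h t).toBlocks₁₂)) t := by
  refine ((hf.hasMDerivAt_frameL ε t).mul (hf.hasMDerivAt_frameM_inv hε t)).neg.congr_deriv ?_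
  have e : frameL (a t) (b t) ε * (frameM (c t) (d t) ε)⁻¹ =
    -frameG (a t) (b t) (c t) (d t) ε := by rw [frameG, neg_neg]
  rw [Matrix.add_mul, Matrix.neg_mul, Matrix.mul_assoc, e, Matrix.mul_assoc,
    (hf.sympl t).frameM_mul_inv hε, Matrix.mul_neg (frameL (a t) (b t) ε), ← Matrix.mul_assoc,
    e]
  simp only [Matrix.mul_one, Matrix.mul_neg, Matrix.neg_mul]
  abel

/-- The terms with the mixed block of the Hamiltonian cancel, and M⁻ᵀ = b - Γd assembles the rest
into a symmetric expression. -/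
lemma hasMDerivAt_inv_mul (t : ℝ) : HasMDerivAt (fun t => (frameM (c t) (d t) ε)⁻¹ * cplx (d t))
    ((frameM (c t) (d t) ε)⁻¹ * cplx (h t).toBlocks₁₁ * (frameM (c t) (d t) ε)⁻¹ᵀ) t := by
  refine ((hf.hasMDerivAt_frameM_inv hε t).mul (hf.dd t).cplx).congr_deriv ?_
  rw [(hf.sympl t).frameM_invT_eq hε]
  simp only [cplx_add, cplx_mul, Matrix.mul_sub, Matrix.mul_add, Matrix.add_mul, Matrix.neg_mul,
    Matrix.mul_assoc]
  abel

/-- The derivative of a packet in time. -/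
lemma hasDerivAt_packet {ħ : ℝ} {r : ℝ → ℂ} {t : ℝ}
    (hr : HasDerivAt r (r t * rootRate (h t) (frameG (a t) (b t) (c t) (d t) ε)) t)
    (hr0 : r t ≠ 0) (y x : Conf n) :
    HasDerivAt (fun t => packet ħ (r t) (a t) (b t) (c t) (d t) ε y x)
      (-(rootRate (h t) (frameG (a t) (b t) (c t) (d t) ε) + Complex.I / ħ *
        quadSymbol (h t) (frameG (a t) (b t) (c t) (d t) ε *ᵥ cvec x +
          (frameM (c t) (d t) ε)⁻¹ᵀ *ᵥ cvec y) (cvec x)) *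
        packet ħ (r t) (a t) (b t) (c t) (d t) ε y x) t := by
  have hphase := (((hf.hasMDerivAt_inv_mul hε t).dotProduct_mulVec (cvec y) (cvec y)).const_mul
    (-(1 / 2) : ℂ)).add ((((hf.hasMDerivAt_frameG hε t).dotProduct_mulVec (cvec x)
      (cvec x)).const_mul (1 / 2 : ℂ)).add
      ((hf.hasMDerivAt_frameM_inv hε t).transpose.dotProduct_mulVec (cvec x) (cvec y)))
  rw [phase_rate (hf.symm t) ((hf.sympl t).frameG_symm hε)] at hphase
  have hder := (hr.fun_inv hr0).fun_mul ((hphase.const_mul (Complex.I / ħ)).cexp)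
  have hfun : (fun t => packet ħ (r t) (a t) (b t) (c t) (d t) ε y x) = fun t => (r t)⁻¹ *
      Complex.exp (Complex.I / ħ * ((-(1 / 2) * (cvec y ⬝ᵥ
        (((frameM (c t) (d t) ε)⁻¹ * cplx (d t)) *ᵥ cvec y))) +
        ((1 / 2) * (cvec x ⬝ᵥ (frameG (a t) (b t) (c t) (d t) ε *ᵥ cvec x)) +
          cvec x ⬝ᵥ ((frameM (c t) (d t) ε)⁻¹ᵀ *ᵥ cvec y)))) := by
    funext t
    rw [packet, gauss, mul_assoc, ← Complex.exp_add, ← mul_add, quadPhase,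
      dotProduct_comm ((frameM (c t) (d t) ε)⁻¹ᵀ *ᵥ cvec y)]
  have hval := congrFun hfun t
  beta_reduce at hval
  rw [hfun]
  refine hder.congr_deriv ?_
  rw [hval]
  simp only [Pi.add_apply]
  generalize Complex.exp _ = E
  field_simp
  ring

end

end BlockFlow

end

section

variable {n : ℕ}

/-! ### Conservation of the overlap of two packets -/

/-- The sum of the absolute values of the entries. -/
def entrySum (M : Matrix (Fin n) (Fin n) ℂ) : ℝ := ∑ i, ∑ j, ‖M i j‖

lemma entrySum_nonneg (M : Matrix (Fin n) (Fin n) ℂ) : 0 ≤ entrySum M := by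
  unfold entrySum; positivity

lemma continuous_entrySum : Continuous (entrySum (n := n)) := by
  unfold entrySum; fun_prop

lemma norm_dotProduct_mulVec_le (M : Matrix (Fin n) (Fin n) ℂ) (v w : Fin n → ℂ) :
    ‖v ⬝ᵥ (M *ᵥ w)‖ ≤ entrySum M * (‖v‖ * ‖w‖) := by
  simp only [dotProduct, Matrix.mulVec, Finset.mul_sum]
  refine (norm_sum_le _ _).trans ?_
  rw [entrySum, Finset.sum_mul]
  refine Finset.sum_le_sum fun i _ => (norm_sum_le _ _).trans ?_
  rw [Finset.sum_mul]
  refine Finset.sum_le_sum fun j _ => ?_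
  rw [norm_mul, norm_mul]
  calc ‖v i‖ * (‖M i j‖ * ‖w j‖) ≤ ‖v‖ * (‖M i j‖ * ‖w‖) := by
        gcongr <;> exact norm_le_pi_norm _ _
    _ = _ := by ring

lemma norm_mulVec_le_entrySum (M : Matrix (Fin n) (Fin n) ℂ) (w : Fin n → ℂ) :
    ‖M *ᵥ w‖ ≤ entrySum M * ‖w‖ := by
  refine (pi_norm_le_iff_of_nonneg (mul_nonneg (entrySum_nonneg M) (norm_nonneg _))).2 fun i => ?_
  rw [Matrix.mulVec, dotProduct]
  refine (norm_sum_le _ _).trans ?_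
  calc ∑ j, ‖M i j * w j‖ ≤ (∑ j, ‖M i j‖) * ‖w‖ := by
        rw [Finset.sum_mul]
        refine Finset.sum_le_sum fun j _ => ?_
        rw [norm_mul]
        gcongr
        exact norm_le_pi_norm _ _
    _ ≤ _ := by
        gcongr
        exact Finset.single_le_sum (f := fun i => ∑ j, ‖M i j‖) (fun i _ => by positivity)
          (Finset.mem_univ i)

lemma norm_cvec_le (x : Conf n) : ‖cvec x‖ ≤ ‖x‖ := by
  refine (pi_norm_le_iff_of_nonneg (norm_nonneg _)).2 fun i => ?_
  rw [cvec, Complex.norm_real]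
  exact PiLp.norm_apply_le x i

/-- The coefficient is continuous in the matrices, so along a flow the growth is quadratic uniformly
on compact time sets. -/
lemma norm_quadSymbol_le (h : Matrix (PhaseIdx n) (PhaseIdx n) ℝ) (Γ N : Matrix (Fin n) (Fin n) ℂ)
    (y x : Conf n) :
    ‖quadSymbol h (Γ *ᵥ cvec x + N *ᵥ cvec y) (cvec x)‖ ≤
      (entrySum (cplx h.toBlocks₁₁) * (entrySum Γ + entrySum N * ‖y‖) ^ 2 +
        entrySum (cplx h.toBlocks₁₂) * (entrySum Γ + entrySum N * ‖y‖) +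
        entrySum (cplx h.toBlocks₂₂)) * (1 + ‖x‖) ^ 2 := by
  have h1 := entrySum_nonneg Γ
  have h2 := entrySum_nonneg N
  have h3 := entrySum_nonneg (cplx h.toBlocks₁₁)
  have h4 := entrySum_nonneg (cplx h.toBlocks₁₂)
  have h5 := entrySum_nonneg (cplx h.toBlocks₂₂)
  have hx0 := norm_nonneg x
  have hy0 := norm_nonneg y
  have hx := norm_cvec_le x
  have hy := norm_cvec_le y
  have hx1 : ‖cvec x‖ ≤ 1 + ‖x‖ := by linarith
  have hu : ‖Γ *ᵥ cvec x + N *ᵥ cvec y‖ ≤ (entrySum Γ + entrySum N * ‖y‖) * (1 + ‖x‖) := by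
    refine (norm_add_le _ _).trans ?_
    calc ‖Γ *ᵥ cvec x‖ + ‖N *ᵥ cvec y‖
        ≤ entrySum Γ * ‖cvec x‖ + entrySum N * ‖cvec y‖ :=
          add_le_add (norm_mulVec_le_entrySum _ _) (norm_mulVec_le_entrySum _ _)
      _ ≤ entrySum Γ * (1 + ‖x‖) + entrySum N * ‖y‖ := by gcongr
      _ ≤ _ := by nlinarith [mul_nonneg (mul_nonneg h2 hy0) hx0]
  generalize Γ *ᵥ cvec x + N *ᵥ cvec y = u at *
  generalize entrySum Γ + entrySum N * ‖y‖ = g at *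
  have hhalf : ‖(1 / 2 : ℂ)‖ ≤ 1 := by norm_num
  have b1 := norm_dotProduct_mulVec_le (cplx h.toBlocks₁₁) u u
  have b2 := norm_dotProduct_mulVec_le (cplx h.toBlocks₁₂) u (cvec x)
  have b3 := norm_dotProduct_mulVec_le (cplx h.toBlocks₂₂) (cvec x) (cvec x)
  have hg : 0 ≤ g * (1 + ‖x‖) := (norm_nonneg u).trans hu
  calc ‖quadSymbol h u (cvec x)‖
      ≤ ‖u ⬝ᵥ (cplx h.toBlocks₁₁ *ᵥ u)‖ + ‖u ⬝ᵥ (cplx h.toBlocks₁₂ *ᵥ cvec x)‖ +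
        ‖cvec x ⬝ᵥ (cplx h.toBlocks₂₂ *ᵥ cvec x)‖ := by
        rw [quadSymbol]
        refine (norm_add_le _ _).trans (add_le_add ((norm_add_le _ _).trans
          (add_le_add ?_ le_rfl)) ?_)
        · rw [norm_mul]; exact mul_le_of_le_one_left (norm_nonneg _) hhalf
        · rw [norm_mul]; exact mul_le_of_le_one_left (norm_nonneg _) hhalf
    _ ≤ entrySum (cplx h.toBlocks₁₁) * ((g * (1 + ‖x‖)) * (g * (1 + ‖x‖))) +
        entrySum (cplx h.toBlocks₁₂) * ((g * (1 + ‖x‖)) * (1 + ‖x‖)) +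
        entrySum (cplx h.toBlocks₂₂) * ((1 + ‖x‖) * (1 + ‖x‖)) := by
        refine add_le_add (add_le_add (b1.trans ?_) (b2.trans ?_)) (b3.trans ?_) <;> gcongr
    _ = _ := by ring

/-! ### Bounds for packets, uniform on compact time sets -/

namespace BlockFlow

variable {h : ℝ → Matrix (PhaseIdx n) (PhaseIdx n) ℝ} {a b c d : ℝ → Matrix (Fin n) (Fin n) ℝ}
  (hf : BlockFlow h a b c d)
include hf

lemma continuous_frameM (ε : ℝ) : Continuous fun t => frameM (c t) (d t) ε :=
  continuous_iff_continuousAt.2 fun t => (hf.hasMDerivAt_frameM ε t).continuousAt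

lemma continuous_d : Continuous d := continuous_iff_continuousAt.2 fun t => (hf.dd t).continuousAt

lemma continuous_blocks : Continuous (fun t => cplx (h t).toBlocks₁₁) ∧
    Continuous (fun t => cplx (h t).toBlocks₁₂) ∧ Continuous (fun t => cplx (h t).toBlocks₂₂) := by
  have hij : ∀ k l, Continuous fun t => ((h t k l : ℝ) : ℂ) := fun k l =>
    Complex.continuous_ofReal.comp ((continuous_apply l).comp ((continuous_apply k).comp hf.cont))
  exact ⟨continuous_pi fun i => continuous_pi fun j => hij (Sum.inl i) (Sum.inl j),
    continuous_pi fun i => continuous_pi fun j => hij (Sum.inl i) (Sum.inr j),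
    continuous_pi fun i => continuous_pi fun j => hij (Sum.inr i) (Sum.inr j)⟩

variable {ε : ℝ} (hε : 0 < ε)
include hε

lemma continuous_frameG : Continuous fun t => frameG (a t) (b t) (c t) (d t) ε :=
  continuous_iff_continuousAt.2 fun t => (hf.hasMDerivAt_frameG hε.ne' t).continuousAt

lemma continuous_frameM_inv : Continuous fun t => (frameM (c t) (d t) ε)⁻¹ :=
  continuous_iff_continuousAt.2 fun t => (hf.hasMDerivAt_frameM_inv hε.ne' t).continuousAt

lemma continuous_rootRate :
    Continuous fun t => rootRate (h t) (frameG (a t) (b t) (c t) (d t) ε) := by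
  unfold rootRate
  exact continuous_const.mul (((hf.continuous_blocks.1.matrix_mul (hf.continuous_frameG hε)).add
    hf.continuous_blocks.2.1).matrix_trace)

lemma exists_rate_bound {K : Set ℝ} (hK : IsCompact K) (ħ : ℝ) (y : Conf n) :
    ∃ C : ℝ, ∀ t ∈ K, ∀ x, ‖-(rootRate (h t) (frameG (a t) (b t) (c t) (d t) ε) + Complex.I / ħ *
        quadSymbol (h t) (frameG (a t) (b t) (c t) (d t) ε *ᵥ cvec x +
          (frameM (c t) (d t) ε)⁻¹ᵀ *ᵥ cvec y) (cvec x))‖ ≤ C * (1 + ‖x‖) ^ 2 := by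
  have hG := continuous_entrySum.comp (hf.continuous_frameG hε)
  have hN := continuous_entrySum.comp (hf.continuous_frameM_inv hε).matrix_transpose
  obtain ⟨h1, h2, h3⟩ := hf.continuous_blocks
  have h1' := continuous_entrySum.comp h1
  have h2' := continuous_entrySum.comp h2
  have h3' := continuous_entrySum.comp h3
  have hu := hG.add (hN.mul (continuous_const (y := ‖y‖)))
  have hcont := (hf.continuous_rootRate hε).norm.add ((continuous_const (y := ‖Complex.I / (ħ : ℂ)‖)).mul
    (((h1'.mul (hu.pow 2)).add (h2'.mul hu)).add h3'))
  obtain ⟨C, hC⟩ := hK.exists_bound_of_continuousOn hcont.continuousOn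
  refine ⟨C, fun t ht x => ?_⟩
  have := (le_abs_self _).trans (hC t ht)
  have hx : 1 ≤ (1 + ‖x‖) ^ 2 := one_le_pow₀ (by linarith [norm_nonneg x])
  rw [norm_neg]
  refine le_trans ?_ (mul_le_mul_of_nonneg_right this (by positivity))
  rw [Pi.add_apply, add_mul]
  refine (norm_add_le _ _).trans (add_le_add ?_ ?_)
  · exact le_mul_of_one_le_right (norm_nonneg _) hx
  · rw [norm_mul, Pi.mul_apply, mul_assoc]
    exact mul_le_mul_of_nonneg_left (norm_quadSymbol_le _ _ _ y x) (norm_nonneg _)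

lemma exists_packet_bound {K : Set ℝ} (hK : IsCompact K) {ħ : ℝ} (hħ : 0 < ħ) {r : ℝ → ℂ}
    (hr : Continuous r) (hr0 : ∀ t, r t ≠ 0) (y : Conf n) :
    ∃ C > 0, ∃ κ > 0, ∀ t ∈ K, ∀ x, ‖packet ħ (r t) (a t) (b t) (c t) (d t) ε y x‖ ≤
      C * Real.exp (-(κ * ‖x‖ ^ 2)) := by
  have c1 : Continuous fun t => ∑ i, ∑ j, ‖frameM (c t) (d t) ε i j‖ ^ 2 := by
    have := hf.continuous_frameM ε
    have hij : ∀ i j, Continuous fun t => frameM (c t) (d t) ε i j := fun i j =>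
      (continuous_apply j).comp ((continuous_apply i).comp this)
    fun_prop
  have c2 : Continuous fun t => confMul (d t) y :=
    (PiLp.continuous_toLp 2 _).comp (hf.continuous_d.matrix_mulVec continuous_const)
  have c3 : Continuous fun t => (r t)⁻¹ := hr.inv₀ hr0
  obtain ⟨K₁, hK₁⟩ := hK.exists_bound_of_continuousOn c1.continuousOn
  obtain ⟨V, hV⟩ := hK.exists_bound_of_continuousOn c2.continuousOn
  obtain ⟨R, hR⟩ := hK.exists_bound_of_continuousOn c3.continuousOn
  have hK0 : 0 < |K₁| + 1 := by positivity
  obtain ⟨κ, hκ⟩ : ∃ κ, κ = ε / (2 * ħ * (|K₁| + 1)) := ⟨_, rfl⟩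
  have hκ0 : 0 < κ := by rw [hκ]; positivity
  -- Moving the centre of the Gaussian from dy to the origin costs half of the exponent and the
  -- factor e^{κV²}, where V bounds the position of the centre.
  refine ⟨(|R| + 1) * Real.exp (κ * V ^ 2), by positivity, κ / 2, by positivity, fun t ht x => ?_⟩
  have hb := (hf.sympl t).norm_packet_le_exp hħ hε hK0
    (((le_abs_self _).trans (hK₁ t ht)).trans ((le_abs_self _).trans (by linarith))) (r t) y x
  rw [← hκ] at hb
  have hR' : ‖r t‖⁻¹ ≤ |R| + 1 := by
    rw [← norm_inv]
    exact (hR t ht).trans ((le_abs_self _).trans (by linarith))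
  have hv := hV t ht
  have hx : ‖x‖ ^ 2 ≤ 2 * (‖x - confMul (d t) y‖ ^ 2 + V ^ 2) := by
    have h1 : ‖x‖ ≤ ‖x - confMul (d t) y‖ + V := by
      calc ‖x‖ = ‖(x - confMul (d t) y) + confMul (d t) y‖ := by rw [sub_add_cancel]
        _ ≤ _ := (norm_add_le _ _).trans (by linarith)
    have h2 := norm_nonneg x
    nlinarith [sq_nonneg (‖x - confMul (d t) y‖ - V)]
  calc _ ≤ ‖r t‖⁻¹ * Real.exp (-κ * ‖x - confMul (d t) y‖ ^ 2) := hb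
    _ ≤ (|R| + 1) * Real.exp (κ * V ^ 2 + -(κ / 2 * ‖x‖ ^ 2)) := by
      gcongr
      nlinarith
    _ = _ := by rw [Real.exp_add, mul_assoc]

end BlockFlow

/-- Comparison with (1 + ‖x‖)^{-(n+1)}, integrable in dimension n. -/
lemma integrable_pow_mul_gaussian {κ : ℝ} (hκ : 0 < κ) (p : ℕ) :
    Integrable fun x : Conf n => (1 + ‖x‖) ^ p * Real.exp (-(κ * ‖x‖ ^ 2)) := by
  obtain ⟨C, hC⟩ := exists_one_add_pow_mul_exp_le hκ (p + (n + 1))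
  have h1 : Integrable fun x : Conf n => (1 + ‖x‖) ^ (-((n : ℝ) + 1)) :=
    integrable_one_add_norm (by simp)
  refine (h1.const_mul C).mono' ?_ (Eventually.of_forall fun x => ?_)
  · have : Continuous fun x : Conf n => (1 + ‖x‖) ^ p * Real.exp (-(κ * ‖x‖ ^ 2)) := by fun_prop
    exact this.aestronglyMeasurable
  · have hx : 0 < 1 + ‖x‖ := by linarith [norm_nonneg x]
    rw [Real.norm_of_nonneg (by positivity)]
    have h2 := hC ‖x‖ (norm_nonneg x)
    rw [pow_add] at h2
    have h3 : (1 + ‖x‖) ^ (-((n : ℝ) + 1)) = ((1 + ‖x‖) ^ (n + 1))⁻¹ := by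
      rw [Real.rpow_neg hx.le]
      congr 1
      exact_mod_cast Real.rpow_natCast (1 + ‖x‖) (n + 1)
    rw [h3, ← div_eq_mul_inv, le_div_iff₀ (by positivity)]
    linarith

/-- The overlap of two packets driven by the same Hamiltonian does not depend on time. -/
lemma overlap_conserved {h : ℝ → Matrix (PhaseIdx n) (PhaseIdx n) ℝ}
    {a b c d a' b' c' d' : ℝ → Matrix (Fin n) (Fin n) ℝ}
    (hf : BlockFlow h a b c d) (hf' : BlockFlow h a' b' c' d') {ε ε' : ℝ} (hε : 0 < ε)
    (hε' : 0 < ε') {ħ : ℝ} (hħ : 0 < ħ) {r r' : ℝ → ℂ}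
    (hr : ∀ t, HasDerivAt r (r t * rootRate (h t) (frameG (a t) (b t) (c t) (d t) ε)) t)
    (hr0 : ∀ t, r t ≠ 0)
    (hr' : ∀ t, HasDerivAt r' (r' t * rootRate (h t) (frameG (a' t) (b' t) (c' t) (d' t) ε')) t)
    (hr0' : ∀ t, r' t ≠ 0) (y y' : Conf n) (t₁ t₂ : ℝ) :
    ∫ x, star (packet ħ (r t₁) (a t₁) (b t₁) (c t₁) (d t₁) ε y x) *
        packet ħ (r' t₁) (a' t₁) (b' t₁) (c' t₁) (d' t₁) ε' y' x =
      ∫ x, star (packet ħ (r t₂) (a t₂) (b t₂) (c t₂) (d t₂) ε y x) *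
        packet ħ (r' t₂) (a' t₂) (b' t₂) (c' t₂) (d' t₂) ε' y' x := by
  have hħ' : (ħ : ℂ) ≠ 0 := by exact_mod_cast hħ.ne'
  choose τ hτ using fun t => (hf.sympl t).exists_schwartz_packet hħ hε (hr0 t) y
  choose τ' hτ' using fun t => (hf'.sympl t).exists_schwartz_packet hħ hε' (hr0' t) y'
  -- Each packet solves the Schrödinger equation: the right side is its time derivative. The trace
  -- from Weyl ordering is exactly the logarithmic rate of the root.
  have hH : ∀ {a b c d : ℝ → Matrix (Fin n) (Fin n) ℝ} (_ : BlockFlow h a b c d) {ε : ℝ}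
      (_ : 0 < ε) {r : ℝ → ℂ} {y : Conf n} {τ : ℝ → 𝓢(Conf n, ℂ)}
      (_ : ∀ t x, τ t x = packet ħ (r t) (a t) (b t) (c t) (d t) ε y x) (t : ℝ) (x : Conf n),
      ((-(Complex.I / ħ)) • hamS ħ (h t) (τ t)) x =
      -(rootRate (h t) (frameG (a t) (b t) (c t) (d t) ε) + Complex.I / ħ *
        quadSymbol (h t) (frameG (a t) (b t) (c t) (d t) ε *ᵥ cvec x +
          (frameM (c t) (d t) ε)⁻¹ᵀ *ᵥ cvec y) (cvec x)) *
        packet ħ (r t) (a t) (b t) (c t) (d t) ε y x := by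
    intro a b c d hf ε hε r y τ hτ t x
    rw [_root_.smul_apply, hamS_of_potential (hf.symm t) ((hf.sympl t).zS_packet hħ hε (hτ t)),
      hτ, quadSymbol, rootRate, smul_eq_mul]
    field_simp
    ring_nf
    rw [Complex.I_sq]
    ring
  have key : ∀ t, HasDerivAt (fun t => ∫ x, star (packet ħ (r t) (a t) (b t) (c t) (d t) ε y x) *
        packet ħ (r' t) (a' t) (b' t) (c' t) (d' t) ε' y' x) 0 t := by
    intro t₀
    obtain ⟨B, hB⟩ := hf.exists_rate_bound hε (isCompact_closedBall t₀ 1) ħ y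
    obtain ⟨B', hB'⟩ := hf'.exists_rate_bound hε' (isCompact_closedBall t₀ 1) ħ y'
    have hrc : Continuous r := continuous_iff_continuousAt.2 fun t => (hr t).continuousAt
    have hrc' : Continuous r' := continuous_iff_continuousAt.2 fun t => (hr' t).continuousAt
    obtain ⟨C, hC0, κ, hκ, hC⟩ := hf.exists_packet_bound hε (isCompact_closedBall t₀ 1) hħ hrc hr0 y
    obtain ⟨C', hC0', κ', hκ', hC'⟩ :=
      hf'.exists_packet_bound hε' (isCompact_closedBall t₀ 1) hħ hrc' hr0' y'
    have hint : ∀ t, Integrable fun x => star (packet ħ (r t) (a t) (b t) (c t) (d t) ε y x) *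
        packet ħ (r' t) (a' t) (b' t) (c' t) (d' t) ε' y' x := by
      intro t
      refine (integrable_star_mul (τ t) (τ' t)).congr (Eventually.of_forall fun x => ?_)
      simp only [hτ, hτ']
    have hder := (hasDerivAt_integral_of_dominated_loc_of_deriv_le (μ := volume) (𝕜 := ℝ)
      (F := fun t x => star (packet ħ (r t) (a t) (b t) (c t) (d t) ε y x) *
        packet ħ (r' t) (a' t) (b' t) (c' t) (d' t) ε' y' x)
      (F' := fun t x => star (((-(Complex.I / ħ)) • hamS ħ (h t) (τ t)) x) * τ' t x +
          star (τ t x) * ((-(Complex.I / ħ)) • hamS ħ (h t) (τ' t)) x) (x₀ := t₀)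
      (bound := fun x => ((B + B') * C * C') * ((1 + ‖x‖) ^ 2 * Real.exp (-((κ + κ') * ‖x‖ ^ 2))))
      (Metric.closedBall_mem_nhds t₀ one_pos)
      (Eventually.of_forall fun t => (hint t).aestronglyMeasurable) (hint t₀)
      ((integrable_star_mul _ _).add (integrable_star_mul _ _)).aestronglyMeasurable
      (Eventually.of_forall fun x t ht => ?_)
      ((integrable_pow_mul_gaussian (add_pos hκ hκ') 2).const_mul _)
      (Eventually.of_forall fun x t ht => ?_)).2
    -- The two terms carry conjugate imaginary factors and cancel, because the quadratic Hamiltonian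
    -- is symmetric.
    · refine hder.congr_deriv ?_
      have e := integral_add (integrable_star_mul ((-(Complex.I / ħ)) • hamS ħ (h t₀) (τ t₀)) (τ' t₀))
        (integrable_star_mul (τ t₀) ((-(Complex.I / ħ)) • hamS ħ (h t₀) (τ' t₀)))
      change _ = ip _ _ + ip _ _ at e
      rw [ip_smul_left, ip_smul_right, ip_hamS ħ (hf.symm t₀)] at e
      rw [e]
      simp
      ring
    · have e1 := hB t ht x
      have e2 := hB' t ht x
      have e3 := hC t ht x
      have e4 := hC' t ht x
      rw [hH hf hε hτ, hH hf' hε' hτ', hτ, hτ']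
      refine (norm_add_le _ _).trans ?_
      rw [norm_mul, norm_mul, norm_star, norm_star, norm_mul, norm_mul]
      have h1 : Real.exp (-((κ + κ') * ‖x‖ ^ 2)) =
          Real.exp (-(κ * ‖x‖ ^ 2)) * Real.exp (-(κ' * ‖x‖ ^ 2)) := by
        rw [← Real.exp_add]; congr 1; ring
      have hBn : 0 ≤ B * (1 + ‖x‖) ^ 2 := (norm_nonneg _).trans e1
      have hBn' : 0 ≤ B' * (1 + ‖x‖) ^ 2 := (norm_nonneg _).trans e2
      rw [h1]
      calc _ ≤ (B * (1 + ‖x‖) ^ 2) * (C * Real.exp (-(κ * ‖x‖ ^ 2))) *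
            (C' * Real.exp (-(κ' * ‖x‖ ^ 2))) + (C * Real.exp (-(κ * ‖x‖ ^ 2))) *
            ((B' * (1 + ‖x‖) ^ 2) * (C' * Real.exp (-(κ' * ‖x‖ ^ 2)))) := by gcongr
        _ = _ := by ring
    · rw [hH hf hε hτ, hH hf' hε' hτ', hτ, hτ']
      have d1 := hf.hasDerivAt_packet hε.ne' (ħ := ħ) (hr t) (hr0 t) y x
      have d2 := hf'.hasDerivAt_packet hε'.ne' (ħ := ħ) (hr' t) (hr0' t) y' x
      exact d1.star.mul d2
  exact is_const_of_deriv_eq_zero (fun t => (key t).differentiableAt) (fun t => (key t).deriv) t₁ t₂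

end

section

variable {n : ℕ}

/-! ### Smoothing with Gaussians -/

lemma norm_exp_neg_sub_one_le {s : ℝ} (hs : 0 ≤ s) : ‖Complex.exp (-(s : ℝ)) - 1‖ ≤ s := by
  rw [← Complex.ofReal_neg, ← Complex.ofReal_exp, ← Complex.ofReal_one, ← Complex.ofReal_sub,
    Complex.norm_real, Real.norm_eq_abs, abs_sub_comm, abs_of_nonneg]
  · linarith [Real.add_one_le_exp (-s)]
  · linarith [Real.exp_le_one_iff.2 (neg_nonpos.2 hs)]

/-- The derivatives of `exp (-cε‖x‖²) - 1` are of the order of `ε`. -/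
lemma exists_iteratedFDeriv_gaussian_sub_one_le {c : ℝ} (hc : 0 < c) (l : ℕ) :
    ∃ B : ℝ, 0 ≤ B ∧ ∃ p : ℕ, ∀ ε : ℝ, 0 < ε → ε ≤ 1 → ∀ i ≤ l, ∀ x : Conf n,
      ‖iteratedFDeriv ℝ i (fun x : Conf n => Complex.exp (-(c * ε * ‖x‖ ^ 2 : ℝ)) - 1) x‖ ≤
        ε * (B * (1 + ‖x‖) ^ p) := by
  have hs : ContDiff ℝ ((⊤ : ℕ∞) : WithTop ℕ∞) (fun x : Conf n => ‖x‖ ^ 2) := contDiff_norm_sq ℝ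
  obtain ⟨q, C₀, hC₀, hq⟩ :=
    (Function.hasTemperateGrowth_norm_sq (H := Conf n)).norm_iteratedFDeriv_le_uniform l
  refine ⟨l.factorial * max 1 c ^ (l + 1) * (1 + C₀) ^ l, by positivity, 2 + q * l,
    fun ε hε hε1 i hi x => ?_⟩
  have hx0 := norm_nonneg x
  have hx1 : 1 ≤ 1 + ‖x‖ := by linarith
  have hg : ContDiff ℝ ((⊤ : ℕ∞) : WithTop ℕ∞)
      (fun s : ℝ => Complex.exp (-((c * ε) * s : ℝ)) - 1) :=
    (contDiff_cexp_neg_mul (c * ε)).sub contDiff_const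
  have hm1 : 1 ≤ max 1 c := le_max_left _ _
  have hmc : c ≤ max 1 c := le_max_right _ _
  have key := norm_iteratedFDeriv_comp_le (𝕜 := ℝ) (n := i)
    (N := ((⊤ : ℕ∞) : WithTop ℕ∞)) hg hs (by exact_mod_cast le_top) x
    (C := ε * (max 1 c ^ (l + 1) * (1 + ‖x‖) ^ 2)) (D := (1 + C₀) * (1 + ‖x‖) ^ q)
    (fun j hj => ?_) (fun j h1 hj => ?_)
  · calc _ ≤ i.factorial * (ε * (max 1 c ^ (l + 1) * (1 + ‖x‖) ^ 2)) *
          ((1 + C₀) * (1 + ‖x‖) ^ q) ^ i := key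
      _ ≤ l.factorial * (ε * (max 1 c ^ (l + 1) * (1 + ‖x‖) ^ 2)) *
          ((1 + C₀) * (1 + ‖x‖) ^ q) ^ l := by
          have h1 : ((1 + C₀) * (1 + ‖x‖) ^ q) ^ i ≤ ((1 + C₀) * (1 + ‖x‖) ^ q) ^ l :=
            pow_le_pow_right₀ (one_le_mul_of_one_le_of_one_le (by linarith) (one_le_pow₀ hx1)) hi
          have h2 : (i.factorial : ℝ) ≤ l.factorial := by exact_mod_cast Nat.factorial_le hi
          gcongr
      _ = _ := by rw [mul_pow, ← pow_mul, pow_add]; ring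
  · rw [norm_iteratedFDeriv_eq_norm_iteratedDeriv]
    rcases Nat.eq_zero_or_pos j with rfl | hj0
    · rw [iteratedDeriv_zero]
      refine (norm_exp_neg_sub_one_le (by positivity)).trans ?_
      calc c * ε * ‖x‖ ^ 2 = ε * (c * ‖x‖ ^ 2) := by ring
        _ ≤ ε * (max 1 c ^ (l + 1) * (1 + ‖x‖) ^ 2) := by
          have : c ≤ max 1 c ^ (l + 1) := hmc.trans (le_self_pow₀ hm1 (by omega))
          gcongr
          linarith
    -- For j ≥ 1 the constant drops out and the factor ε comes from ε^j ≤ ε, valid for ε ≤ 1. For j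
    -- = 0 it came from 1 - e^{-s} ≤ s.
    · have e : iteratedDeriv j (fun s : ℝ => Complex.exp (-((c * ε) * s : ℝ)) - 1) =
          iteratedDeriv j (fun s : ℝ => Complex.exp (-((c * ε) * s : ℝ))) := by
        obtain ⟨j, rfl⟩ := Nat.exists_eq_succ_of_ne_zero hj0.ne'
        rw [iteratedDeriv_succ', iteratedDeriv_succ']
        congr 1
        funext s
        rw [deriv_sub_const]
      rw [e, iteratedDeriv_cexp_neg_mul, norm_mul, norm_pow,
        norm_neg, Complex.norm_real, Real.norm_of_nonneg (by positivity), ← Complex.ofReal_neg,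
        Complex.norm_exp_ofReal]
      have h1 : Real.exp (-(c * ε * ‖x‖ ^ 2)) ≤ 1 :=
        Real.exp_le_one_iff.2 (neg_nonpos.2 (by positivity))
      have h2 : ε ^ j ≤ ε := pow_le_of_le_one hε.le hε1 hj0.ne'
      have h3 : c ^ j ≤ max 1 c ^ (l + 1) :=
        (pow_le_pow_left₀ hc.le hmc j).trans (pow_le_pow_right₀ hm1 (by omega))
      have h4 : 1 ≤ (1 + ‖x‖) ^ 2 := one_le_pow₀ hx1
      calc (c * ε) ^ j * Real.exp (-(c * ε * ‖x‖ ^ 2)) ≤ (c * ε) ^ j * 1 := by gcongr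
        _ = ε ^ j * (c ^ j * 1) := by rw [mul_pow]; ring
        _ ≤ _ := by gcongr
  · refine (hq j (hj.trans hi) x).trans ?_
    rw [mul_pow]
    have e1 : (1 + ‖x‖) ^ q ≤ ((1 + ‖x‖) ^ q) ^ j :=
      le_self_pow₀ (one_le_pow₀ hx1) (by omega)
    have e2 : C₀ ≤ (1 + C₀) ^ j := (by linarith : C₀ ≤ 1 + C₀).trans
      (le_self_pow₀ (by linarith) (by omega))
    gcongr

lemma hasTemperateGrowth_gaussian {a : ℝ} (ha : 0 < a) :
    Function.HasTemperateGrowth (fun x : Conf n => Complex.exp (-(a * ‖x‖ ^ 2 : ℝ))) := by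
  obtain ⟨g, hg⟩ := exists_schwartz_gaussian (n := n) ha
  rw [← show ⇑g = fun x : Conf n => Complex.exp (-(a * ‖x‖ ^ 2 : ℝ)) from funext hg]
  exact g.hasTemperateGrowth

/-- Multiplication by Gaussians which become flat converges to the identity. -/
lemma tendsto_gaussian_smul {c : ℝ} (hc : 0 < c) (F : 𝓢(Conf n, ℂ)) :
    Tendsto (fun ε : ℝ => SchwartzMap.smulLeftCLM ℂ
      (fun x : Conf n => Complex.exp (-(c * ε * ‖x‖ ^ 2 : ℝ))) F) (𝓝[>] 0) (𝓝 F) := by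
  rw [(schwartz_withSeminorms ℝ (Conf n) ℂ).tendsto_nhds]
  rintro ⟨k, l⟩ δ hδ
  obtain ⟨B, hB0, p, hB⟩ := exists_iteratedFDeriv_gaussian_sub_one_le (n := n) hc l
  obtain ⟨S, hS⟩ : ∃ S, S = 2 ^ (k + p) * (Finset.Iic ((k + p, l) : ℕ × ℕ)).sup
    (fun m => SchwartzMap.seminorm ℝ m.1 m.2) F := ⟨_, rfl⟩
  have hF : ∀ j ≤ l, ∀ x, (1 + ‖x‖) ^ (k + p) * ‖iteratedFDeriv ℝ j F x‖ ≤ S := by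
    intro j hj x
    rw [hS]
    exact SchwartzMap.one_add_le_sup_seminorm_apply (𝕜 := ℝ) (m := (k + p, l)) le_rfl hj F x
  have hS0 : 0 ≤ S := le_trans (by positivity) (hF 0 (Nat.zero_le l) 0)
  -- The factor 2^l is the sum of the binomial coefficients in the Leibniz rule; S is a Schwartz
  -- bound on F with enough weight to absorb the polynomial growth.
  have hsmall : ∀ᶠ ε in 𝓝[>] (0 : ℝ), ε * (2 ^ l * (B * S)) < δ := by
    have : Tendsto (fun ε : ℝ => ε * (2 ^ l * (B * S))) (𝓝[>] 0) (𝓝 (0 * (2 ^ l * (B * S)))) :=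
      (tendsto_id.mul_const _).mono_left nhdsWithin_le_nhds
    rw [zero_mul] at this
    exact this.eventually_lt_const hδ
  filter_upwards [hsmall, self_mem_nhdsWithin, nhdsWithin_le_nhds (Iic_mem_nhds one_pos)]
    with ε hε hε0 hε1
  have hε0' : 0 < ε := hε0
  refine lt_of_le_of_lt (SchwartzMap.seminorm_le_bound ℝ k l _ (by positivity) fun x => ?_) hε
  have hfun : ⇑(SchwartzMap.smulLeftCLM ℂ
      (fun x : Conf n => Complex.exp (-(c * ε * ‖x‖ ^ 2 : ℝ))) F - F) =
      fun x => (Complex.exp (-(c * ε * ‖x‖ ^ 2 : ℝ)) - 1) * F x := by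
    funext x
    rw [_root_.sub_apply, SchwartzMap.smulLeftCLM_apply_apply
      (hasTemperateGrowth_gaussian (by positivity)), smul_eq_mul]
    ring
  rw [hfun]
  have hsm : ContDiff ℝ ((⊤ : ℕ∞) : WithTop ℕ∞)
      (fun x : Conf n => Complex.exp (-(c * ε * ‖x‖ ^ 2 : ℝ)) - 1) :=
    ((contDiff_cexp_neg_mul (c * ε)).comp (contDiff_norm_sq ℝ)).sub contDiff_const
  have hmul := norm_iteratedFDeriv_mul_le (𝕜 := ℝ) (n := l) hsm F.smooth' x
    (by exact_mod_cast le_top)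
  calc _ ≤ ‖x‖ ^ k * ∑ i ∈ Finset.range (l + 1), (l.choose i : ℝ) *
        ‖iteratedFDeriv ℝ i (fun x : Conf n => Complex.exp (-(c * ε * ‖x‖ ^ 2 : ℝ)) - 1) x‖ *
          ‖iteratedFDeriv ℝ (l - i) F x‖ := mul_le_mul_of_nonneg_left hmul (by positivity)
    _ ≤ ∑ i ∈ Finset.range (l + 1), (l.choose i : ℝ) * (ε * (B * S)) := by
        rw [Finset.mul_sum]
        refine Finset.sum_le_sum fun i hi => ?_
        have h1 := hB ε hε0' hε1 i (Nat.lt_succ_iff.1 (Finset.mem_range.1 hi)) x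
        have h2 := hF (l - i) (Nat.sub_le _ _) x
        have hx : ‖x‖ ^ k ≤ (1 + ‖x‖) ^ k := by gcongr; linarith
        calc _ ≤ (1 + ‖x‖) ^ k * ((l.choose i : ℝ) * (ε * (B * (1 + ‖x‖) ^ p)) *
              ‖iteratedFDeriv ℝ (l - i) F x‖) := by gcongr
          _ = (l.choose i : ℝ) * (ε * (B * ((1 + ‖x‖) ^ (k + p) *
              ‖iteratedFDeriv ℝ (l - i) F x‖))) := by rw [pow_add]; ring
          _ ≤ _ := by gcongr
    _ = _ := by
        rw [← Finset.sum_mul]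
        have : ∑ i ∈ Finset.range (l + 1), (l.choose i : ℝ) = 2 ^ l := by
          exact_mod_cast Nat.sum_range_choose l
        rw [this]
        ring

/-! ### Convolution with narrow Gaussians and totality of Gaussians -/

open FourierTransform

/-- Convolution with the normalized Gaussian of width `√(ħε)`. -/
def smoothing (ħ ε : ℝ) (f : 𝓢(Conf n, ℂ)) : 𝓢(Conf n, ℂ) :=
  𝓕⁻ (SchwartzMap.smulLeftCLM ℂ
    (fun x : Conf n => Complex.exp (-(2 * Real.pi ^ 2 * ħ * ε * ‖x‖ ^ 2 : ℝ))) (𝓕 f))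

/-- On the Fourier side the convolution is multiplication by Gaussians which become flat, and the
inverse Fourier transform is continuous on Schwartz space. -/
lemma tendsto_smoothing {ħ : ℝ} (hħ : 0 < ħ) (f : 𝓢(Conf n, ℂ)) :
    Tendsto (fun ε => smoothing ħ ε f) (𝓝[>] 0) (𝓝 f) := by
  have h := tendsto_gaussian_smul (c := 2 * Real.pi ^ 2 * ħ) (by positivity) (𝓕 f)
  have hc := ((ContinuousFourierInv.continuous_fourierInv (E := 𝓢(Conf n, ℂ))).tendsto
    (𝓕 f)).comp h
  rw [FourierTransform.fourierInv_fourier_eq f] at hc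
  exact hc

lemma heat_const {ħ ε : ℝ} (hħ : 0 < ħ) (hε : 0 < ε) :
    ((Real.pi : ℂ) / ((2 * Real.pi ^ 2 * ħ * ε : ℝ) : ℂ)) ^ ((n : ℂ) / 2) =
      (Real.sqrt ((2 * Real.pi * ħ * ε) ^ n) : ℂ)⁻¹ := by
  have h1 : (Real.pi : ℂ) / ((2 * Real.pi ^ 2 * ħ * ε : ℝ) : ℂ) =
      (((2 * Real.pi * ħ * ε)⁻¹ : ℝ) : ℂ) := by
    have := Real.pi_pos.ne'
    rw [← Complex.ofReal_div]
    congr 1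
    field_simp
  have h2 : ((n : ℂ) / 2) = (((n : ℝ) / 2 : ℝ) : ℂ) := by push_cast; rfl
  rw [h1, h2, ← Complex.ofReal_cpow (by positivity), ← Complex.ofReal_inv]
  congr 1
  rw [Real.inv_rpow (by positivity), Real.sqrt_eq_rpow, ← Real.rpow_natCast, ← Real.rpow_mul
    (by positivity)]
  congr 2
  ring

/-- The inverse transform at y is an integral of 𝓕f against a modulated Gaussian. Shifting 𝓕 onto
the latter by the multiplication formula produces the heat kernel centred at y. -/
lemma smoothing_apply {ħ ε : ℝ} (hħ : 0 < ħ) (hε : 0 < ε) (f : 𝓢(Conf n, ℂ)) (y : Conf n) :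
    smoothing ħ ε f y = ∫ x, heatAt ħ ε y x * f x := by
  have ha : 0 < 2 * Real.pi ^ 2 * ħ * ε := by positivity
  have hgr := hasTemperateGrowth_gaussian (n := n) ha
  obtain ⟨m, hm⟩ := exists_schwartz_gaussian (n := n) ha
  have hwave : Function.HasTemperateGrowth
      (fun v : Conf n => Complex.exp ((2 * Real.pi * inner ℝ y v : ℝ) * Complex.I)) := by
    refine hasTemperateGrowth_cexp_I.comp ?_
    exact (Function.HasTemperateGrowth.const (2 * Real.pi)).mul ((innerSL ℝ y).hasTemperateGrowth)
  obtain ⟨g, hg⟩ : ∃ g : 𝓢(Conf n, ℂ), ∀ v, g v =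
      Complex.exp ((2 * Real.pi * inner ℝ y v : ℝ) * Complex.I) * m v :=
    ⟨SchwartzMap.smulLeftCLM ℂ _ m, fun v => by
      rw [SchwartzMap.smulLeftCLM_apply_apply hwave, smul_eq_mul]⟩
  have h1 : smoothing ħ ε f y = ∫ v, 𝓕 f v * g v := by
    rw [smoothing, SchwartzMap.fourierInv_coe, Real.fourierInv_eq']
    congr 1
    funext v
    rw [SchwartzMap.smulLeftCLM_apply_apply hgr, hg, hm, smul_eq_mul, smul_eq_mul, real_inner_comm]
    push_cast
    ring
  have h2 : ∀ x, 𝓕 g x = heatAt ħ ε y x := by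
    intro x
    have hfun : ⇑g = fun v : Conf n => Complex.exp (-((2 * Real.pi ^ 2 * ħ * ε : ℝ) : ℂ) * ‖v‖ ^ 2 +
        2 * Real.pi * Complex.I * (inner ℝ y v : ℝ)) := by
      funext v
      rw [hg, hm, ← Complex.exp_add]
      congr 1
      push_cast
      ring
    rw [SchwartzMap.fourier_coe, hfun, fourier_gaussian_innerProductSpace' (by
      rw [Complex.ofReal_re]; exact ha), heatAt_apply hħ hε, finrank_euclideanSpace_fin,
      heat_const hħ hε, norm_sub_rev]
    congr 2
    have := Real.pi_pos.ne'
    have hπ : (Real.pi : ℂ) ≠ 0 := by exact_mod_cast this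
    have hħ' : (ħ : ℂ) ≠ 0 := by exact_mod_cast hħ.ne'
    have hε' : (ε : ℂ) ≠ 0 := by exact_mod_cast hε.ne'
    push_cast
    field_simp
  rw [h1, SchwartzMap.integral_fourier_mul_eq]
  congr 1
  funext x
  rw [h2, mul_comm]

lemma star_heatAt {ħ ε : ℝ} (hħ : 0 < ħ) (hε : 0 < ε) (y x : Conf n) :
    star (heatAt ħ ε y x) = heatAt ħ ε y x := by
  rw [heatAt_apply hħ hε, ← Complex.ofReal_neg, ← Complex.ofReal_exp, ← Complex.ofReal_inv,
    ← Complex.ofReal_mul, Complex.star_def, Complex.conj_ofReal]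

lemma ip_heatAt {ħ ε : ℝ} (hħ : 0 < ħ) (hε : 0 < ε) (f : 𝓢(Conf n, ℂ)) (y : Conf n) :
    ip (heatAt ħ ε y) f = smoothing ħ ε f y := by
  rw [smoothing_apply hħ hε, ip]
  simp only [star_heatAt hħ hε]

lemma continuous_schwartz_eval (x : Conf n) : Continuous fun f : 𝓢(Conf n, ℂ) => f x :=
  ((BoundedContinuousFunction.evalCLM ℂ x).comp
    (SchwartzMap.toBoundedContinuousFunctionCLM ℂ (Conf n) ℂ)).continuous

/-- The Gaussians are total. -/
lemma eq_zero_of_ip_heatAt {ħ : ℝ} (hħ : 0 < ħ) {f : 𝓢(Conf n, ℂ)}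
    (h : ∀ ε, 0 < ε → ∀ y, ip (heatAt ħ ε y) f = 0) : f = 0 := by
  ext y
  have h1 : Tendsto (fun ε => smoothing ħ ε f y) (𝓝[>] 0) (𝓝 (f y)) :=
    ((continuous_schwartz_eval y).tendsto f).comp (tendsto_smoothing hħ f)
  have h2 : Tendsto (fun ε => smoothing ħ ε f y) (𝓝[>] 0) (𝓝 0) := by
    refine tendsto_const_nhds.congr' ?_
    filter_upwards [self_mem_nhdsWithin] with ε hε
    rw [← ip_heatAt hħ hε, h ε hε]
  exact tendsto_nhds_unique h1 h2

/-- The integrand is strictly positive. Being nonzero for all pairs of widths and centres, the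
overlap can be cancelled when constants are compared. -/
lemma ip_heatAt_heatAt_ne_zero {ħ ε ε' : ℝ} (hħ : 0 < ħ) (hε : 0 < ε) (hε' : 0 < ε')
    (y y' : Conf n) : ip (heatAt ħ ε y) (heatAt ħ ε' y') ≠ 0 := by
  obtain ⟨F, hF, hpos⟩ : ∃ F : Conf n → ℝ, (∀ x, star (heatAt ħ ε y x) * heatAt ħ ε' y' x = F x) ∧
      ∀ x, 0 < F x := by
    refine ⟨fun x => ((Real.sqrt ((2 * Real.pi * ħ * ε) ^ n))⁻¹ *
      Real.exp (-(1 / (2 * ħ * ε) * ‖x - y‖ ^ 2))) * ((Real.sqrt ((2 * Real.pi * ħ * ε') ^ n))⁻¹ *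
      Real.exp (-(1 / (2 * ħ * ε') * ‖x - y'‖ ^ 2))), fun x => ?_, fun x => by positivity⟩
    rw [star_heatAt hħ hε, heatAt_apply hħ hε, heatAt_apply hħ hε']
    push_cast
    rfl
  have hint : Integrable F := by
    have := (integrable_star_mul (heatAt ħ ε y) (heatAt ħ ε' y')).re
    refine this.congr (Eventually.of_forall fun x => ?_)
    beta_reduce
    rw [hF]
    exact Complex.ofReal_re _
  rw [ip]
  simp only [hF]
  rw [integral_complex_ofReal, Complex.ofReal_ne_zero]
  refine ne_of_gt ((integral_pos_iff_support_of_nonneg (fun x => (hpos x).le) hint).2 ?_)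
  rw [show Function.support F = Set.univ from Set.eq_univ_of_forall fun x => (hpos x).ne']
  exact Measure.measure_univ_pos.2 (NeZero.ne _)

end

section

variable {n : ℕ} {D : Coeffs n}

/-! ### The flow of the system in variations -/

/-- The upper left block of the matriciant. -/
abbrev blkA (D : Coeffs n) (κt t s : ℝ) := (matriciant D κt t s).toBlocks₁₁
/-- The upper right block of the matriciant. -/
abbrev blkB (D : Coeffs n) (κt t s : ℝ) := (matriciant D κt t s).toBlocks₁₂
/-- The lower left block of the matriciant. -/
abbrev blkC (D : Coeffs n) (κt t s : ℝ) := (matriciant D κt t s).toBlocks₂₁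
/-- The lower right block of the matriciant. -/
abbrev blkD (D : Coeffs n) (κt t s : ℝ) := (matriciant D κt t s).toBlocks₂₂

lemma fromBlocks_blk (D : Coeffs n) (κt t s : ℝ) :
    fromBlocks (blkA D κt t s) (blkB D κt t s) (blkC D κt t s) (blkD D κt t s) =
      matriciant D κt t s := Matrix.fromBlocks_toBlocks _

lemma isSympl_blk (hD : D.IsContinuous) (hS : D.IsSymmetric) (κt t s : ℝ) :
    IsSympl (blkA D κt t s) (blkB D κt t s) (blkC D κt t s) (blkD D κt t s) := by
  apply IsSympl.of_fromBlocks
  rw [fromBlocks_blk]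
  exact matriciant_symplectic hD hS κt t s

lemma blk_self (hD : D.IsContinuous) (κt s : ℝ) : blkA D κt s s = 1 ∧ blkB D κt s s = 0 ∧
    blkC D κt s s = 0 ∧ blkD D κt s s = 1 := by
  have h := matriciant_self hD κt s
  rw [← fromBlocks_blk, ← Matrix.fromBlocks_one, Matrix.fromBlocks_inj] at h
  exact h

lemma blockFlow_matriciant (hD : D.IsContinuous) (hS : D.IsSymmetric) (κt s : ℝ) :
    BlockFlow (effHess D κt) (fun t => blkA D κt t s) (fun t => blkB D κt t s)
      (fun t => blkC D κt t s) (fun t => blkD D κt t s) := by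
  have hd : ∀ t, Matrix.J (Fin n) ℝ * effHess D κt t * matriciant D κt t s =
      fromBlocks (-((effHess D κt t).toBlocks₂₁ * blkA D κt t s) -
          (effHess D κt t).toBlocks₂₂ * blkC D κt t s)
        (-((effHess D κt t).toBlocks₂₁ * blkB D κt t s) -
          (effHess D κt t).toBlocks₂₂ * blkD D κt t s)
        ((effHess D κt t).toBlocks₁₁ * blkA D κt t s +
          (effHess D κt t).toBlocks₁₂ * blkC D κt t s)
        ((effHess D κt t).toBlocks₁₁ * blkB D κt t s +
          (effHess D κt t).toBlocks₁₂ * blkD D κt t s) := by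
    intro t
    conv_lhs => rw [← fromBlocks_blk, ← Matrix.fromBlocks_toBlocks (effHess D κt t), Matrix.J,
      Matrix.fromBlocks_multiply, Matrix.fromBlocks_multiply]
    congr 1 <;> simp [sub_eq_add_neg]
  have hM := fun t => (hasMDerivAt_matriciant hD κt s t).congr_deriv (hd t)
  exact ⟨fun t => effHess_isSymm hS κt t, continuous_effHess hD κt,
    fun t => isSympl_blk hD hS κt t s, fun t i j => hM t (Sum.inl i) (Sum.inl j),
    fun t i j => hM t (Sum.inl i) (Sum.inr j), fun t i j => hM t (Sum.inr i) (Sum.inl j),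
    fun t i j => hM t (Sum.inr i) (Sum.inr j)⟩

lemma lam3Reg_eq (D : Coeffs n) (κt ε t s : ℝ) :
    lam3Reg D κt ε t s = (frameM (blkC D κt t s) (blkD D κt t s) ε)ᵀ := by
  ext i j
  simp [lam3Reg, frameM, lam3, lam1]

lemma lam4Reg_eq (D : Coeffs n) (κt ε t s : ℝ) :
    lam4Reg D κt ε t s = (frameL (blkA D κt t s) (blkB D κt t s) ε)ᵀ := by
  ext i j
  simp [lam4Reg, frameL, lam4, lam2, sub_eq_add_neg]

lemma lam1_eq (D : Coeffs n) (κt t s : ℝ) : cplx (lam1 D κt t s) = (cplx (blkD D κt t s))ᵀ := rfl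

/-! ### The root of the determinant -/

lemma detReg_eq (D : Coeffs n) (ħ κt ε t s : ℝ) : detReg D ħ κt ε t s =
    (-Complex.I * 2 * Real.pi * ħ) ^ n * (frameM (blkC D κt t s) (blkD D κt t s) ε).det := by
  rw [detReg, lam3Reg_eq, Matrix.det_smul, Matrix.det_transpose, Fintype.card_fin]

lemma detReg_ne_zero (hD : D.IsContinuous) (hS : D.IsSymmetric) {ħ ε : ℝ} (hħ : 0 < ħ)
    (hε : 0 < ε) (κt t s : ℝ) : detReg D ħ κt ε t s ≠ 0 := by
  have hħ' : (ħ : ℂ) ≠ 0 := by exact_mod_cast hħ.ne'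
  have hπ : (Real.pi : ℂ) ≠ 0 := by exact_mod_cast Real.pi_ne_zero
  rw [detReg_eq]
  exact mul_ne_zero (pow_ne_zero _ (by simp [hħ', hπ]))
    ((isSympl_blk hD hS κt t s).frameM_det_ne_zero hε.ne')

lemma detReg_self (hD : D.IsContinuous) (ħ κt ε s : ℝ) :
    detReg D ħ κt ε s s = (((2 * Real.pi * ħ * ε) ^ n : ℝ) : ℂ) := by
  obtain ⟨-, -, h3, h4⟩ := blk_self hD κt s
  rw [detReg_eq, h3, h4, frameM_one, Matrix.det_smul, Matrix.det_one, Fintype.card_fin, mul_one,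
    ← mul_pow]
  push_cast
  congr 1
  linear_combination (-2 * (Real.pi : ℂ) * ħ * ε) * Complex.I_sq

/-- The rate `½ tr (𝔥_pp Γ + 𝔥_px)` along the flow. -/
def flowRate (D : Coeffs n) (κt ε t s : ℝ) : ℂ :=
  rootRate (effHess D κt t)
    (frameG (blkA D κt t s) (blkB D κt t s) (blkC D κt t s) (blkD D κt t s) ε)

lemma continuous_flowRate (hD : D.IsContinuous) (hS : D.IsSymmetric) {ε : ℝ} (hε : 0 < ε)
    (κt s : ℝ) : Continuous fun t => flowRate D κt ε t s :=
  (blockFlow_matriciant hD hS κt s).continuous_rootRate hε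

/-- The frame satisfies Ṁ = (𝔥_pp Γ + 𝔥_px)M, so Jacobi's formula gives det M times the trace of the
bracket, which is twice the rate of the root. -/
lemma hasDerivAt_detReg (hD : D.IsContinuous) (hS : D.IsSymmetric) {ε : ℝ} (hε : 0 < ε)
    (ħ κt t s : ℝ) : HasDerivAt (fun t => detReg D ħ κt ε t s)
      (detReg D ħ κt ε t s * (2 * flowRate D κt ε t s)) t := by
  have hf := blockFlow_matriciant hD hS κt s
  have hd := ((hf.hasMDerivAt_frameM ε t).det).const_mul ((-Complex.I * 2 * Real.pi * ħ) ^ n)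
  rw [funext fun t => detReg_eq D ħ κt ε t s]
  refine hd.congr_deriv ?_
  have hs := isSympl_blk hD hS κt t s
  rw [flowRate, rootRate, frameG]
  have e : (-(cplx (effHess D κt t).toBlocks₁₁ * frameL (blkA D κt t s) (blkB D κt t s) ε) +
      cplx (effHess D κt t).toBlocks₁₂ * frameM (blkC D κt t s) (blkD D κt t s) ε) =
      (cplx (effHess D κt t).toBlocks₁₁ * -(frameL (blkA D κt t s) (blkB D κt t s) ε *
        (frameM (blkC D κt t s) (blkD D κt t s) ε)⁻¹) + cplx (effHess D κt t).toBlocks₁₂) *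
        frameM (blkC D κt t s) (blkD D κt t s) ε := by
    rw [Matrix.add_mul, Matrix.mul_assoc _ (-_), Matrix.neg_mul, Matrix.mul_assoc,
      hs.frameM_inv_mul hε.ne', Matrix.mul_one, Matrix.mul_neg]
  rw [e, ← Matrix.mul_assoc, Matrix.trace_mul_comm, ← Matrix.mul_assoc, Matrix.mul_adjugate,
    Matrix.smul_mul, Matrix.one_mul, Matrix.trace_smul, smul_eq_mul, detReg_eq]
  ring

lemma logDeriv_detReg (hD : D.IsContinuous) (hS : D.IsSymmetric) {ħ ε : ℝ} (hħ : 0 < ħ)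
    (hε : 0 < ε) (κt t s : ℝ) :
    logDeriv (fun σ => detReg D ħ κt ε σ s) t = 2 * flowRate D κt ε t s := by
  rw [logDeriv_apply, (hasDerivAt_detReg hD hS hε ħ κt t s).deriv,
    mul_div_cancel_left₀ _ (detReg_ne_zero hD hS hħ hε κt t s)]

lemma rootReg_eq (hD : D.IsContinuous) (hS : D.IsSymmetric) {ħ ε : ℝ} (hħ : 0 < ħ)
    (hε : 0 < ε) (κt t s : ℝ) : rootReg D ħ κt ε t s =
      (Real.sqrt ((2 * Real.pi * ħ * ε) ^ n) : ℂ) *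
        Complex.exp (∫ τ in s..t, flowRate D κt ε τ s) := by
  rw [rootReg]
  simp only [logDeriv_detReg hD hS hħ hε]
  rw [intervalIntegral.integral_const_mul]
  congr 2
  ring

lemma sqrt_two_pi_pow_ne_zero {ħ ε : ℝ} (hħ : 0 < ħ) (hε : 0 < ε) :
    (Real.sqrt ((2 * Real.pi * ħ * ε) ^ n) : ℂ) ≠ 0 := by
  have : Real.sqrt ((2 * Real.pi * ħ * ε) ^ n) ≠ 0 := by positivity
  exact_mod_cast this

lemma rootReg_ne_zero {ħ ε : ℝ} (hħ : 0 < ħ) (hε : 0 < ε) (κt t s : ℝ) :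
    rootReg D ħ κt ε t s ≠ 0 :=
  mul_ne_zero (sqrt_two_pi_pow_ne_zero hħ hε) (Complex.exp_ne_zero _)

lemma rootReg_self (D : Coeffs n) (ħ κt ε s : ℝ) :
    rootReg D ħ κt ε s s = (Real.sqrt ((2 * Real.pi * ħ * ε) ^ n) : ℂ) := by
  simp [rootReg]

lemma hasDerivAt_rootReg (hD : D.IsContinuous) (hS : D.IsSymmetric) {ħ ε : ℝ} (hħ : 0 < ħ)
    (hε : 0 < ε) (κt t s : ℝ) : HasDerivAt (fun t => rootReg D ħ κt ε t s)
      (rootReg D ħ κt ε t s * flowRate D κt ε t s) t := by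
  have hc := continuous_flowRate hD hS hε κt s
  have hi : HasDerivAt (fun t => ∫ τ in s..t, flowRate D κt ε τ s) (flowRate D κt ε t s) t :=
    intervalIntegral.integral_hasDerivAt_right (hc.intervalIntegrable _ _)
      hc.aestronglyMeasurable.stronglyMeasurableAtFilter hc.continuousAt
  rw [funext fun t => rootReg_eq hD hS hħ hε κt t s]
  refine (hi.cexp.const_mul _).congr_deriv ?_
  rw [rootReg_eq hD hS hħ hε, mul_assoc (_ : ℂ)]

/-- The quotient of the squared root and the determinant has zero derivative in t and equals one at
t = s. Here it serves to control the modulus of the root as ε → 0⁺. -/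
lemma rootReg_sq (hD : D.IsContinuous) (hS : D.IsSymmetric) {ħ ε : ℝ} (hħ : 0 < ħ)
    (hε : 0 < ε) (κt t s : ℝ) : rootReg D ħ κt ε t s ^ 2 = detReg D ħ κt ε t s := by
  have hdet := detReg_ne_zero hD hS hħ hε κt
  have hd : ∀ t, HasDerivAt (fun t => (rootReg D ħ κt ε t s * rootReg D ħ κt ε t s) *
      (detReg D ħ κt ε t s)⁻¹) 0 t := by
    intro t
    have hr := hasDerivAt_rootReg hD hS hħ hε κt t s
    refine ((hr.fun_mul hr).fun_mul
      ((hasDerivAt_detReg hD hS hε ħ κt t s).fun_inv (hdet t s))).congr_deriv ?_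
    have := hdet t s
    field_simp
    ring
  have h := is_const_of_deriv_eq_zero (fun t => (hd t).differentiableAt) (fun t => (hd t).deriv) t s
  beta_reduce at h
  have hself : rootReg D ħ κt ε s s * rootReg D ħ κt ε s s = detReg D ħ κt ε s s := by
    rw [rootReg_self, detReg_self hD, ← Complex.ofReal_mul, Real.mul_self_sqrt (by positivity)]
  rw [hself, mul_inv_cancel₀ (hdet s s)] at h
  rw [sq]
  exact eq_of_mul_inv_eq_one h

/-! ### The propagator of the linear equation for `ẑ` -/

/-- The Gaussian packet emitted from `y` at time `s`. -/
def wave (D : Coeffs n) (ħ κt ε t s : ℝ) (y x : Conf n) : ℂ :=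
  packet ħ (rootReg D ħ κt ε t s) (blkA D κt t s) (blkB D κt t s) (blkC D κt t s)
    (blkD D κt t s) ε y x

lemma wave_self (hD : D.IsContinuous) {ħ ε : ℝ} (hħ : 0 < ħ) (hε : 0 < ε) (κt s : ℝ)
    (y x : Conf n) : wave D ħ κt ε s s y x = heatAt ħ ε y x := by
  obtain ⟨h1, h2, h3, h4⟩ := blk_self hD κt s
  rw [wave, h1, h2, h3, h4, rootReg_self, packet_one_eq_heatAt hħ hε]

/-- The two packets may be emitted at different times; this freedom is what the composition law of
propagators uses. -/
lemma wave_overlap (hD : D.IsContinuous) (hS : D.IsSymmetric) {ħ ε ε' : ℝ} (hħ : 0 < ħ)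
    (hε : 0 < ε) (hε' : 0 < ε') (κt s s' : ℝ) (y y' : Conf n) (t₁ t₂ : ℝ) :
    ∫ x, star (wave D ħ κt ε t₁ s y x) * wave D ħ κt ε' t₁ s' y' x =
      ∫ x, star (wave D ħ κt ε t₂ s y x) * wave D ħ κt ε' t₂ s' y' x :=
  overlap_conserved (blockFlow_matriciant hD hS κt s) (blockFlow_matriciant hD hS κt s') hε hε' hħ
    (fun t => hasDerivAt_rootReg hD hS hħ hε κt t s) (fun t => rootReg_ne_zero hħ hε κt t s)
    (fun t => hasDerivAt_rootReg hD hS hħ hε' κt t s') (fun t => rootReg_ne_zero hħ hε' κt t s')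
    y y' t₁ t₂

/-- `T` is the unitary operator over the matriciant which takes Gaussians to packets. -/
structure IsPropagator (D : Coeffs n) (ħ κt t s : ℝ) (T : 𝓢(Conf n, ℂ) →L[ℂ] 𝓢(Conf n, ℂ)) :
    Prop where
  intertwiner : IsIntertwiner ħ T (matriciant D κt t s)
  ip_map : ∀ f g, ip (T f) (T g) = ip f g
  map_heatAt : ∀ ε, 0 < ε → ∀ y x, T (heatAt ħ ε y) x = wave D ħ κt ε t s y x

/-- An intertwining operator T maps each Gaussian to a multiple C(ε, y) of its packet. Since T is an
isometry up to K and packet overlaps are conserved, the conjugate of C(ε, y) times C(ε', y') equals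
K for every pair. Hence C is constant, and dividing T by it fixes modulus and phase at once. -/
lemma exists_isPropagator (hD : D.IsContinuous) (hS : D.IsSymmetric) {ħ : ℝ} (hħ : 0 < ħ)
    (κt t s : ℝ) : ∃ T, IsPropagator D ħ κt t s T := by
  obtain ⟨T, hT⟩ := exists_isIntertwiner hħ (isSympl_blk hD hS κt t s)
  choose C hC using fun (ε : {ε : ℝ // 0 < ε}) (y : Conf n) =>
    hT.heatAt hħ (isSympl_blk hD hS κt t s) ε.2 (rootReg_ne_zero (D := D) hħ ε.2 κt t s) y
  obtain ⟨K, hK, hiso⟩ := hT.isometry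
  have hCC : ∀ ε y ε' y', star (C ε y) * C ε' y' = K := by
    intro ε y ε' y'
    have h1 : ip (T (heatAt ħ ε y)) (T (heatAt ħ ε' y')) =
        star (C ε y) * C ε' y' * ip (heatAt ħ ε y) (heatAt ħ ε' y') := by
      have h2 := wave_overlap hD hS hħ ε.2 ε'.2 κt s s y y' t s
      simp only [wave_self hD hħ ε.2, wave_self hD hħ ε'.2] at h2
      rw [ip, ip, ← h2, ← integral_const_mul]
      congr 1
      funext x
      rw [hC, hC, wave, wave, star_mul']
      ring
    rw [hiso] at h1
    exact (mul_right_cancel₀ (ip_heatAt_heatAt_ne_zero hħ ε.2 ε'.2 y y') h1).symm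
  have hK' : (K : ℂ) ≠ 0 := by exact_mod_cast hK.ne'
  obtain ⟨C₀, hC₀⟩ : ∃ C₀, C₀ = C ⟨1, one_pos⟩ 0 := ⟨_, rfl⟩
  have hsq : star C₀ * C₀ = K := by rw [hC₀]; exact hCC _ _ _ _
  have hC0' : C₀ ≠ 0 := by
    rintro rfl
    rw [mul_zero] at hsq
    exact hK' hsq.symm
  have hall : ∀ ε y, C ε y = C₀ := by
    intro ε y
    have h1 := hCC ⟨1, one_pos⟩ 0 ε y
    rw [← hC₀, ← hsq] at h1
    exact mul_left_cancel₀ (star_ne_zero.2 hC0') h1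
  refine ⟨C₀⁻¹ • T, ?_, fun f g => ?_, fun ε hε y x => ?_⟩
  · rw [← fromBlocks_blk]
    exact hT.smul (inv_ne_zero hC0')
  · rw [_root_.smul_apply, _root_.smul_apply, ip_smul_left, ip_smul_right, hiso, ← hsq, star_inv₀]
    have := star_ne_zero.2 hC0'
    field_simp
  · rw [_root_.smul_apply, _root_.smul_apply, hC ⟨ε, hε⟩ y x, hall, smul_eq_mul,
      inv_mul_cancel_left₀ hC0', wave]

/-- Write Tf - T'f = Tg by surjectivity. Both maps preserve inner products and agree on Gaussians,
so g is orthogonal to all Gaussians and vanishes. -/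
lemma eq_of_isometry_of_heatAt {ħ : ℝ} (hħ : 0 < ħ) {T T' : 𝓢(Conf n, ℂ) →L[ℂ] 𝓢(Conf n, ℂ)}
    (hs : Function.Surjective T) (hT : ∀ f g, ip (T f) (T g) = ip f g)
    (hT' : ∀ f g, ip (T' f) (T' g) = ip f g)
    (h : ∀ ε, 0 < ε → ∀ y, T (heatAt ħ ε y) = T' (heatAt ħ ε y)) : T = T' := by
  ext1 f
  obtain ⟨g, hg⟩ := hs (T f - T' f)
  have hg0 : g = 0 := by
    refine eq_zero_of_ip_heatAt hħ fun ε hε y => ?_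
    rw [← hT, hg, ip_sub_right, hT, h ε hε, hT', sub_self]
  rw [hg0, map_zero] at hg
  exact (sub_eq_zero.1 hg.symm)

/-- The cocycle identity without a sign. By totality it suffices to compare on Gaussians emitted at
s, tested against images under T₁ of Gaussians emitted at r. Conservation of the overlap between
times r and t identifies the two pairings. -/
lemma IsPropagator.comp_eq (hD : D.IsContinuous) (hS : D.IsSymmetric) {ħ : ℝ} (hħ : 0 < ħ)
    {κt t r s : ℝ} {T T₁ T₂ : 𝓢(Conf n, ℂ) →L[ℂ] 𝓢(Conf n, ℂ)} (hT : IsPropagator D ħ κt t s T)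
    (h₁ : IsPropagator D ħ κt t r T₁) (h₂ : IsPropagator D ħ κt r s T₂) : T₁.comp T₂ = T := by
  symm
  refine eq_of_isometry_of_heatAt hħ hT.intertwiner.surj hT.ip_map
    (fun f g => (h₁.ip_map _ _).trans (h₂.ip_map _ _)) fun ε hε y => ?_
  obtain ⟨g, hg⟩ := h₁.intertwiner.surj (T (heatAt ħ ε y) - T₁ (T₂ (heatAt ħ ε y)))
  have hg0 : g = 0 := by
    refine eq_zero_of_ip_heatAt hħ fun δ hδ w => ?_
    have h3 := wave_overlap hD hS hħ hδ hε κt r s w y t r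
    simp only [wave_self hD hħ hδ, ← hT.map_heatAt ε hε, ← h₁.map_heatAt δ hδ,
      ← h₂.map_heatAt ε hε] at h3
    rw [← h₁.ip_map, hg, ip_sub_right, h₁.ip_map, sub_eq_zero]
    exact h3
  rw [hg0, map_zero] at hg
  exact sub_eq_zero.1 hg.symm

lemma IsPropagator.eq_id (hD : D.IsContinuous) {ħ : ℝ} (hħ : 0 < ħ) {κt s : ℝ}
    {T : 𝓢(Conf n, ℂ) →L[ℂ] 𝓢(Conf n, ℂ)} (hT : IsPropagator D ħ κt s s T) (f : 𝓢(Conf n, ℂ)) :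
    T f = f := by
  have h := eq_of_isometry_of_heatAt (T' := ContinuousLinearMap.id ℂ _) hħ hT.intertwiner.surj
    hT.ip_map (fun f g => rfl) (fun ε hε y => by
      ext x
      rw [hT.map_heatAt ε hε, wave_self hD hħ hε]
      rfl)
  rw [h]
  rfl

end

section

variable {n : ℕ} {D : Coeffs n}

/-! ### Integrals of packets -/

lemma continuous_cvec : Continuous (cvec : Conf n → Fin n → ℂ) := by
  unfold cvec; fun_prop

lemma continuous_packet (ħ : ℝ) (r : ℂ) (a b c d : Matrix (Fin n) (Fin n) ℝ) (ε : ℝ) :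
    Continuous fun p : Conf n × Conf n => packet ħ r a b c d ε p.2 p.1 := by
  have h1 : Continuous fun p : Conf n × Conf n => cvec p.1 := continuous_cvec.comp continuous_fst
  have h2 : Continuous fun p : Conf n × Conf n => cvec p.2 := continuous_cvec.comp continuous_snd
  have hq : ∀ (M : Matrix (Fin n) (Fin n) ℂ) {v : Conf n × Conf n → Fin n → ℂ},
      Continuous v → Continuous fun p => M *ᵥ v p := fun M v hv =>
    continuous_const.matrix_mulVec hv
  have hd : ∀ {v w : Conf n × Conf n → Fin n → ℂ}, Continuous v → Continuous w →
      Continuous fun p => v p ⬝ᵥ w p := fun hv hw => hv.dotProduct hw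
  unfold packet gauss quadPhase
  refine (continuous_const.mul ?_).mul ?_
  · exact (continuous_const.mul (continuous_const.mul (hd h2 (hq _ h2)))).cexp
  · exact (continuous_const.mul ((continuous_const.mul (hd h1 (hq _ h1))).add
      (hd (hq _ h2) h1))).cexp

lemma continuous_wave (D : Coeffs n) (ħ κt ε t s : ℝ) :
    Continuous fun p : Conf n × Conf n => wave D ħ κt ε t s p.2 p.1 := continuous_packet _ _ _ _ _ _ _

lemma norm_wave_le (hD : D.IsContinuous) (hS : D.IsSymmetric) {ħ ε : ℝ} (hħ : 0 < ħ) (hε : 0 < ε)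
    (κt t s : ℝ) (y x : Conf n) :
    ‖wave D ħ κt ε t s y x‖ ≤ ‖rootReg D ħ κt ε t s‖⁻¹ :=
  (isSympl_blk hD hS κt t s).norm_packet_le hε.ne' hħ hε _ y x

lemma integrable_kernel_mul {K : Conf n × Conf n → ℂ} (hK : Continuous K) {B : ℝ}
    (hB : ∀ p, ‖K p‖ ≤ B) (f : 𝓢(Conf n, ℂ)) (x : Conf n) : Integrable fun y => K (x, y) * f y :=
  (f.integrable (μ := volume)).bdd_mul (hK.comp (by fun_prop)).aestronglyMeasurable
    (Eventually.of_forall fun y => hB (x, y))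

lemma continuous_integral_kernel {K : Conf n × Conf n → ℂ} (hK : Continuous K) {B : ℝ}
    (hB : ∀ p, ‖K p‖ ≤ B) (f : 𝓢(Conf n, ℂ)) : Continuous fun x => ∫ y, K (x, y) * f y := by
  refine continuous_of_dominated (bound := fun y => B * ‖f y‖)
    (fun x => (integrable_kernel_mul hK hB f x).aestronglyMeasurable)
    (fun x => Eventually.of_forall fun y => ?_) ((f.integrable (μ := volume)).norm.const_mul B)
    (Eventually.of_forall fun y => ?_)
  · rw [norm_mul]
    gcongr
    exact hB _
  · exact (hK.comp (by fun_prop)).mul continuous_const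

lemma integral_kernel_swap {K : Conf n × Conf n → ℂ} (hK : Continuous K) {B : ℝ}
    (hB : ∀ p, ‖K p‖ ≤ B) (φ f : 𝓢(Conf n, ℂ)) :
    ∫ x, star (φ x) * ∫ y, K (x, y) * f y = ∫ y, (∫ x, star (φ x) * K (x, y)) * f y := by
  have hφ : Integrable fun x => star (φ x) := by
    have := (φ.integrable (μ := volume))
    exact (LinearIsometryEquiv.integrable_comp_iff Complex.conjLIE).2 this
  have hint : Integrable (Function.uncurry fun x y => K (x, y) * (star (φ x) * f y))
      ((volume : Measure (Conf n)).prod (volume : Measure (Conf n))) :=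
    (hφ.mul_prod (f.integrable (μ := volume))).bdd_mul (c := B) hK.aestronglyMeasurable
      (Eventually.of_forall hB)
  have h := integral_integral_swap hint
  calc _ = ∫ x, ∫ y, K (x, y) * (star (φ x) * f y) := by
        congr 1; funext x
        rw [← integral_const_mul]
        congr 1; funext y; ring
    _ = _ := h
    _ = _ := by
        congr 1; funext y
        rw [← integral_mul_const]
        congr 1; funext x; ring

/-- Smooth compactly supported functions are among the test functions, so G vanishes almost
everywhere, and everywhere by continuity. -/
lemma eq_zero_of_forall_integral_star_mul {G : Conf n → ℂ} (hG : Continuous G)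
    (h : ∀ φ : 𝓢(Conf n, ℂ), ∫ x, star (φ x) * G x = 0) : G = 0 := by
  have h1 := ae_eq_zero_of_integral_contDiff_smul_eq_zero (μ := volume) hG.locallyIntegrable
    (fun g hg hgs => by
      have hs : HasCompactSupport fun x => (g x : ℂ) := hgs.comp_left (g := Complex.ofReal) rfl
      have := h (hs.toSchwartzMap (Complex.ofRealCLM.contDiff.comp hg))
      rw [← this]
      congr 1; funext x
      change _ = star ((g x : ℝ) : ℂ) * G x
      rw [Complex.star_def, Complex.conj_ofReal, Complex.real_smul])
  exact (Continuous.ae_eq_iff_eq volume hG continuous_const).1 h1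

lemma heatAt_symm {ħ ε : ℝ} (hħ : 0 < ħ) (hε : 0 < ε) (y x : Conf n) :
    heatAt ħ ε y x = heatAt ħ ε x y := by
  rw [heatAt_apply hħ hε, heatAt_apply hħ hε, norm_sub_rev]

/-- The integral against packets is the propagator applied to the smoothed function. -/
lemma IsPropagator.integral_wave (hD : D.IsContinuous) (hS : D.IsSymmetric) {ħ ε : ℝ} (hħ : 0 < ħ)
    (hε : 0 < ε) {κt t s : ℝ} {T : 𝓢(Conf n, ℂ) →L[ℂ] 𝓢(Conf n, ℂ)}
    (hT : IsPropagator D ħ κt t s T) (f : 𝓢(Conf n, ℂ)) (x : Conf n) :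
    ∫ y, wave D ħ κt ε t s y x * f y = T (smoothing ħ ε f) x := by
  have hK := continuous_wave D ħ κt ε t s
  have hB : ∀ p : Conf n × Conf n, ‖wave D ħ κt ε t s p.2 p.1‖ ≤ _ :=
    fun p => norm_wave_le hD hS hħ hε κt t s p.2 p.1
  have hK₀ := continuous_wave D ħ κt ε s s
  have hB₀ : ∀ p : Conf n × Conf n, ‖wave D ħ κt ε s s p.2 p.1‖ ≤ _ :=
    fun p => norm_wave_le hD hS hħ hε κt s s p.2 p.1
  have hc := continuous_integral_kernel hK hB f
  have hint : ∀ φ : 𝓢(Conf n, ℂ), Integrable fun x =>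
      star (φ x) * ∫ y, wave D ħ κt ε t s y x * f y := by
    intro φ
    have hb : ∀ x, ‖∫ y, wave D ħ κt ε t s y x * f y‖ ≤
        ∫ y, ‖rootReg D ħ κt ε t s‖⁻¹ * ‖f y‖ := by
      intro x
      refine norm_integral_le_of_norm_le ((f.integrable (μ := volume)).norm.const_mul _)
        (Eventually.of_forall fun y => ?_)
      rw [norm_mul]
      gcongr
      exact hB (x, y)
    have hφ : Integrable fun x => star (φ x) :=
      (LinearIsometryEquiv.integrable_comp_iff Complex.conjLIE).2 (φ.integrable (μ := volume))
    exact hφ.mul_bdd hc.aestronglyMeasurable (Eventually.of_forall hb)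
  have key := eq_zero_of_forall_integral_star_mul
    (G := fun x => (∫ y, wave D ħ κt ε t s y x * f y) - T (smoothing ħ ε f) x)
    (hc.sub (T (smoothing ħ ε f)).continuous) (fun φ => by
      -- Testing only against functions in the image of T lets the isometry pull the pairing back to
      -- time s.
      obtain ⟨φ, rfl⟩ := hT.intertwiner.surj φ
      simp only [mul_sub]
      rw [integral_sub (hint _) (integrable_star_mul _ _), sub_eq_zero]
      change _ = ip (T φ) (T (smoothing ħ ε f))
      rw [hT.ip_map, integral_kernel_swap hK hB (T φ) f]
      -- After Fubini the inner integral is a pairing with a packet; at time s the packet is the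
      -- heat kernel, and Fubini in reverse recovers the convolution.
      have e1 : ∀ y, ∫ x, star (T φ x) * wave D ħ κt ε t s y x =
          ∫ x, star (φ x) * wave D ħ κt ε s s y x := by
        intro y
        have := hT.ip_map φ (heatAt ħ ε y)
        simp only [ip, hT.map_heatAt ε hε] at this
        simpa only [wave_self hD hħ hε] using this
      simp only [e1]
      rw [← integral_kernel_swap hK₀ hB₀ φ f, ip]
      congr 1; funext x
      rw [smoothing_apply hħ hε]
      congr 2; funext y
      simp only [wave_self hD hħ hε]
      rw [heatAt_symm hħ hε])
  exact sub_eq_zero.1 (congrFun key x)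

lemma IsPropagator.tendsto_integral_wave (hD : D.IsContinuous) (hS : D.IsSymmetric) {ħ : ℝ}
    (hħ : 0 < ħ) {κt t s : ℝ} {T : 𝓢(Conf n, ℂ) →L[ℂ] 𝓢(Conf n, ℂ)}
    (hT : IsPropagator D ħ κt t s T) (f : 𝓢(Conf n, ℂ)) (x : Conf n) :
    Tendsto (fun ε => ∫ y, wave D ħ κt ε t s y x * f y) (𝓝[>] 0) (𝓝 (T f x)) := by
  have h1 : Tendsto (fun ε => T (smoothing ħ ε f) x) (𝓝[>] 0) (𝓝 (T f x)) :=
    (((continuous_schwartz_eval x).comp T.continuous).tendsto f).comp (tendsto_smoothing hħ f)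
  refine h1.congr' ?_
  filter_upwards [self_mem_nhdsWithin] with ε hε
  exact (hT.integral_wave hD hS hħ hε f x).symm

/-! ### The Green function away from caustics -/

lemma continuous_frameM_param (c d : Matrix (Fin n) (Fin n) ℝ) :
    Continuous fun ε => frameM c d ε := by
  unfold frameM
  exact continuous_const.add ((continuous_const.mul Complex.continuous_ofReal).smul continuous_const)

lemma continuous_frameL_param (a b : Matrix (Fin n) (Fin n) ℝ) :
    Continuous fun ε => frameL a b ε := by
  unfold frameL
  exact continuous_const.sub ((continuous_const.mul Complex.continuous_ofReal).smul continuous_const)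

lemma tendsto_packet_one (ħ : ℝ) (a b c d : Matrix (Fin n) (Fin n) ℝ)
    (h0 : (frameM c d 0).det ≠ 0) (y x : Conf n) :
    Tendsto (fun ε => packet ħ 1 a b c d ε y x) (𝓝 0) (𝓝 (packet ħ 1 a b c d 0 y x)) := by
  have hM := (continuous_frameM_param c d).continuousAt (x := 0)
  have hI : ContinuousAt (fun ε => (frameM c d ε)⁻¹) 0 := by
    have : ContinuousAt (Inv.inv : Matrix (Fin n) (Fin n) ℂ → _) (frameM c d 0) := by
      refine continuousAt_matrix_inv _ ?_
      rw [Ring.inverse_eq_inv']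
      exact continuousAt_inv₀ h0
    exact this.comp hM
  have hL := (continuous_frameL_param a b).continuousAt (x := 0)
  have hmul : ∀ {M N : ℝ → Matrix (Fin n) (Fin n) ℂ}, ContinuousAt M 0 → ContinuousAt N 0 →
      ContinuousAt (fun ε => M ε * N ε) 0 := fun hM hN =>
    (Continuous.matrix_mul continuous_fst continuous_snd).continuousAt.comp (hM.prodMk hN)
  have hG : ContinuousAt (fun ε => frameG a b c d ε) 0 := (hmul hL hI).neg
  have hq : ∀ {M : ℝ → Matrix (Fin n) (Fin n) ℂ} (v w : Fin n → ℂ), ContinuousAt M 0 →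
      ContinuousAt (fun ε => v ⬝ᵥ (M ε *ᵥ w)) 0 := fun v w hM =>
    (Continuous.dotProduct continuous_const
      (Continuous.matrix_mulVec continuous_id continuous_const)).continuousAt.comp hM
  have hT : ContinuousAt (fun ε => (frameM c d ε)⁻¹ᵀ) 0 :=
    (continuous_id.matrix_transpose).continuousAt.comp hI
  unfold packet gauss quadPhase
  simp only [dotProduct_comm _ (cvec x)]
  exact ((continuousAt_const.mul ((continuousAt_const.mul (continuousAt_const.mul
    (hq _ _ (hmul hI continuousAt_const)))).cexp)).mul ((continuousAt_const.mul
    ((continuousAt_const.mul (hq _ _ hG)).add (hq _ _ hT))).cexp)).tendsto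

lemma packet_eq_inv_mul (ħ : ℝ) (r : ℂ) (a b c d : Matrix (Fin n) (Fin n) ℝ) (ε : ℝ)
    (y x : Conf n) : packet ħ r a b c d ε y x = r⁻¹ * packet ħ 1 a b c d ε y x := by
  simp only [packet, inv_one, one_mul, mul_assoc]

lemma frameM_zero (D : Coeffs n) (κt t s : ℝ) :
    frameM (blkC D κt t s) (blkD D κt t s) 0 = (cplx (lam3 D κt t s))ᵀ := by
  ext i j
  simp [frameM, lam3]

lemma det_frameM_zero (D : Coeffs n) (κt t s : ℝ) (h : (lam3 D κt t s).det ≠ 0) :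
    (frameM (blkC D κt t s) (blkD D κt t s) 0).det ≠ 0 := by
  rw [frameM_zero, Matrix.det_transpose, cplx_det]
  exact_mod_cast h

/-- Away from caustics the propagator is given by a Green function. -/
lemma IsPropagator.integral_green (hD : D.IsContinuous) (hS : D.IsSymmetric) {ħ : ℝ}
    (hħ : 0 < ħ) {κt t s : ℝ} {T : 𝓢(Conf n, ℂ) →L[ℂ] 𝓢(Conf n, ℂ)}
    (hT : IsPropagator D ħ κt t s T) (hdet : (lam3 D κt t s).det ≠ 0) (f : 𝓢(Conf n, ℂ))
    (x : Conf n) :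
    ∫ y, packet ħ (root D ħ κt t s) (blkA D κt t s) (blkB D κt t s) (blkC D κt t s)
      (blkD D κt t s) 0 y x * f y = T f x := by
  have h0 := det_frameM_zero D κt t s hdet
  -- The root is split off from the integral. The rest converges by dominated convergence, while
  -- convergence of the root has to be derived.
  obtain ⟨E, hE⟩ : ∃ E : ℝ → 𝓢(Conf n, ℂ) → Conf n → ℂ, E = fun ε f x =>
    ∫ y, packet ħ 1 (blkA D κt t s) (blkB D κt t s) (blkC D κt t s) (blkD D κt t s) ε y x * f y :=
    ⟨_, rfl⟩
  have hElim : ∀ f x, Tendsto (fun ε => E ε f x) (𝓝[>] 0) (𝓝 (E 0 f x)) := by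
    intro f x
    rw [hE]
    refine tendsto_integral_filter_of_dominated_convergence (fun y => ‖f y‖) ?_ ?_
      (f.integrable (μ := volume)).norm (Eventually.of_forall fun y => ?_)
    · refine Eventually.of_forall fun ε => ?_
      exact (((continuous_packet ħ 1 _ _ _ _ ε).comp (by fun_prop :
        Continuous fun y : Conf n => (x, y))).mul f.continuous).aestronglyMeasurable
    · filter_upwards [self_mem_nhdsWithin] with ε hε
      refine Eventually.of_forall fun y => ?_
      rw [norm_mul]
      have := (isSympl_blk hD hS κt t s).norm_packet_le (ne_of_gt hε) hħ hε 1 y x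
      rw [norm_one, inv_one] at this
      exact mul_le_of_le_one_left (norm_nonneg _) this
    · exact ((tendsto_packet_one ħ _ _ _ _ h0 y x).mono_left nhdsWithin_le_nhds).mul_const _
  have hW : ∀ f x, Tendsto (fun ε => (rootReg D ħ κt ε t s)⁻¹ * E ε f x) (𝓝[>] 0)
      (𝓝 (T f x)) := by
    intro f x
    refine (hT.tendsto_integral_wave hD hS hħ f x).congr fun ε => ?_
    rw [hE]
    beta_reduce
    rw [← integral_const_mul]
    congr 1; funext y
    rw [wave, packet_eq_inv_mul, mul_assoc]
  -- A state whose image is nonzero at the origin serves as a probe for the limit of the root.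
  obtain ⟨f₀, hf₀⟩ := hT.intertwiner.surj (heatAt ħ 1 0)
  have hne : T f₀ 0 ≠ 0 := by
    rw [hf₀, heatAt_apply hħ one_pos]
    exact mul_ne_zero (inv_ne_zero (sqrt_two_pi_pow_ne_zero hħ one_pos)) (Complex.exp_ne_zero _)
  have hnorm : Tendsto (fun ε => ‖rootReg D ħ κt ε t s‖ ^ 2) (𝓝[>] 0)
      (𝓝 ‖(-Complex.I * 2 * Real.pi * ħ) ^ n *
        (frameM (blkC D κt t s) (blkD D κt t s) 0).det‖) := by
    have hc : Continuous fun ε => ‖(-Complex.I * 2 * Real.pi * ħ) ^ n *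
        (frameM (blkC D κt t s) (blkD D κt t s) ε).det‖ :=
      (continuous_const.mul (continuous_frameM_param _ _).matrix_det).norm
    refine ((hc.tendsto 0).mono_left nhdsWithin_le_nhds).congr' ?_
    filter_upwards [self_mem_nhdsWithin] with ε hε
    rw [← norm_pow, rootReg_sq hD hS hħ hε, detReg_eq]
  have hpos : ‖(-Complex.I * 2 * Real.pi * ħ) ^ n *
      (frameM (blkC D κt t s) (blkD D κt t s) 0).det‖ ≠ 0 := by
    have hħ' : (ħ : ℂ) ≠ 0 := by exact_mod_cast hħ.ne'
    have hπ : (Real.pi : ℂ) ≠ 0 := by exact_mod_cast Real.pi_ne_zero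
    exact norm_ne_zero_iff.2 (mul_ne_zero (pow_ne_zero _ (by simp [hħ', hπ])) h0)
  -- The modulus of the root has a finite nonzero limit, read off from the determinant. If the
  -- limiting integral vanished, so would the image of the probe at the origin.
  have hE0 : E 0 f₀ 0 ≠ 0 := by
    intro h
    have h1 := ((hElim f₀ 0).norm.pow 2)
    have h2 := hnorm.mul ((hW f₀ 0).norm.pow 2)
    have h3 : Tendsto (fun ε => ‖E ε f₀ 0‖ ^ 2) (𝓝[>] 0) _ := h2.congr' (by
      filter_upwards [self_mem_nhdsWithin] with ε hε
      have := norm_ne_zero_iff.2 (rootReg_ne_zero (D := D) hħ hε κt t s)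
      rw [norm_mul, norm_inv]
      field_simp)
    have h4 := tendsto_nhds_unique h1 h3
    rw [h, norm_zero, zero_pow two_ne_zero, eq_comm] at h4
    exact mul_ne_zero hpos (pow_ne_zero _ (norm_ne_zero_iff.2 hne)) h4
  -- Hence the reciprocal root converges as a quotient of convergent quantities, so the branch is
  -- selected without following the argument of the determinant. This makes the `limUnder` in `root`
  -- a genuine limit.
  have hinv : Tendsto (fun ε => (rootReg D ħ κt ε t s)⁻¹) (𝓝[>] 0)
      (𝓝 (T f₀ 0 / E 0 f₀ 0)) := by
    refine ((hW f₀ 0).div (hElim f₀ 0) hE0).congr' ?_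
    filter_upwards [(hElim f₀ 0).eventually_ne hE0] with ε hε
    exact mul_div_cancel_right₀ _ hε
  have hroot : root D ħ κt t s = (T f₀ 0 / E 0 f₀ 0)⁻¹ := by
    refine Tendsto.limUnder_eq ?_
    have := hinv.inv₀ (div_ne_zero hne hE0)
    simpa only [inv_inv] using this
  have hfin := tendsto_nhds_unique (hW f x) (hinv.mul (hElim f x))
  have hE0x : E 0 f x = ∫ y, packet ħ 1 (blkA D κt t s) (blkB D κt t s) (blkC D κt t s)
      (blkD D κt t s) 0 y x * f y := by rw [hE]
  rw [hfin, hE0x, ← integral_const_mul]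
  congr 1; funext y
  rw [packet_eq_inv_mul, hroot, inv_inv, mul_assoc]

end

section

variable {n : ℕ} {D : Coeffs n}

/-! ### Phase-space shifts -/

/-- The plane wave `exp (i⟨P, x⟩/ħ)`. -/
def planeWave (ħ : ℝ) (P : Fin n → ℝ) (x : Conf n) : ℂ :=
  Complex.exp ((1 / ħ * ∑ j, P j * x j : ℝ) * Complex.I)

lemma hasTemperateGrowth_planeWave (ħ : ℝ) (P : Fin n → ℝ) :
    Function.HasTemperateGrowth (planeWave ħ P) := by
  refine hasTemperateGrowth_cexp_I.comp ?_
  exact (Function.HasTemperateGrowth.const (1 / ħ)).mul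
    (Function.HasTemperateGrowth.sum fun j _ => (Function.HasTemperateGrowth.const (P j)).mul
      (EuclideanSpace.proj (𝕜 := ℝ) j).hasTemperateGrowth)

lemma norm_planeWave (ħ : ℝ) (P : Fin n → ℝ) (x : Conf n) : ‖planeWave ħ P x‖ = 1 :=
  Complex.norm_exp_ofReal_mul_I _

lemma planeWave_mul_neg (ħ : ℝ) (P : Fin n → ℝ) (x : Conf n) :
    planeWave ħ P x * planeWave ħ (-P) x = 1 := by
  rw [planeWave, planeWave, ← Complex.exp_add, ← add_mul, ← Complex.ofReal_add]
  simp

/-- The configuration part of a point of phase space. -/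
def posOf (z : PhaseIdx n → ℝ) : Conf n := WithLp.toLp 2 fun j => z (Sum.inr j)

/-- The momentum part of a point of phase space. -/
def momOf (z : PhaseIdx n → ℝ) : Fin n → ℝ := fun j => z (Sum.inl j)

/-- The shift by `z` in phase space. -/
def weyl (ħ : ℝ) (z : PhaseIdx n → ℝ) : 𝓢(Conf n, ℂ) →L[ℂ] 𝓢(Conf n, ℂ) :=
  (SchwartzMap.compSubConstCLM ℂ (posOf z)).comp
    (SchwartzMap.smulLeftCLM ℂ (planeWave ħ (momOf z)))

/-- The inverse of the shift by `z` in phase space. -/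
def weylInv (ħ : ℝ) (z : PhaseIdx n → ℝ) : 𝓢(Conf n, ℂ) →L[ℂ] 𝓢(Conf n, ℂ) :=
  (SchwartzMap.smulLeftCLM ℂ (planeWave ħ (-momOf z))).comp
    (SchwartzMap.compSubConstCLM ℂ (-posOf z))

lemma weyl_apply (ħ : ℝ) (z : PhaseIdx n → ℝ) (f : 𝓢(Conf n, ℂ)) (x : Conf n) :
    weyl ħ z f x = planeWave ħ (momOf z) (x - posOf z) * f (x - posOf z) := by
  change SchwartzMap.smulLeftCLM ℂ (planeWave ħ (momOf z)) f (x - posOf z) = _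
  rw [SchwartzMap.smulLeftCLM_apply_apply (hasTemperateGrowth_planeWave _ _), smul_eq_mul]

lemma weylInv_apply (ħ : ℝ) (z : PhaseIdx n → ℝ) (f : 𝓢(Conf n, ℂ)) (x : Conf n) :
    weylInv ħ z f x = planeWave ħ (-momOf z) x * f (x + posOf z) := by
  change SchwartzMap.smulLeftCLM ℂ (planeWave ħ (-momOf z))
    (SchwartzMap.compSubConstCLM ℂ (-posOf z) f) x = _
  rw [SchwartzMap.smulLeftCLM_apply_apply (hasTemperateGrowth_planeWave _ _), smul_eq_mul]
  change _ * f (x - -posOf z) = _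
  rw [sub_neg_eq_add]

lemma weyl_weylInv (ħ : ℝ) (z : PhaseIdx n → ℝ) (f : 𝓢(Conf n, ℂ)) :
    weyl ħ z (weylInv ħ z f) = f := by
  ext x
  rw [weyl_apply, weylInv_apply, ← mul_assoc, planeWave_mul_neg, one_mul, sub_add_cancel]

lemma weylInv_weyl (ħ : ℝ) (z : PhaseIdx n → ℝ) (f : 𝓢(Conf n, ℂ)) :
    weylInv ħ z (weyl ħ z f) = f := by
  ext x
  rw [weylInv_apply, weyl_apply, add_sub_cancel_right, ← mul_assoc,
    mul_comm (planeWave ħ (-momOf z) x), planeWave_mul_neg, one_mul]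

lemma ip_weyl (ħ : ℝ) (z : PhaseIdx n → ℝ) (f g : 𝓢(Conf n, ℂ)) :
    ip (weyl ħ z f) (weyl ħ z g) = ip f g := by
  rw [ip, ip, ← integral_sub_right_eq_self (fun x => star (f x) * g x) (posOf z)]
  congr 1; funext x
  rw [weyl_apply, weyl_apply, star_mul']
  have h : star (planeWave ħ (momOf z) (x - posOf z)) * planeWave ħ (momOf z) (x - posOf z) = 1 := by
    rw [Complex.star_def, ← Complex.normSq_eq_conj_mul_self, Complex.normSq_eq_norm_sq,
      norm_planeWave]
    simp
  linear_combination (star (f (x - posOf z)) * g (x - posOf z)) * h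

lemma hasFDerivAt_planeWave (ħ : ℝ) (P : Fin n → ℝ) (x : Conf n) :
    HasFDerivAt (planeWave ħ P) ((Complex.I / ħ * planeWave ħ P x) •
      ∑ j, (P j : ℂ) • coordCLM j) x := by
  have h0 : planeWave ħ P = gauss ħ 0 (fun j => (P j : ℂ)) := by
    funext x
    rw [planeWave, gauss, quadPhase, Matrix.zero_mulVec, dotProduct_zero, mul_zero, zero_add]
    congr 1
    simp only [dotProduct, cvec]
    push_cast
    ring
  rw [h0]
  have := hasFDerivAt_gauss ħ (Matrix.isSymm_zero) (fun j => (P j : ℂ)) x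
  simpa only [Matrix.zero_mulVec, zero_add] using this

/-- Translation displaces x by X, and differentiating the plane wave adds P to the momentum. -/
lemma zS_weyl {ħ : ℝ} (hħ : 0 < ħ) (z : PhaseIdx n → ℝ) (k : PhaseIdx n) (f : 𝓢(Conf n, ℂ)) :
    zS ħ k (weyl ħ z f) = weyl ħ z (zS ħ k f + (z k : ℂ) • f) := by
  have hħ' : (ħ : ℂ) ≠ 0 := by exact_mod_cast hħ.ne'
  ext x
  rw [weyl_apply, _root_.add_apply, _root_.smul_apply, smul_eq_mul]
  cases k with
  | inr j =>
    rw [zS_inr_apply, zS_inr_apply, weyl_apply]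
    have : ((x - posOf z) j : ℂ) = x j - z (Sum.inr j) := by simp [posOf]
    rw [this]
    ring
  | inl j =>
    have h1 := ((hasFDerivAt_planeWave ħ (momOf z) (x - posOf z)).fun_mul
      (f.hasFDerivAt (x - posOf z))).comp x ((hasFDerivAt_id x).sub_const (posOf z))
    have h2 : (fun x => planeWave ħ (momOf z) x * f x) ∘ (fun x => id x - posOf z) =
        weyl ħ z f := by
      funext x
      rw [weyl_apply]; rfl
    rw [h2] at h1
    rw [zS_inl_apply, zS_inl_apply, h1.fderiv, ContinuousLinearMap.comp_id, _root_.add_apply,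
      _root_.smul_apply, _root_.smul_apply, _root_.smul_apply, sum_coordCLM_single]
    simp only [smul_eq_mul, momOf]
    field_simp
    ring_nf
    rw [Complex.I_sq]
    ring

/-- The centred operators `ẑ - z`. -/
def dS (ħ : ℝ) (z : PhaseIdx n → ℝ) (k : PhaseIdx n) (f : 𝓢(Conf n, ℂ)) : 𝓢(Conf n, ℂ) :=
  zS ħ k f - (z k : ℂ) • f

lemma coe_dS (ħ : ℝ) (z : PhaseIdx n → ℝ) (k : PhaseIdx n) (f : 𝓢(Conf n, ℂ)) :
    ⇑(dS ħ z k f) = dzOp ħ z k f := by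
  funext x
  rw [dS, _root_.sub_apply, _root_.smul_apply, smul_eq_mul, dzOp, ← coe_zS]

lemma dS_weyl {ħ : ℝ} (hħ : 0 < ħ) (z : PhaseIdx n → ℝ) (k : PhaseIdx n) (f : 𝓢(Conf n, ℂ)) :
    dS ħ z k (weyl ħ z f) = weyl ħ z (zS ħ k f) := by
  rw [dS, zS_weyl hħ, map_add, map_smul, add_sub_cancel_right]

lemma zS_weylInv {ħ : ℝ} (hħ : 0 < ħ) (z : PhaseIdx n → ℝ) (k : PhaseIdx n) (f : 𝓢(Conf n, ℂ)) :
    zS ħ k (weylInv ħ z f) = weylInv ħ z (dS ħ z k f) := by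
  have h := dS_weyl hħ z k (weylInv ħ z f)
  rw [weyl_weylInv] at h
  rw [h, weylInv_weyl]

lemma dS_smul (ħ : ℝ) (z : PhaseIdx n → ℝ) (k : PhaseIdx n) (c : ℂ) (f : 𝓢(Conf n, ℂ)) :
    dS ħ z k (c • f) = c • dS ħ z k f := by
  rw [dS, dS, map_smul, smul_sub, smul_comm]

lemma dS_sum_smul {ι : Type*} (s : Finset ι) (ħ : ℝ) (z : PhaseIdx n → ℝ) (k : PhaseIdx n)
    (c : ι → ℂ) (f : ι → 𝓢(Conf n, ℂ)) :
    dS ħ z k (∑ i ∈ s, c i • f i) = ∑ i ∈ s, c i • dS ħ z k (f i) := by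
  simp only [dS, map_sum, map_smul, Finset.smul_sum, smul_sub, Finset.sum_sub_distrib]
  congr 1
  exact Finset.sum_congr rfl fun i _ => smul_comm _ _ _

/-! ### The evolution operator along a curve -/

/-- The operator `e^{iS/ħ} W(z_t) T W(z_s)⁻¹`, with the phase-space shifts `W`. -/
def evoCLM (ħ S : ℝ) (zt zs : PhaseIdx n → ℝ) (T : 𝓢(Conf n, ℂ) →L[ℂ] 𝓢(Conf n, ℂ)) :
    𝓢(Conf n, ℂ) →L[ℂ] 𝓢(Conf n, ℂ) :=
  Complex.exp (Complex.I / ħ * S) • (weyl ħ zt).comp (T.comp (weylInv ħ zs))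

lemma evoCLM_apply (ħ S : ℝ) (zt zs : PhaseIdx n → ℝ) (T : 𝓢(Conf n, ℂ) →L[ℂ] 𝓢(Conf n, ℂ))
    (f : 𝓢(Conf n, ℂ)) : evoCLM ħ S zt zs T f =
      Complex.exp (Complex.I / ħ * S) • weyl ħ zt (T (weylInv ħ zs f)) := rfl

/-- The shifts at the common intermediate point cancel and the phases multiply. This reduces the
flow property to the composition of propagators and the additivity of the action. -/
lemma evoCLM_evoCLM (ħ S S' : ℝ) (zt zr zs : PhaseIdx n → ℝ)
    (T T' : 𝓢(Conf n, ℂ) →L[ℂ] 𝓢(Conf n, ℂ)) (f : 𝓢(Conf n, ℂ)) :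
    evoCLM ħ S zt zr T (evoCLM ħ S' zr zs T' f) = evoCLM ħ (S + S') zt zs (T.comp T') f := by
  rw [evoCLM_apply, evoCLM_apply, evoCLM_apply, map_smul, map_smul, map_smul, weylInv_weyl,
    smul_smul, ← Complex.exp_add, ContinuousLinearMap.comp_apply, Complex.ofReal_add, mul_add]

lemma ip_weylInv (ħ : ℝ) (z : PhaseIdx n → ℝ) (f g : 𝓢(Conf n, ℂ)) :
    ip (weylInv ħ z f) (weylInv ħ z g) = ip f g := by
  rw [← ip_weyl ħ z, weyl_weylInv, weyl_weylInv]

lemma ip_evoCLM (ħ S : ℝ) (zt zs : PhaseIdx n → ℝ) {T : 𝓢(Conf n, ℂ) →L[ℂ] 𝓢(Conf n, ℂ)}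
    (hT : ∀ f g, ip (T f) (T g) = ip f g) (f g : 𝓢(Conf n, ℂ)) :
    ip (evoCLM ħ S zt zs T f) (evoCLM ħ S zt zs T g) = ip f g := by
  rw [evoCLM_apply, evoCLM_apply, ip_smul_left, ip_smul_right, ip_weyl, hT, ip_weylInv,
    ← mul_assoc]
  have h : star (Complex.exp (Complex.I / ħ * S)) * Complex.exp (Complex.I / ħ * S) = 1 := by
    have e : Complex.I / (ħ : ℂ) * S = ((S / ħ : ℝ) : ℂ) * Complex.I := by push_cast; ring
    rw [Complex.star_def, ← Complex.normSq_eq_conj_mul_self, Complex.normSq_eq_norm_sq, e,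
      Complex.norm_exp_ofReal_mul_I]
    simp
  rw [h, one_mul]

/-- Conjugation by the shifts turns ẑ into centred operators at both ends, so the centred operators
are carried by A alone. -/
lemma dS_evoCLM {ħ : ℝ} (hħ : 0 < ħ) (S : ℝ) (zt zs : PhaseIdx n → ℝ)
    {T : 𝓢(Conf n, ℂ) →L[ℂ] 𝓢(Conf n, ℂ)} {A : Matrix (PhaseIdx n) (PhaseIdx n) ℝ}
    (hT : IsIntertwiner ħ T A) (k : PhaseIdx n) (f : 𝓢(Conf n, ℂ)) :
    dS ħ zt k (evoCLM ħ S zt zs T f) =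
      evoCLM ħ S zt zs T (∑ l, (A k l : ℂ) • dS ħ zs l f) := by
  have h1 : ∑ l, (A k l : ℂ) • zS ħ l (weylInv ħ zs f) =
      weylInv ħ zs (∑ l, (A k l : ℂ) • dS ħ zs l f) := by
    rw [map_sum]
    exact Finset.sum_congr rfl fun l _ => by rw [zS_weylInv hħ, map_smul]
  rw [evoCLM_apply, evoCLM_apply, dS_smul, dS_weyl hħ, hT.zS_map, h1]

/-! ### Transport of the moments -/

lemma mean_eq {A : (Conf n → ℂ) → Conf n → ℂ} {ψ g : 𝓢(Conf n, ℂ)} (h : A ψ = g) :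
    mean A ψ = (ip ψ g).re / normSq ψ := by
  rw [mean, h]; rfl

lemma normSq_pos {ψ : 𝓢(Conf n, ℂ)} (hψ : ψ ≠ 0) : 0 < normSq ψ := by
  refine lt_of_le_of_ne (integral_nonneg fun x => by positivity) fun h => hψ ?_
  apply eq_zero_of_ip_self
  rw [ip_self, ← h, Complex.ofReal_zero]

lemma meanZ_eq (ħ : ℝ) (ψ : 𝓢(Conf n, ℂ)) (k : PhaseIdx n) :
    meanZ ħ ψ k = (ip ψ (zS ħ k ψ)).re / normSq ψ := mean_eq (coe_zS ħ k ψ).symm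

lemma re_ip_dS {ħ : ℝ} {ψ : 𝓢(Conf n, ℂ)} (hψ : ψ ≠ 0) (z : PhaseIdx n → ℝ) (k : PhaseIdx n) :
    (ip ψ (dS ħ z k ψ)).re = (meanZ ħ ψ k - z k) * normSq ψ := by
  have h := (normSq_pos hψ).ne'
  rw [dS, ip_sub_right, ip_smul_right, ip_self, meanZ_eq, Complex.sub_re, ← Complex.ofReal_mul,
    Complex.ofReal_re]
  field_simp

lemma moment2_eq (ħ : ℝ) (ψ : 𝓢(Conf n, ℂ)) (j k : PhaseIdx n) :
    moment2 ħ ψ j k = (1 / 2) * ((ip ψ (dS ħ (meanZ ħ ψ) j (dS ħ (meanZ ħ ψ) k ψ))).re +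
      (ip ψ (dS ħ (meanZ ħ ψ) k (dS ħ (meanZ ħ ψ) j ψ))).re) / normSq ψ := by
  rw [moment2, Matrix.of_apply, mean_eq (g := dS ħ (meanZ ħ ψ) j (dS ħ (meanZ ħ ψ) k ψ) +
    dS ħ (meanZ ħ ψ) k (dS ħ (meanZ ħ ψ) j ψ)), ip_add_right, Complex.add_re, mul_div_assoc]
  funext x
  rw [_root_.add_apply, coe_dS, coe_dS, coe_dS, coe_dS]

section Transport

variable {ħ : ℝ} (hħ : 0 < ħ) (S : ℝ) (zt : PhaseIdx n → ℝ) {ψ : 𝓢(Conf n, ℂ)} (hψ : ψ ≠ 0)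
  {T : 𝓢(Conf n, ℂ) →L[ℂ] 𝓢(Conf n, ℂ)} {A : Matrix (PhaseIdx n) (PhaseIdx n) ℝ}
  (hT : IsIntertwiner ħ T A) (hi : ∀ f g, ip (T f) (T g) = ip f g)

include hi in
lemma normSq_evoCLM (zs : PhaseIdx n → ℝ) : normSq (evoCLM ħ S zt zs T ψ) = normSq ψ := by
  have h := ip_evoCLM ħ S zt zs hi ψ ψ
  rw [ip_self, ip_self] at h
  exact_mod_cast h

include hi hψ in
lemma evoCLM_ne_zero (zs : PhaseIdx n → ℝ) : evoCLM ħ S zt zs T ψ ≠ 0 := by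
  intro h
  have h1 := normSq_evoCLM (ħ := ħ) (ψ := ψ) S zt hi zs
  rw [h] at h1
  have h2 : normSq (0 : 𝓢(Conf n, ℂ)) = 0 := by simp [normSq]
  exact (normSq_pos hψ).ne' (h1.symm.trans h2)

-- The centred first moments of ψ vanish. They are carried linearly into the first moments of the
-- image centred at `zt`, which therefore vanish as well.
include hħ hT hi hψ in
lemma meanZ_evoCLM : meanZ ħ (evoCLM ħ S zt (meanZ ħ ψ) T ψ) = zt := by
  funext k
  have h1 := re_ip_dS (ħ := ħ) (evoCLM_ne_zero (ħ := ħ) S zt hψ hi (meanZ ħ ψ)) zt k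
  rw [dS_evoCLM hħ S zt _ hT, ip_evoCLM _ _ _ _ hi, ip_sum_right, Complex.re_sum] at h1
  have h2 : ∀ l, (ip ψ ((A k l : ℂ) • dS ħ (meanZ ħ ψ) l ψ)).re = 0 := fun l => by
    rw [ip_smul_right, Complex.re_ofReal_mul, re_ip_dS hψ, sub_self, zero_mul, mul_zero]
  simp only [h2, Finset.sum_const_zero] at h1
  rcases mul_eq_zero.1 h1.symm with h | h
  · exact sub_eq_zero.1 h
  · exact absurd h (normSq_pos (evoCLM_ne_zero (ħ := ħ) S zt hψ hi (meanZ ħ ψ))).ne'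

-- Each of the two centred operators contributes one factor A, and inner products are preserved.
-- Symmetrization absorbs the interchange of the two indices.
include hħ hT hi hψ in
lemma moment2_evoCLM : moment2 ħ (evoCLM ħ S zt (meanZ ħ ψ) T ψ) = A * moment2 ħ ψ * Aᵀ := by
  have hd : ∀ j k, (ip (evoCLM ħ S zt (meanZ ħ ψ) T ψ)
      (dS ħ zt j (dS ħ zt k (evoCLM ħ S zt (meanZ ħ ψ) T ψ)))).re =
      ∑ m, (∑ l, A j l * (ip ψ (dS ħ (meanZ ħ ψ) l (dS ħ (meanZ ħ ψ) m ψ))).re) * A k m := by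
    intro j k
    rw [dS_evoCLM hħ S zt _ hT, dS_evoCLM hħ S zt _ hT, ip_evoCLM _ _ _ _ hi]
    simp only [dS_sum_smul, ip_sum_right, ip_smul_right, Complex.re_sum, Complex.re_ofReal_mul,
      Finset.sum_mul, Finset.mul_sum]
    rw [Finset.sum_comm]
    exact Finset.sum_congr rfl fun m _ => Finset.sum_congr rfl fun l _ => by ring
  ext j k
  rw [moment2_eq, meanZ_evoCLM hħ S zt hψ hT hi, hd, hd, normSq_evoCLM S zt hi, Matrix.mul_apply]
  simp only [Matrix.mul_apply, Matrix.transpose_apply, moment2_eq]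
  have h3 : ∑ m, (∑ l, A k l * (ip ψ (dS ħ (meanZ ħ ψ) l (dS ħ (meanZ ħ ψ) m ψ))).re) * A j m =
      ∑ m, (∑ l, A j l * (ip ψ (dS ħ (meanZ ħ ψ) m (dS ħ (meanZ ħ ψ) l ψ))).re) * A k m := by
    simp only [Finset.sum_mul]
    rw [Finset.sum_comm]
    exact Finset.sum_congr rfl fun m _ => Finset.sum_congr rfl fun l _ => by ring
  rw [h3, ← Finset.sum_add_distrib, Finset.mul_sum, Finset.sum_div]
  refine Finset.sum_congr rfl fun m _ => ?_
  rw [← add_mul, ← Finset.sum_add_distrib, ← mul_assoc, Finset.mul_sum, ← div_mul_eq_mul_div,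
    Finset.sum_div]
  congr 1
  exact Finset.sum_congr rfl fun l _ => by ring

end Transport

end

section

variable {n : ℕ} {D : Coeffs n}

/-! ### The evolution operator in terms of the propagator -/

lemma shift_eq (z : PhaseIdx n → ℝ) (x : Conf n) : shift z x = cvec (x - posOf z) := by
  funext j
  simp [shift, cvec, posOf]

lemma exp_mom (ħ : ℝ) (z : PhaseIdx n → ℝ) (v : Conf n) :
    Complex.exp (Complex.I / ħ * (mom z ⬝ᵥ cvec v)) = planeWave ħ (momOf z) v := by
  rw [planeWave]
  congr 1
  simp only [dotProduct, cvec, mom, momOf]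
  push_cast
  ring

lemma exp_neg_mom (ħ : ℝ) (z : PhaseIdx n → ℝ) (v : Conf n) :
    Complex.exp (Complex.I / ħ * -(mom z ⬝ᵥ cvec v)) = planeWave ħ (-momOf z) v := by
  rw [planeWave]
  congr 1
  simp only [dotProduct, cvec, mom, momOf, Pi.neg_apply, neg_mul, Finset.sum_neg_distrib]
  push_cast
  ring

/-- The matrices λ are transposed blocks of the matriciant, and a scalar product does not
distinguish a matrix from its transpose on equal vectors. After centring y, the Green function
splits into the action phase, two plane waves and a packet. -/
lemma gaussKernel_eq (ħ : ℝ) (r : ℂ) (a b c d : Matrix (Fin n) (Fin n) ℝ) (ε S : ℝ)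
    (zt zs : PhaseIdx n → ℝ) (x y : Conf n) :
    gaussKernel ħ r (cplx d)ᵀ (frameM c d ε)ᵀ (frameL a b ε)ᵀ S zt zs x (y + posOf zs) =
      Complex.exp (Complex.I / ħ * S) * planeWave ħ (momOf zt) (x - posOf zt) *
        (packet ħ r a b c d ε y (x - posOf zt) * planeWave ħ (-momOf zs) y) := by
  rw [gaussKernel, shift_eq, shift_eq, add_sub_cancel_right, packet, gauss, quadPhase,
    ← exp_mom, ← exp_neg_mom]
  generalize x - posOf zt = v
  have e1 : cvec y ⬝ᵥ (((cplx d)ᵀ * (frameM c d ε)ᵀ⁻¹) *ᵥ cvec y) =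
      cvec y ⬝ᵥ (((frameM c d ε)⁻¹ * cplx d) *ᵥ cvec y) := by
    rw [← Matrix.transpose_nonsing_inv, ← Matrix.transpose_mul, ← dotProduct_mulVec_symm]
  have e2 : cvec v ⬝ᵥ (((frameM c d ε)ᵀ⁻¹ * (frameL a b ε)ᵀ) *ᵥ cvec v) =
      -(cvec v ⬝ᵥ (frameG a b c d ε *ᵥ cvec v)) := by
    rw [← Matrix.transpose_nonsing_inv, ← Matrix.transpose_mul, ← dotProduct_mulVec_symm, frameG,
      Matrix.neg_mulVec, dotProduct_neg, neg_neg]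
  rw [e1, e2, ← Matrix.transpose_nonsing_inv, dotProduct_comm (cvec v) ((frameM c d ε)⁻¹ᵀ *ᵥ _)]
  have hexp : ∀ A B C E F : ℂ, Complex.exp A * Complex.exp B * (r⁻¹ * Complex.exp C *
      Complex.exp E * Complex.exp F) = r⁻¹ * Complex.exp (A + B + C + E + F) := by
    intro A B C E F
    simp only [Complex.exp_add]
    ring
  rw [hexp]
  congr 2
  ring

lemma integral_gaussKernel (ħ : ℝ) (r : ℂ) (a b c d : Matrix (Fin n) (Fin n) ℝ) (ε S : ℝ)
    (zt zs : PhaseIdx n → ℝ) (ψ : 𝓢(Conf n, ℂ)) (x : Conf n) :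
    ∫ y, gaussKernel ħ r (cplx d)ᵀ (frameM c d ε)ᵀ (frameL a b ε)ᵀ S zt zs x y * ψ y =
      Complex.exp (Complex.I / ħ * S) * planeWave ħ (momOf zt) (x - posOf zt) *
        ∫ y, packet ħ r a b c d ε y (x - posOf zt) * weylInv ħ zs ψ y := by
  rw [← integral_add_right_eq_self _ (posOf zs), ← integral_const_mul]
  congr 1; funext y
  rw [gaussKernel_eq, weylInv_apply]
  ring

section Evolution

variable (hD : D.IsContinuous) (hS : D.IsSymmetric) {ħ κ : ℝ} (hħ : 0 < ħ) {ψ : 𝓢(Conf n, ℂ)}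

/-- The increment of the action along the trajectory of `ψ`. -/
def actionIncr (D : Coeffs n) (ħ κ t s : ℝ) (ψ : Conf n → ℂ) : ℝ :=
  action D (kappaTilde κ ψ) (trajectory D ħ κ s ψ) t -
    action D (kappaTilde κ ψ) (trajectory D ħ κ s ψ) s

/-- The evolution operator on Schwartz functions, for a given propagator. -/
def evoS (D : Coeffs n) (ħ κ t s : ℝ) (ψ : 𝓢(Conf n, ℂ))
    (T : 𝓢(Conf n, ℂ) →L[ℂ] 𝓢(Conf n, ℂ)) : 𝓢(Conf n, ℂ) :=
  evoCLM ħ (actionIncr D ħ κ t s ψ) (trajectory D ħ κ s ψ t).1 (trajectory D ħ κ s ψ s).1 T ψ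

include hD hS hħ

lemma tendsto_evolutionReg {t s : ℝ} {T : 𝓢(Conf n, ℂ) →L[ℂ] 𝓢(Conf n, ℂ)}
    (hT : IsPropagator D ħ (kappaTilde κ ψ) t s T) (x : Conf n) :
    Tendsto (fun ε => evolutionReg D ħ κ ε t s ψ x) (𝓝[>] 0) (𝓝 (evoS D ħ κ t s ψ T x)) := by
  have h := (hT.tendsto_integral_wave hD hS hħ (weylInv ħ (trajectory D ħ κ s ψ s).1 ψ)
    (x - posOf (trajectory D ħ κ s ψ t).1)).const_mul
      (Complex.exp (Complex.I / ħ * actionIncr D ħ κ t s ψ) *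
        planeWave ħ (momOf (trajectory D ħ κ s ψ t).1) (x - posOf (trajectory D ħ κ s ψ t).1))
  rw [evoS, evoCLM_apply, _root_.smul_apply, weyl_apply, smul_eq_mul, ← mul_assoc]
  refine h.congr fun ε => ?_
  rw [evolutionReg]
  simp only [greenReg, lam1_eq, lam3Reg_eq, lam4Reg_eq, integral_gaussKernel]
  rfl

/-- Both branches of the definition give the same operator: outside caustics by the Green function
formula, at caustics by the regularized limit, which is shown to exist. -/
lemma evolution_eq_evoS {t s : ℝ} {T : 𝓢(Conf n, ℂ) →L[ℂ] 𝓢(Conf n, ℂ)}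
    (hT : IsPropagator D ħ (kappaTilde κ ψ) t s T) :
    evolution D ħ κ t s ψ = evoS D ħ κ t s ψ T := by
  funext x
  rw [evolution]
  split_ifs with hdet
  · have h3 : cplx (lam3 D (kappaTilde κ ψ) t s) =
        (frameM (blkC D (kappaTilde κ ψ) t s) (blkD D (kappaTilde κ ψ) t s) 0)ᵀ := by
      rw [frameM_zero, Matrix.transpose_transpose]
    have h4 : cplx (lam4 D (kappaTilde κ ψ) t s) =
        (frameL (blkA D (kappaTilde κ ψ) t s) (blkB D (kappaTilde κ ψ) t s) 0)ᵀ := by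
      ext i j
      simp [frameL, lam4]
    simp only [green, lam1_eq, h3, h4, integral_gaussKernel]
    rw [hT.integral_green hD hS hħ hdet, evoS, evoCLM_apply, _root_.smul_apply, weyl_apply,
      smul_eq_mul, ← mul_assoc]
    rfl
  · exact (tendsto_evolutionReg hD hS hħ hT x).limUnder_eq

lemma evolution_self (s : ℝ) : evolution D ħ κ s s ψ = ψ := by
  obtain ⟨T, hT⟩ := exists_isPropagator hD hS hħ (kappaTilde κ ψ) s s
  rw [evolution_eq_evoS hD hS hħ hT]
  have : evoS D ħ κ s s ψ T = ψ := by
    rw [evoS, evoCLM_apply, hT.eq_id hD hħ, weyl_weylInv, actionIncr, sub_self]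
    simp
  rw [this]

omit hħ in
lemma trajectory_self (s : ℝ) (φ : Conf n → ℂ) :
    trajectory D ħ κ s φ s = (meanZ ħ φ, moment2 ħ φ) :=
  (hesSolution_spec hD hS _ s _).1

variable (hψ : ψ ≠ 0)
include hψ

omit hD hS hħ in
lemma evoS_ne_zero {t s : ℝ} {T : 𝓢(Conf n, ℂ) →L[ℂ] 𝓢(Conf n, ℂ)}
    (hT : IsPropagator D ħ (kappaTilde κ ψ) t s T) : evoS D ħ κ t s ψ T ≠ 0 :=
  evoCLM_ne_zero _ _ hψ hT.ip_map _

/-- The state moves along the trajectory which it started on. -/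
lemma trajectory_evoS {t s : ℝ} {T : 𝓢(Conf n, ℂ) →L[ℂ] 𝓢(Conf n, ℂ)}
    (hT : IsPropagator D ħ (kappaTilde κ ψ) t s T) :
    kappaTilde κ (evoS D ħ κ t s ψ T) = kappaTilde κ ψ ∧
      trajectory D ħ κ t (evoS D ħ κ t s ψ T) = trajectory D ħ κ s ψ := by
  have h0 := trajectory_self hD hS (ħ := ħ) (κ := κ) s ψ
  have hk : kappaTilde κ (evoS D ħ κ t s ψ T) = kappaTilde κ ψ := by
    rw [kappaTilde, kappaTilde, evoS, normSq_evoCLM _ _ hT.ip_map]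
  refine ⟨hk, ?_⟩
  have hz : meanZ ħ (evoS D ħ κ t s ψ T) = (trajectory D ħ κ s ψ t).1 := by
    rw [evoS, h0]
    exact meanZ_evoCLM hħ _ _ hψ hT.intertwiner hT.ip_map
  have hm : moment2 ħ (evoS D ħ κ t s ψ T) = (trajectory D ħ κ s ψ t).2 := by
    rw [evoS, h0, moment2_evoCLM hħ _ _ hψ hT.intertwiner hT.ip_map, trajectory,
      hesSolution_snd hD hS]
  -- The norm and the moments of the evolved state are the data of the old curve at time t, so that
  -- curve solves the Cauchy problem posed there.
  rw [trajectory, hk, hz, hm]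
  exact hesSolution_restart hD hS _ s t _

/-- The flow property. -/
lemma evolution_flow (t r s : ℝ) : evolution D ħ κ t s ψ =
    evolution D ħ κ t r (evolution D ħ κ r s ψ) := by
  obtain ⟨T, hT⟩ := exists_isPropagator hD hS hħ (kappaTilde κ ψ) t s
  obtain ⟨T₁, hT₁⟩ := exists_isPropagator hD hS hħ (kappaTilde κ ψ) t r
  obtain ⟨T₂, hT₂⟩ := exists_isPropagator hD hS hħ (kappaTilde κ ψ) r s
  -- Conservation of ϰ̃ lets the propagator `T₁`, built for the initial state, act on the
  -- intermediate state.
  obtain ⟨hk, htr⟩ := trajectory_evoS hD hS hħ hψ hT₂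
  rw [evolution_eq_evoS hD hS hħ hT₂, evolution_eq_evoS hD hS hħ hT,
    evolution_eq_evoS hD hS hħ (T := T₁) (by rw [hk]; exact hT₁)]
  congr 1
  have hact : actionIncr D ħ κ t r (evoS D ħ κ r s ψ T₂) =
      action D (kappaTilde κ ψ) (trajectory D ħ κ s ψ) t -
        action D (kappaTilde κ ψ) (trajectory D ħ κ s ψ) r := by
    rw [actionIncr, hk, htr]
  rw [evoS.eq_1 D ħ κ t r, hact, htr, evoS, evoS, evoCLM_evoCLM, hT.comp_eq hD hS hħ hT₁ hT₂,
    actionIncr, actionIncr, sub_add_sub_cancel]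

end Evolution

/-! ### Time-independent coefficients -/

section Autonomous

variable (hD : D.IsContinuous) (hS : D.IsSymmetric) (hA : D.IsAutonomous)
include hA

lemma effHess_autonomous (κt t t' : ℝ) : effHess D κt t = effHess D κt t' := by
  rw [effHess, effHess, (hA t).1, (hA t).2.2.1, (hA t').1, (hA t').2.2.1]

-- A time shift of the matriciant solves the same equation, since the generator is constant, with
-- the same initial value.
include hD in
lemma matriciant_autonomous (κt t s : ℝ) :
    matriciant D κt (t + s) s = matriciant D κt t 0 := by
  refine congrFun (matrix_solution_unique hD κt (s := 0)
    (A := fun t => matriciant D κt (t + s) s) (B := fun t => matriciant D κt t 0) (fun t => ?_)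
    (fun t => hasMDerivAt_matriciant hD κt 0 t) ?_) t
  · rw [effHess_autonomous hA κt t (t + s)]
    intro i j
    exact (hasMDerivAt_matriciant hD κt s (t + s) i j).comp_add_const t s
  · simp [matriciant_self hD]

include hD hS in
lemma rootReg_autonomous {ħ ε : ℝ} (hħ : 0 < ħ) (hε : 0 < ε) (κt t s : ℝ) :
    rootReg D ħ κt ε (t + s) s = rootReg D ħ κt ε t 0 := by
  rw [rootReg_eq hD hS hħ hε, rootReg_eq hD hS hħ hε]
  have h1 : ∀ τ, flowRate D κt ε τ 0 = flowRate D κt ε (τ + s) s := by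
    intro τ
    simp only [flowRate, blkA, blkB, blkC, blkD, matriciant_autonomous hD hA,
      effHess_autonomous hA κt τ (τ + s)]
  simp only [h1]
  rw [intervalIntegral.integral_comp_add_right (fun τ => flowRate D κt ε τ s), zero_add]

include hD hS in
lemma IsPropagator.autonomous {ħ : ℝ} (hħ : 0 < ħ) {κt t s : ℝ}
    {T : 𝓢(Conf n, ℂ) →L[ℂ] 𝓢(Conf n, ℂ)} (hT : IsPropagator D ħ κt (t + s) s T) :
    IsPropagator D ħ κt t 0 T := by
  refine ⟨?_, hT.ip_map, fun ε hε y x => ?_⟩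
  · rw [← matriciant_autonomous hD hA κt t s]
    exact hT.intertwiner
  · rw [hT.map_heatAt ε hε, wave, wave, rootReg_autonomous hD hS hA hħ hε]
    simp only [blkA, blkB, blkC, blkD, matriciant_autonomous hD hA]

include hD hS in
lemma hesSolution_autonomous (κt s t : ℝ)
    (g₀ : (PhaseIdx n → ℝ) × Matrix (PhaseIdx n) (PhaseIdx n) ℝ) :
    hesSolution D κt s g₀ (t + s) = hesSolution D κt 0 g₀ t := by
  obtain ⟨h1, h2, h3⟩ := hesSolution_spec hD hS κt s g₀
  have h : IsHESSolution D κt 0 g₀ (fun τ => hesSolution D κt s g₀ (τ + s)) := by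
    refine ⟨by beta_reduce; rw [zero_add, h1], fun t k => ?_, fun t j k => ?_⟩
    · have := (h2 (t + s) k).comp_add_const t s
      rw [(hA t).1, (hA t).2.1, (hA t).2.2.1, (hA t).2.2.2.1]
      rwa [(hA (t + s)).1, (hA (t + s)).2.1, (hA (t + s)).2.2.1, (hA (t + s)).2.2.2.1] at this
    · have := (h3 (t + s) j k).comp_add_const t s
      rwa [effHess_autonomous hA κt (t + s) t] at this
  rw [hesSolution_eq hD hS h]

lemma effZero_autonomous (κt t t' : ℝ)
    (g : (PhaseIdx n → ℝ) × Matrix (PhaseIdx n) (PhaseIdx n) ℝ) :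
    effZero D κt t g = effZero D κt t' g := by
  obtain ⟨h1, h2, h3, h4, h5⟩ := hA t
  obtain ⟨h1', h2', h3', h4', h5'⟩ := hA t'
  rw [effZero, effZero, h1, h2, h3, h4, h5, h1', h2', h3', h4', h5']

end Autonomous

/-- The Lagrangian along a solution of the Hamilton–Ehrenfest system is continuous. -/
lemma continuous_lagrangian (hD : D.IsContinuous) {κt s : ℝ}
    {g₀ : (PhaseIdx n → ℝ) × Matrix (PhaseIdx n) (PhaseIdx n) ℝ}
    {g : ℝ → (PhaseIdx n → ℝ) × Matrix (PhaseIdx n) (PhaseIdx n) ℝ}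
    (hg : IsHESSolution D κt s g₀ g) : Continuous fun τ =>
      (∑ j, (g τ).1 (Sum.inl j) * deriv (fun σ => (g σ).1 (Sum.inr j)) τ) -
        effZero D κt τ (g τ) := by
  obtain ⟨-, h2, h3⟩ := hg
  obtain ⟨c1, c2, c3, c4, c5⟩ := hD
  have hz : Continuous fun τ => (g τ).1 := continuous_pi fun k =>
    continuous_iff_continuousAt.2 fun t => (h2 t k).continuousAt
  have hΔ : Continuous fun τ => (g τ).2 := continuous_pi fun j => continuous_pi fun k =>
    continuous_iff_continuousAt.2 fun t => (h3 t j k).continuousAt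
  simp only [fun j τ => (h2 τ (Sum.inr j)).deriv]
  have hv : Continuous fun τ => Matrix.J (Fin n) ℝ *ᵥ
      (D.Hz τ + (D.Hzz τ + κt • (D.Wzz τ + D.Wzw τ)) *ᵥ (g τ).1) :=
    continuous_const.matrix_mulVec (c2.add ((c1.add ((c3.add c4).const_smul κt)).matrix_mulVec hz))
  refine Continuous.sub (continuous_finsetSum _ fun j _ => ?_) ?_
  · exact ((continuous_apply _).comp hz).mul ((continuous_apply _).comp hv)
  · unfold effZero
    have hq := (c1.add (((c3.add (c4.const_smul (2 : ℝ))).add c5).const_smul κt)).matrix_mulVec hz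
    exact ((continuous_const.mul (hz.dotProduct hq)).add (c2.dotProduct hz)).add
      (continuous_const.mul (c5.matrix_mul hΔ).matrix_trace)

/-- The increment of the action is the integral of the Lagrangian over [s, t + s]; a translation of
time carries it to [0, t], where the shifted curve is the solution started at 0. Subtracting the two
integrals from 0 requires integrability, which continuity of the Lagrangian provides. -/
lemma action_sub_autonomous (hD : D.IsContinuous) (hS : D.IsSymmetric) (hA : D.IsAutonomous)
    (κt s t : ℝ) (g₀ : (PhaseIdx n → ℝ) × Matrix (PhaseIdx n) (PhaseIdx n) ℝ) :
    action D κt (hesSolution D κt s g₀) (t + s) - action D κt (hesSolution D κt s g₀) s =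
      action D κt (hesSolution D κt 0 g₀) t - action D κt (hesSolution D κt 0 g₀) 0 := by
  have hc := continuous_lagrangian hD (hesSolution_spec hD hS κt s g₀)
  have h1 : ∀ τ, hesSolution D κt 0 g₀ τ = hesSolution D κt s g₀ (τ + s) :=
    fun τ => (hesSolution_autonomous hD hS hA κt s τ g₀).symm
  simp only [action]
  rw [intervalIntegral.integral_interval_sub_left (hc.intervalIntegrable _ _)
    (hc.intervalIntegrable _ _), intervalIntegral.integral_same, sub_zero]
  simp only [h1]
  have h2 : ∀ (j : Fin n) (τ : ℝ),
      deriv (fun σ => (hesSolution D κt s g₀ (σ + s)).1 (Sum.inr j)) τ =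
      deriv (fun σ => (hesSolution D κt s g₀ σ).1 (Sum.inr j)) (τ + s) := fun j τ =>
    deriv_comp_add_const (fun σ => (hesSolution D κt s g₀ σ).1 (Sum.inr j)) s τ
  have h3 : ∀ τ, effZero D κt τ (hesSolution D κt s g₀ (τ + s)) =
      effZero D κt (τ + s) (hesSolution D κt s g₀ (τ + s)) := fun τ =>
    effZero_autonomous hA κt τ (τ + s) _
  simp_rw [h2, h3]
  rw [intervalIntegral.integral_comp_add_right (fun τ =>
    (∑ j, (hesSolution D κt s g₀ τ).1 (Sum.inl j) *
      deriv (fun σ => (hesSolution D κt s g₀ σ).1 (Sum.inr j)) τ) -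
        effZero D κt τ (hesSolution D κt s g₀ τ)), zero_add]

/-- The evolution operator of time-independent coefficients is invariant under time shifts. -/
lemma evolution_autonomous (hD : D.IsContinuous) (hS : D.IsSymmetric) (hA : D.IsAutonomous)
    {ħ κ : ℝ} (hħ : 0 < ħ) (ψ : 𝓢(Conf n, ℂ)) (t s : ℝ) :
    evolution D ħ κ (t + s) s ψ = evolution D ħ κ t 0 ψ := by
  obtain ⟨T, hT⟩ := exists_isPropagator hD hS hħ (kappaTilde κ ψ) (t + s) s
  rw [evolution_eq_evoS hD hS hħ hT, evolution_eq_evoS hD hS hħ (hT.autonomous hD hS hA hħ)]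
  congr 1
  rw [evoS, evoS, actionIncr, actionIncr, trajectory_self hD hS, trajectory_self hD hS,
    trajectory, trajectory, action_sub_autonomous hD hS hA, hesSolution_autonomous hD hS hA]

end

end NonlocalGP

end

/-! ### The main theorem -/

open NonlocalGP in
theorem mainTheorem4 (n : ℕ) (D : Coeffs n) (hcont : D.IsContinuous) (hsymm : D.IsSymmetric)
    (ħ κ : ℝ) (hħ : 0 < ħ) (ψ : 𝓢(Conf n, ℂ)) (hψ : ψ ≠ 0) :
    (∀ t s x, Tendsto (fun ε => evolutionReg D ħ κ ε t s ψ x) (𝓝[>] (0 : ℝ))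
      (𝓝 (evolution D ħ κ t s ψ x))) ∧
    (∀ s, evolution D ħ κ s s ψ = ψ) ∧
    (∀ t s, ∃ Φ : 𝓢(Conf n, ℂ), Φ ≠ 0 ∧ ⇑Φ = evolution D ħ κ t s ψ) ∧
    (∀ t s, evolution₀ D ħ κ (t + s) ψ = evolution D ħ κ (t + s) s (evolution₀ D ħ κ s ψ)) ∧
    (D.IsAutonomous → ∀ t s,
      evolution₀ D ħ κ (t + s) ψ = evolution₀ D ħ κ t (evolution₀ D ħ κ s ψ)) := by
  refine ⟨fun t s x => ?_, fun s => evolution_self hcont hsymm hħ s, fun t s => ?_,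
    fun t s => evolution_flow hcont hsymm hħ hψ (t + s) s 0, fun hA t s => ?_⟩
  · obtain ⟨T, hT⟩ := exists_isPropagator hcont hsymm hħ (kappaTilde κ ψ) t s
    rw [evolution_eq_evoS hcont hsymm hħ hT]
    exact tendsto_evolutionReg hcont hsymm hħ hT x
  · obtain ⟨T, hT⟩ := exists_isPropagator hcont hsymm hħ (kappaTilde κ ψ) t s
    exact ⟨evoS D ħ κ t s ψ T, evoS_ne_zero hψ hT, (evolution_eq_evoS hcont hsymm hħ hT).symm⟩
  -- The intermediate state is first exhibited as a Schwartz function, so that invariance under time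
  -- shifts applies to the second factor of the flow property.
  · obtain ⟨T, hT⟩ := exists_isPropagator hcont hsymm hħ (kappaTilde κ ψ) s 0
    have h := evolution_flow (κ := κ) hcont hsymm hħ hψ (t + s) s 0
    rw [evolution_eq_evoS hcont hsymm hħ hT, evolution_autonomous hcont hsymm hA hħ] at h
    rw [evolution₀, evolution₀, evolution₀, evolution_eq_evoS hcont hsymm hħ hT]
    exact h
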